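/- Let $\Bbbk$ be an algebraically closed field and let $R$ be a finite-dimensional Gorenstein $\Bbbk$-algebra, i.e. a finite-dimensional associative $\Bbbk$-algebra which has finite injective dimension as a left and as a right module over itself. Let $\operatorname{GP}(R)$ be the category of finitely generated $R$-modules $X$ with $\operatorname{Ext}^i_R(X,R)=0$ for all $i>0$. Let $\operatorname{GP}_{\mathcal P}(R)$ be any Frobenius exact structure on $\operatorname{GP}(R)$, i.e. any Quillen exact structure on the additive category $\operatorname{GP}(R)$ which has enough projective and enough injective objects and whose class $\mathcal P$ of projective objects equals its class of injective objects. Let $\underline{\operatorname{GP}}_{\mathcal P}(R)=\operatorname{GP}(R)/\mathcal P$ be its stable category, with the cosyzygy functor $\Sigma$ as suspension. The quiver of a $\Bbbk$-linear category $\mathcal A$ has the isomorphism classes $[X]$ of indecomposable objects of $\mathcal A$ as vertices, and an arrow $[X]\to[Y]$ if and only if $\operatorname{rad}_{\mathcal A}(X,Y)/\operatorname{rad}^2_{\mathcal A}(X,Y)\neq 0$. The quiver underlying the Auslander–Reiten quiver of $\underline{\operatorname{GP}}_{\mathcal P}(R)$ is the quiver of the category $\underline{\operatorname{GP}}_{\mathcal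 P}(R)$. (a) The Auslander–Reiten quiver of $\underline{\operatorname{GP}}_{\mathcal P}(R)$ has no loops. (b) Suppose that $\underline{\operatorname{GP}}_{\mathcal P}(R)$ is $2$-Calabi–Yau, i.e. that $\Sigma^2$ is a Serre functor: $\operatorname{Hom}(X,Y)\cong \operatorname{Hom}_{\Bbbk}(\operatorname{Hom}(Y,\Sigma^2X),\Bbbk)$ naturally in $X$ and $Y$. Then the quiver of every cluster-tilting subcategory $\mathcal T$ of $\underline{\operatorname{GP}}_{\mathcal P}(R)$ has neither loops nor $2$-cycles, and the quiver of every cluster-tilting object $T$ of $\underline{\operatorname{GP}}_{\mathcal P}(R)$, that is the quiver of the category $\operatorname{add}T$, has neither loops nor $2$-cycles. Here a full subcategory $\mathcal T$ is cluster-tilting if $\operatorname{Hom}(T,\Sigma T')=0$ for all $T,T'\in\mathcal T$, every object $X$ with $\operatorname{Hom}(T,\Sigma X)=0$ for all $T\in\mathcal T$ lies in $\mathcal T$, and $\mathcal T$ is functorially finite (every object has a left and a right $\mathcal T$-approximation). An object $T$ is cluster-tilting if $\operatorname{Hom}(T,\Sigma T)=0$ and every object $X$ with $\operatorname{Hom}(T,\Sigma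 X)=0$ lies in $\operatorname{add}T$, the class of direct summands of finite direct sums of copies of $T$. -/

import Mathlib

open CategoryTheory CategoryTheory.Limits

universe w v u

noncomputable section

/-! ## Exact categories (Quillen) -/

section Exact

variable {E : Type u} [Category.{v} E] [Preadditive E]

/-- For a class `S` of short sequences: `i` is the first map of a member of `S`. -/
def IsInflationOf (S : ShortComplex E → Prop) {X Y : E} (i : X ⟶ Y) : Prop :=
  ∃ (Z : E) (p : Y ⟶ Z) (h : i ≫ p = 0), S (ShortComplex.mk i p h)

/-- For a class `S` of short sequences: `p` is the second map of a member of `S`. -/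
def IsDeflationOf (S : ShortComplex E → Prop) {Y Z : E} (p : Y ⟶ Z) : Prop :=
  ∃ (X : E) (i : X ⟶ Y) (h : i ≫ p = 0), S (ShortComplex.mk i p h)

variable (E) in
/-- A (Quillen) exact structure on the additive category `E`: a class of kernel-cokernel pairs
(the conflations), closed under isomorphism, such that identities are inflations and deflations,
inflations and deflations are closed under composition, inflations are stable under push-out
along arbitrary morphisms and deflations are stable under pull-back along arbitrary morphisms. -/
structure ExactStructure [HasFiniteBiproducts E] where
  conflation : ShortComplex E → Prop
  conflation_of_iso : ∀ {S T : ShortComplex E}, (S ≅ T) → conflation S → conflation T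
  isKernel : ∀ {S : ShortComplex E}, conflation S → Nonempty (IsLimit (KernelFork.ofι S.f S.zero))
  isCokernel : ∀ {S : ShortComplex E}, conflation S →
    Nonempty (IsColimit (CokernelCofork.ofπ S.g S.zero))
  inflation_id : ∀ X : E, IsInflationOf conflation (𝟙 X)
  deflation_id : ∀ X : E, IsDeflationOf conflation (𝟙 X)
  inflation_comp : ∀ {X Y Z : E} (i : X ⟶ Y) (j : Y ⟶ Z), IsInflationOf conflation i →
    IsInflationOf conflation j → IsInflationOf conflation (i ≫ j)
  deflation_comp : ∀ {X Y Z : E} (p : X ⟶ Y) (q : Y ⟶ Z), IsDeflationOf conflation p →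
    IsDeflationOf conflation q → IsDeflationOf conflation (p ≫ q)
  exists_pushout : ∀ {X Y X' : E} (i : X ⟶ Y) (f : X ⟶ X'), IsInflationOf conflation i →
    ∃ (Y' : E) (f' : Y ⟶ Y') (i' : X' ⟶ Y'), IsPushout i f f' i' ∧ IsInflationOf conflation i'
  exists_pullback : ∀ {Y Z Z' : E} (p : Y ⟶ Z) (f : Z' ⟶ Z), IsDeflationOf conflation p →
    ∃ (Y' : E) (f' : Y' ⟶ Y) (p' : Y' ⟶ Z'), IsPullback f' p' p f ∧ IsDeflationOf conflation p'

namespace ExactStructure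

variable [HasFiniteBiproducts E] (𝓢 : ExactStructure E)

def IsInflation {X Y : E} (i : X ⟶ Y) : Prop := IsInflationOf 𝓢.conflation i

def IsDeflation {Y Z : E} (p : Y ⟶ Z) : Prop := IsDeflationOf 𝓢.conflation p

/-- The projective objects of the exact category. -/
def IsProj (P : E) : Prop :=
  ∀ ⦃Y Z : E⦄ (p : Y ⟶ Z), 𝓢.IsDeflation p → ∀ f : P ⟶ Z, ∃ g : P ⟶ Y, g ≫ p = f

/-- The injective objects of the exact category. -/
def IsInj (I : E) : Prop :=
  ∀ ⦃X Y : E⦄ (i : X ⟶ Y), 𝓢.IsInflation i → ∀ f : X ⟶ I, ∃ g : Y ⟶ I, i ≫ g = f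

end ExactStructure

variable (E) in
/-- A Frobenius exact structure: an exact structure with enough projectives and enough injectives
in which the projective and the injective objects coincide. -/
structure FrobeniusStructure [HasFiniteBiproducts E] extends ExactStructure E where
  enough_proj : ∀ X : E, ∃ (P : E) (p : P ⟶ X), toExactStructure.IsProj P ∧
    toExactStructure.IsDeflation p
  enough_inj : ∀ X : E, ∃ (I : E) (i : X ⟶ I), toExactStructure.IsInj I ∧
    toExactStructure.IsInflation i
  proj_iff_inj : ∀ X : E, toExactStructure.IsProj X ↔ toExactStructure.IsInj X

/-! ## The stable category of a Frobenius exact category, with its suspension -/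

namespace FrobeniusStructure

variable [HasFiniteBiproducts E] (𝓕 : FrobeniusStructure E)

/-- The morphisms of the ideal by which the stable category is formed: those that factor through
a projective object. -/
def Negligible {X Y : E} (f : X ⟶ Y) : Prop :=
  ∃ (P : E) (a : X ⟶ P) (b : P ⟶ Y), 𝓕.IsProj P ∧ a ≫ b = f

/-- Two parallel morphisms are identified when their difference factors through a projective. -/
def stableRel : HomRel E := fun _ _ f g => 𝓕.Negligible (f - g)

lemma isProj_biprod [HasBinaryBiproducts E] {P Q : E} (hP : 𝓕.IsProj P) (hQ : 𝓕.IsProj Q) :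
    𝓕.IsProj (P ⊞ Q) := by
  intro Y Z p hp f
  obtain ⟨g, hg⟩ := hP p hp (biprod.inl ≫ f)
  obtain ⟨h, hh⟩ := hQ p hp (biprod.inr ≫ f)
  exact ⟨biprod.desc g h, by ext <;> simp [hg, hh]⟩

lemma negligible_add {X Y : E} {f g : X ⟶ Y} (hf : 𝓕.Negligible f) (hg : 𝓕.Negligible g) :
    𝓕.Negligible (f + g) := by
  obtain ⟨P, a, b, hP, rfl⟩ := hf
  obtain ⟨Q, c, d, hQ, rfl⟩ := hg
  have : HasBinaryBiproducts E := hasBinaryBiproducts_of_finite_biproducts E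
  exact ⟨P ⊞ Q, biprod.lift a c, biprod.desc b d, 𝓕.isProj_biprod hP hQ, by simp⟩

lemma negligible_neg {X Y : E} {f : X ⟶ Y} (hf : 𝓕.Negligible f) : 𝓕.Negligible (-f) := by
  obtain ⟨P, a, b, hP, rfl⟩ := hf
  exact ⟨P, -a, b, hP, by simp⟩

lemma negligible_zero (X Y : E) : 𝓕.Negligible (0 : X ⟶ Y) := by
  obtain ⟨P, p, hP, -⟩ := 𝓕.enough_proj Y
  exact ⟨P, 0, p, hP, by simp⟩

lemma negligible_smul {k : Type w} [Semiring k] [Linear k E] (a : k) {X Y : E} {f : X ⟶ Y}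
    (hf : 𝓕.Negligible f) : 𝓕.Negligible (a • f) := by
  obtain ⟨P, c, d, hP, rfl⟩ := hf
  exact ⟨P, a • c, d, hP, by simp⟩

instance : Congruence 𝓕.stableRel where
  equivalence :=
    { refl := fun f => by simpa [stableRel] using 𝓕.negligible_zero _ _
      symm := fun {f g} h => by simpa [stableRel] using 𝓕.negligible_neg h
      trans := fun {f g h} h₁ h₂ => by simpa [stableRel] using 𝓕.negligible_add h₁ h₂ }
  comp_left := by
    intro X Y Z f g g' h
    obtain ⟨P, a, b, hP, hab⟩ := h
    exact ⟨P, f ≫ a, b, hP, by simp [hab]⟩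
  comp_right := by
    intro X Y Z f f' g h
    obtain ⟨P, a, b, hP, hab⟩ := h
    exact ⟨P, a, b ≫ g, hP, by rw [← Category.assoc, hab, Preadditive.sub_comp]⟩

/-- The stable category: the additive quotient of `E` by the projective objects. -/
abbrev Stable : Type u := CategoryTheory.Quotient 𝓕.stableRel

lemma stableRel_add ⦃X Y : E⦄ (f₁ f₂ g₁ g₂ : X ⟶ Y) (hf : 𝓕.stableRel f₁ f₂)
    (hg : 𝓕.stableRel g₁ g₂) : 𝓕.stableRel (f₁ + g₁) (f₂ + g₂) := by
  have := 𝓕.negligible_add hf hg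
  rwa [← add_sub_add_comm] at this

instance : Preadditive 𝓕.Stable := CategoryTheory.Quotient.preadditive _ 𝓕.stableRel_add

instance : (CategoryTheory.Quotient.functor 𝓕.stableRel).Additive :=
  CategoryTheory.Quotient.functor_additive _ 𝓕.stableRel_add

instance (k : Type w) [Semiring k] [Linear k E] : Linear k 𝓕.Stable :=
  CategoryTheory.Quotient.linear k 𝓕.stableRel (fun a _ _ _ _ h => by
    have := 𝓕.negligible_smul a h
    rwa [smul_sub] at this)

/-- The injective object `I X` in a chosen conflation `X ↣ I X ↠ Σ X`. -/
def hull (X : E) : E := (𝓕.enough_inj X).choose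

def toHull (X : E) : X ⟶ 𝓕.hull X := (𝓕.enough_inj X).choose_spec.choose

lemma isInj_hull (X : E) : 𝓕.IsInj (𝓕.hull X) := (𝓕.enough_inj X).choose_spec.choose_spec.1

lemma isInflation_toHull (X : E) : 𝓕.IsInflation (𝓕.toHull X) :=
  (𝓕.enough_inj X).choose_spec.choose_spec.2

/-- The cosyzygy `Σ X` in a chosen conflation `X ↣ I X ↠ Σ X`. -/
def cosyzygy (X : E) : E := (𝓕.isInflation_toHull X).choose

def toCosyzygy (X : E) : 𝓕.hull X ⟶ 𝓕.cosyzygy X := (𝓕.isInflation_toHull X).choose_spec.choose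

lemma toHull_toCosyzygy (X : E) : 𝓕.toHull X ≫ 𝓕.toCosyzygy X = 0 :=
  (𝓕.isInflation_toHull X).choose_spec.choose_spec.choose

lemma conflation_cosyzygy (X : E) :
    𝓕.conflation (ShortComplex.mk (𝓕.toHull X) (𝓕.toCosyzygy X) (𝓕.toHull_toCosyzygy X)) :=
  (𝓕.isInflation_toHull X).choose_spec.choose_spec.choose_spec

lemma toCosyzygy_desc {X Y : E} (f : 𝓕.hull X ⟶ Y) (hf : 𝓕.toHull X ≫ f = 0) :
    ∃ g : 𝓕.cosyzygy X ⟶ Y, 𝓕.toCosyzygy X ≫ g = f := by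
  obtain ⟨hc⟩ := 𝓕.isCokernel (𝓕.conflation_cosyzygy X)
  exact ⟨hc.desc (CokernelCofork.ofπ f hf), hc.fac _ WalkingParallelPair.one⟩

lemma toCosyzygy_cancel {X Y : E} {f g : 𝓕.cosyzygy X ⟶ Y}
    (h : 𝓕.toCosyzygy X ≫ f = 𝓕.toCosyzygy X ≫ g) : f = g := by
  obtain ⟨hc⟩ := 𝓕.isCokernel (𝓕.conflation_cosyzygy X)
  exact Cofork.IsColimit.hom_ext hc h

/-- `g : Σ X ⟶ Σ Y` is induced by `f : X ⟶ Y`, through some map `I X ⟶ I Y`. -/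
def IsCosyzygyMap {X Y : E} (f : X ⟶ Y) (g : 𝓕.cosyzygy X ⟶ 𝓕.cosyzygy Y) : Prop :=
  ∃ e : 𝓕.hull X ⟶ 𝓕.hull Y, 𝓕.toHull X ≫ e = f ≫ 𝓕.toHull Y ∧
    𝓕.toCosyzygy X ≫ g = e ≫ 𝓕.toCosyzygy Y

lemma exists_isCosyzygyMap {X Y : E} (f : X ⟶ Y) : ∃ g, 𝓕.IsCosyzygyMap f g := by
  obtain ⟨e, he⟩ := 𝓕.isInj_hull Y _ (𝓕.isInflation_toHull X) (f ≫ 𝓕.toHull Y)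
  obtain ⟨g, hg⟩ := 𝓕.toCosyzygy_desc (e ≫ 𝓕.toCosyzygy Y)
    (by rw [← Category.assoc, he, Category.assoc, toHull_toCosyzygy, comp_zero])
  exact ⟨g, e, he, hg⟩

lemma IsCosyzygyMap.negligible {X Y : E} {f : X ⟶ Y} {g : 𝓕.cosyzygy X ⟶ 𝓕.cosyzygy Y}
    (h : 𝓕.IsCosyzygyMap f g) (hf : 𝓕.Negligible f) : 𝓕.Negligible g := by
  obtain ⟨e, he, hg⟩ := h
  obtain ⟨P, a, b, hP, rfl⟩ := hf
  obtain ⟨a', ha'⟩ := (𝓕.proj_iff_inj P).1 hP _ (𝓕.isInflation_toHull X) a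
  obtain ⟨c, hc⟩ := 𝓕.toCosyzygy_desc (e - a' ≫ b ≫ 𝓕.toHull Y) (by
    rw [Preadditive.comp_sub, he, ← ha']; simp)
  refine ⟨𝓕.hull Y, c, 𝓕.toCosyzygy Y, (𝓕.proj_iff_inj _).2 (𝓕.isInj_hull Y), ?_⟩
  apply 𝓕.toCosyzygy_cancel
  rw [← Category.assoc, hc, hg]
  simp [toHull_toCosyzygy]

lemma IsCosyzygyMap.sub {X Y : E} {f f' : X ⟶ Y} {g g' : 𝓕.cosyzygy X ⟶ 𝓕.cosyzygy Y}
    (h : 𝓕.IsCosyzygyMap f g) (h' : 𝓕.IsCosyzygyMap f' g') :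
    𝓕.IsCosyzygyMap (f - f') (g - g') := by
  obtain ⟨e, he, hg⟩ := h
  obtain ⟨e', he', hg'⟩ := h'
  exact ⟨e - e', by simp [he, he'], by simp [hg, hg']⟩

lemma IsCosyzygyMap.comp {X Y Z : E} {f : X ⟶ Y} {f' : Y ⟶ Z} {g : 𝓕.cosyzygy X ⟶ 𝓕.cosyzygy Y}
    {g' : 𝓕.cosyzygy Y ⟶ 𝓕.cosyzygy Z} (h : 𝓕.IsCosyzygyMap f g) (h' : 𝓕.IsCosyzygyMap f' g') :
    𝓕.IsCosyzygyMap (f ≫ f') (g ≫ g') := by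
  obtain ⟨e, he, hg⟩ := h
  obtain ⟨e', he', hg'⟩ := h'
  exact ⟨e ≫ e', by simp [reassoc_of% he, he'], by simp [reassoc_of% hg, hg']⟩

lemma isCosyzygyMap_id (X : E) : 𝓕.IsCosyzygyMap (𝟙 X) (𝟙 _) := ⟨𝟙 _, by simp, by simp⟩

/-- A chosen map `Σ X ⟶ Σ Y` induced by `f : X ⟶ Y`. -/
def cosyzygyMap {X Y : E} (f : X ⟶ Y) : 𝓕.cosyzygy X ⟶ 𝓕.cosyzygy Y :=
  (𝓕.exists_isCosyzygyMap f).choose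

lemma isCosyzygyMap_cosyzygyMap {X Y : E} (f : X ⟶ Y) :
    𝓕.IsCosyzygyMap f (𝓕.cosyzygyMap f) := (𝓕.exists_isCosyzygyMap f).choose_spec

lemma IsCosyzygyMap.stableRel {X Y : E} {f f' : X ⟶ Y} {g g' : 𝓕.cosyzygy X ⟶ 𝓕.cosyzygy Y}
    (h : 𝓕.IsCosyzygyMap f g) (h' : 𝓕.IsCosyzygyMap f' g') (hf : 𝓕.stableRel f f') :
    𝓕.stableRel g g' :=
  IsCosyzygyMap.negligible 𝓕 (IsCosyzygyMap.sub 𝓕 h h') hf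

lemma stableRel_refl {X Y : E} (f : X ⟶ Y) : 𝓕.stableRel f f :=
  by simpa [FrobeniusStructure.stableRel] using 𝓕.negligible_zero X Y

/-- The suspension of the stable category: the cosyzygy functor `X ↦ Σ X`. -/
def suspension : 𝓕.Stable ⥤ 𝓕.Stable :=
  CategoryTheory.Quotient.lift 𝓕.stableRel
    { obj := fun X => (CategoryTheory.Quotient.functor 𝓕.stableRel).obj (𝓕.cosyzygy X)
      map := fun f => (CategoryTheory.Quotient.functor 𝓕.stableRel).map (𝓕.cosyzygyMap f)
      map_id := fun X => by
        rw [← (CategoryTheory.Quotient.functor 𝓕.stableRel).map_id]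
        exact CategoryTheory.Quotient.sound _ (IsCosyzygyMap.stableRel 𝓕 (𝓕.isCosyzygyMap_cosyzygyMap _)
          (𝓕.isCosyzygyMap_id X) (𝓕.stableRel_refl _))
      map_comp := fun f g => by
        rw [← (CategoryTheory.Quotient.functor 𝓕.stableRel).map_comp]
        exact CategoryTheory.Quotient.sound _ (IsCosyzygyMap.stableRel 𝓕 (𝓕.isCosyzygyMap_cosyzygyMap _)
          (IsCosyzygyMap.comp 𝓕 (𝓕.isCosyzygyMap_cosyzygyMap f) (𝓕.isCosyzygyMap_cosyzygyMap g))
          (𝓕.stableRel_refl _)) }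
    (fun _ _ _ _ h => CategoryTheory.Quotient.sound _ (IsCosyzygyMap.stableRel 𝓕
      (𝓕.isCosyzygyMap_cosyzygyMap _) (𝓕.isCosyzygyMap_cosyzygyMap _) h))

end FrobeniusStructure

end Exact

/-! ## Radical and quiver of an additive category -/

section KrullSchmidt

variable (C : Type u) [Category.{v} C] [Preadditive C]

variable {C} in
/-- `f` lies in the radical `rad(X, Y)` of the category. -/
def IsRadicalHom {X Y : C} (f : X ⟶ Y) : Prop := ∀ g : Y ⟶ X, IsIso (𝟙 X - f ≫ g)

variable {C} in
/-- `f` lies in `rad²(X, Y)`. -/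
def IsRadicalSqHom {X Y : C} (f : X ⟶ Y) : Prop :=
  ∃ (Z : C) (g : X ⟶ Z) (h : Z ⟶ Y), IsRadicalHom g ∧ IsRadicalHom h ∧ g ≫ h = f

/-- The indecomposable objects: nonzero and not a direct sum of two nonzero objects. -/
def isIndecomposable : ObjectProperty C := fun X =>
  ¬ IsZero X ∧ ∀ ⦃Y Z : C⦄ (b : BinaryBicone Y Z), b.IsBilimit → (b.pt ≅ X) → IsZero Y ∨ IsZero Z

/-- Isomorphism classes of indecomposable objects. -/
abbrev IndecClass : Type u :=
  _root_.Quotient (isIsomorphicSetoid (isIndecomposable C).FullSubcategory)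

/-- The quiver (without multiple arrows) of `C`: its vertices are the isomorphism classes of
indecomposable objects, and there is an arrow `[X] → [Y]` iff `rad(X, Y) / rad²(X, Y) ≠ 0`. When `C`
is triangulated with a Serre functor, this is the quiver underlying the Auslander-Reiten quiver
(which carries in addition the multiplicities of the arrows and the translation on the vertices). -/
def categoryQuiver : Digraph (IndecClass C) where
  Adj x y := ∃ X Y : (isIndecomposable C).FullSubcategory, ⟦X⟧ = x ∧ ⟦Y⟧ = y ∧
    ∃ f : X.obj ⟶ Y.obj, IsRadicalHom f ∧ ¬ IsRadicalSqHom f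

end KrullSchmidt

def Digraph.NoLoops {V : Type u} (Q : Digraph V) : Prop := ∀ x, ¬ Q.Adj x x

def Digraph.NoTwoCycles {V : Type u} (Q : Digraph V) : Prop := ∀ x y, ¬ (Q.Adj x y ∧ Q.Adj y x)

/-! ## Calabi-Yau property and cluster-tilting -/

section ClusterTilting

variable {C : Type u} [Category.{v} C] [Preadditive C]

/-- `S` is a Serre functor: an auto-equivalence with `k`-linear isomorphisms
`Hom(X, Y) ≅ D Hom(Y, S X)` natural in `X` and `Y`, where `D` is the `k`-dual. -/
def IsSerreFunctor (k : Type w) [Field k] [Linear k C] (S : C ⥤ C) : Prop :=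
  S.IsEquivalence ∧ ∃ η : ∀ X Y : C, (X ⟶ Y) ≃ₗ[k] Module.Dual k (Y ⟶ S.obj X),
    (∀ (X Y Y' : C) (f : X ⟶ Y) (g : Y ⟶ Y') (h : Y' ⟶ S.obj X),
      η X Y' (f ≫ g) h = η X Y f (g ≫ h)) ∧
    (∀ (X' X Y : C) (e : X' ⟶ X) (f : X ⟶ Y) (h : Y ⟶ S.obj X'),
      η X' Y (e ≫ f) h = η X Y f (h ≫ S.map e))

/-- A category with suspension `T` is 2-Calabi-Yau if `T²` is a Serre functor. -/
def IsTwoCalabiYau (k : Type w) [Field k] [Linear k C] (T : C ⥤ C) : Prop :=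
  IsSerreFunctor k (T ⋙ T)

/-- `X` has a right `𝒯`-approximation and a left `𝒯`-approximation, for every `X`. -/
def IsFunctoriallyFinite (𝒯 : ObjectProperty C) : Prop :=
  (∀ X : C, ∃ (M : C) (f : M ⟶ X), 𝒯 M ∧ ∀ (N : C) (h : N ⟶ X), 𝒯 N → ∃ g : N ⟶ M, g ≫ f = h) ∧
  (∀ X : C, ∃ (M : C) (f : X ⟶ M), 𝒯 M ∧ ∀ (N : C) (h : X ⟶ N), 𝒯 N → ∃ g : M ⟶ N, f ≫ g = h)

/-- `𝒯` is a cluster-tilting (full) subcategory of the 2-Calabi-Yau category `C` with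
suspension `T`. -/
structure IsClusterTiltingSubcategory (T : C ⥤ C) (𝒯 : ObjectProperty C) : Prop where
  rigid : ∀ ⦃X Y : C⦄, 𝒯 X → 𝒯 Y → ∀ f : X ⟶ T.obj Y, f = 0
  maximal : ∀ X : C, (∀ Y : C, 𝒯 Y → ∀ f : Y ⟶ T.obj X, f = 0) → 𝒯 X
  functoriallyFinite : IsFunctoriallyFinite 𝒯

/-- `add M`: the direct summands of finite direct sums of copies of `M`. -/
def addClosure (M : C) : ObjectProperty C := fun X =>
  ∃ (n : ℕ) (b : Bicone (fun _ : Fin n => M)), Nonempty b.IsBilimit ∧ Nonempty (Retract X b.pt)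

/-- `M` is a cluster-tilting object of the 2-Calabi-Yau category `C` with suspension `T`. -/
structure IsClusterTiltingObject (T : C ⥤ C) (M : C) : Prop where
  rigid : ∀ f : M ⟶ T.obj M, f = 0
  maximal : ∀ X : C, (∀ f : M ⟶ T.obj X, f = 0) → addClosure M X

/-- The quiver of a full subcategory. -/
abbrev subcategoryQuiver (𝒯 : ObjectProperty C) : Digraph (IndecClass 𝒯.FullSubcategory) :=
  categoryQuiver 𝒯.FullSubcategory

/-- The quiver of an object `M`: the quiver of the category `add M`. Its vertices are the
isomorphism classes of indecomposable direct summands of `M`. -/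
abbrev objectQuiver (M : C) : Digraph (IndecClass (addClosure M).FullSubcategory) :=
  subcategoryQuiver (addClosure M)

end ClusterTilting

/-! ## Gorenstein rings and Gorenstein projective modules -/

section Gorenstein

/-- A (not necessarily commutative) Gorenstein ring, also called Iwanaga-Gorenstein: two-sided
noetherian and of finite injective dimension as a left and as a right module over itself. -/
structure IsGorensteinRing (R : Type u) [Ring R] : Prop where
  noetherian_left : IsNoetherianRing R
  noetherian_right : IsNoetherianRing Rᵐᵒᵖ
  injdim_left : ∃ n : ℕ, HasInjectiveDimensionLE (ModuleCat.of R R) n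
  injdim_right : ∃ n : ℕ, HasInjectiveDimensionLE (ModuleCat.of Rᵐᵒᵖ Rᵐᵒᵖ) n

/-- Finitely generated modules `M` with `Ext^i(M, R) = 0` for all `i > 0`. -/
def isGorensteinProjective (R : Type u) [Ring R] : ObjectProperty (ModuleCat.{u} R) := fun M =>
  Module.Finite R M ∧ ∀ i : ℕ, 0 < i → Subsingleton (Abelian.Ext M (ModuleCat.of R R) i)

/-- The category of Gorenstein projective modules. -/
abbrev GP (R : Type u) [Ring R] : Type (u + 1) := (isGorensteinProjective R).FullSubcategory

variable {R : Type u} [Ring R]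

lemma isGorensteinProjective_zero : isGorensteinProjective R (ModuleCat.of R PUnit) :=
  ⟨inferInstance, fun i _ => ⟨fun a b => by
    have h : (𝟙 (ModuleCat.of R PUnit.{u + 1})) = 0 := by ext x
    rw [← Abelian.Ext.mk₀_id_comp a, ← Abelian.Ext.mk₀_id_comp b, h]; simp⟩⟩

lemma isGorensteinProjective_biprod {M N : ModuleCat.{u} R} (hM : isGorensteinProjective R M)
    (hN : isGorensteinProjective R N) : isGorensteinProjective R (M ⊞ N) := by
  refine ⟨?_, fun i hi => ⟨fun a b => ?_⟩⟩
  · have := hM.1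
    have := hN.1
    exact Module.Finite.equiv (ModuleCat.biprodIsoProd M N).symm.toLinearEquiv
  · have := hM.2 i hi
    have := hN.2 i hi
    exact Abelian.Ext.biprod_ext (Subsingleton.elim _ _) (Subsingleton.elim _ _)

instance : HasZeroObject (GP R) :=
  ⟨⟨⟨_, isGorensteinProjective_zero⟩, by
    rw [IsZero.iff_id_eq_zero]
    ext x⟩⟩

instance : HasBinaryBiproducts (GP R) :=
  ⟨fun M N => HasBinaryBiproduct.mk
    { bicone :=
        { pt := ⟨M.obj ⊞ N.obj, isGorensteinProjective_biprod M.property N.property⟩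
          fst := ObjectProperty.homMk biprod.fst
          snd := ObjectProperty.homMk biprod.snd
          inl := ObjectProperty.homMk biprod.inl
          inr := ObjectProperty.homMk biprod.inr
          inl_fst := by ext1; simp
          inl_snd := by ext1; simp
          inr_fst := by ext1; simp
          inr_snd := by ext1; simp }
      isBilimit := isBinaryBilimitOfTotal _ (by ext1; exact biprod.total) }⟩

instance : HasFiniteBiproducts (GP R) :=
  have : HasTerminal (GP R) := inferInstance
  have : HasFiniteProducts (GP R) := hasFiniteProducts_of_has_binary_and_terminal
  HasFiniteBiproducts.of_hasFiniteProducts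

end Gorenstein

end

noncomputable section

/-!
On the finitely generated `R`-modules a trace kills nilpotent endomorphisms, because a nilpotent `f`
has the same trace on `ker (f ^ (i + 1))` as on `ker (f ^ i)`. As `R` is Gorenstein, every finitely
generated module has a finite resolution by Gorenstein projectives which is exact relative to
`GP R`, and a trace on `GP R` extends along it by alternating sums; so traces on `GP R` kill
nilpotents. A cluster-tilting `𝒯` of the stable category pulls back to a class in `GP R` relative to
which each object has a presentation of length one, so its traces extend to `GP R` as well.

A radical endomorphism `f` of an indecomposable `X` is nilpotent. Were it not in the square of the
radical, a functional on `End X` killing the square but not `f` would extend to a trace, as in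
Lenzing's no-loop theorem. For a two-cycle `b : X ⟶ Y`, `a : Y ⟶ X` of irreducible maps, choose
functionals `α`, `β` killing the square of the radical with `α b = β a = 1`. The functional
`b' ≫ a' ↦ α b' * β a'` on the paths of length two extends to `End X`: by the Calabi–Yau property,
each map `X ⟶ E` killed by the sink map `E ⟶ X` of `𝒯` factors as a radical map into an object of
`𝒯` followed by a map killed by the sink map. Doing the same at `Y` produces a trace with value `1`
on the nilpotent `b ≫ a`.
-/

/-! ## Triangles in the stable category -/

/-- The exactness properties of a distinguished triangle `A ⟶ B ⟶ D ⟶ S A` on which the argument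
rests; no axiom of a triangulated category beyond them is assumed. -/
structure IsExactTriangle {C : Type u} [Category.{v} C] [Preadditive C] (S : C ⥤ C) {A B D : C}
    (j : A ⟶ B) (q : B ⟶ D) (δ : D ⟶ S.obj A) : Prop where
  comp_right : q ≫ δ = 0
  comp_susp : δ ≫ S.map j = 0
  exact_mid : ∀ {W : C} (f : W ⟶ B), f ≫ q = 0 → ∃ g, g ≫ j = f
  exact_right : ∀ {W : C} (f : W ⟶ D), f ≫ δ = 0 → ∃ g, g ≫ q = f
  exact_susp : ∀ {W : C} (f : W ⟶ S.obj A), f ≫ S.map j = 0 → ∃ g, g ≫ δ = f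
  coexact_mid : ∀ {W : C} (f : B ⟶ W), j ≫ f = 0 → ∃ g, q ≫ g = f

/-- Every morphism `D ⟶ S A` is the third map of an exact triangle. -/
def HasExactTriangles {C : Type u} [Category.{v} C] [Preadditive C] (S : C ⥤ C) : Prop :=
  ∀ ⦃A D : C⦄ (δ : D ⟶ S.obj A), ∃ (B : C) (j : A ⟶ B) (q : B ⟶ D), IsExactTriangle S j q δ

lemma isPullback_biprod_map_id {E : Type u} [Category.{v} E] [Preadditive E]
    [HasBinaryBiproducts E] (X : E) {Y Z : E} (p : Y ⟶ Z) :
    IsPullback (biprod.snd : X ⊞ Y ⟶ Y) (biprod.map (𝟙 X) p) p biprod.snd where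
  w := by simp
  isLimit' := ⟨PullbackCone.IsLimit.mk _ (fun s => biprod.lift (s.snd ≫ biprod.fst) s.fst)
    (fun s => by simp)
    (fun s => by
      ext
      · simp
      · simpa using s.condition)
    (fun s m h₁ h₂ => by
      ext
      · simpa using h₂ =≫ biprod.fst
      · simpa using h₁)⟩

section Exact

variable {E : Type u} [Category.{v} E] [Preadditive E] [HasFiniteBiproducts E]

namespace ExactStructure

variable (𝓢 : ExactStructure E) {A B C : E} {i : A ⟶ B} {p : B ⟶ C} {h : i ≫ p = 0}

section Conflation

variable {𝓢} (hc : 𝓢.conflation (ShortComplex.mk i p h))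

include hc

lemma exists_lift {W : E} (f : W ⟶ B) (hf : f ≫ p = 0) : ∃ g : W ⟶ A, g ≫ i = f := by
  obtain ⟨hl⟩ := 𝓢.isKernel hc
  exact ⟨_, (KernelFork.IsLimit.lift' hl f hf).2⟩

lemma mono_of_conflation : Mono i := by
  obtain ⟨hl⟩ := 𝓢.isKernel hc
  exact mono_of_isLimit_fork hl

lemma exists_desc {W : E} (f : B ⟶ W) (hf : i ≫ f = 0) : ∃ g : C ⟶ W, p ≫ g = f := by
  obtain ⟨hl⟩ := 𝓢.isCokernel hc
  exact ⟨_, (CokernelCofork.IsColimit.desc' hl f hf).2⟩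

lemma epi_of_conflation : Epi p := by
  obtain ⟨hl⟩ := 𝓢.isCokernel hc
  exact epi_of_isColimit_cofork hl

end Conflation

variable {𝓢} in
lemma conflation_of_isKernel (hp : 𝓢.IsDeflation p) (hi : IsLimit (KernelFork.ofι i h)) :
    𝓢.conflation (ShortComplex.mk i p h) := by
  obtain ⟨A', i', h', hc⟩ := hp
  obtain ⟨hi'⟩ := 𝓢.isKernel hc
  refine 𝓢.conflation_of_iso (ShortComplex.isoMk (S₁ := ShortComplex.mk i' p h')
    (hi'.conePointUniqueUpToIso hi) (Iso.refl _) (Iso.refl _) ?_ (by simp)) hc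
  simpa using hi'.conePointUniqueUpToIso_hom_comp hi WalkingParallelPair.zero

variable {𝓢} in
lemma exists_pullback_conflation (hc : 𝓢.conflation (ShortComplex.mk i p h)) {W : E}
    (f : W ⟶ C) : ∃ (W' : E) (i' : A ⟶ W') (p' : W' ⟶ W) (g : W' ⟶ B) (h' : i' ≫ p' = 0),
      𝓢.conflation (ShortComplex.mk i' p' h') ∧ i' ≫ g = i ∧ g ≫ p = p' ≫ f := by
  obtain ⟨W', g, p', hpb, hp'⟩ := 𝓢.exists_pullback p f ⟨A, i, h, hc⟩
  have := mono_of_conflation hc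
  have hw : i ≫ p = 0 ≫ f := by rw [h, zero_comp]
  have : Mono (hpb.lift i 0 hw) := mono_of_mono_fac (hpb.lift_fst i 0 hw)
  refine ⟨W', hpb.lift i 0 hw, p', g, hpb.lift_snd _ _ _, conflation_of_isKernel hp' ?_,
    hpb.lift_fst _ _ _, hpb.w⟩
  refine KernelFork.IsLimit.ofι' _ _ fun l hl => ?_
  have hlift := exists_lift hc (l ≫ g) (by rw [Category.assoc, hpb.w, reassoc_of% hl, zero_comp])
  exact ⟨hlift.choose, hpb.hom_ext (by simp [hlift.choose_spec]) (by simp [hl])⟩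

lemma isDeflation_iso_hom {X Y : E} (e : X ≅ Y) : 𝓢.IsDeflation e.hom := by
  obtain ⟨K, i, h, hc⟩ := 𝓢.deflation_id X
  obtain rfl : i = 0 := by simpa using h
  exact ⟨K, 0, zero_comp, 𝓢.conflation_of_iso (ShortComplex.isoMk
    (S₁ := ShortComplex.mk 0 (𝟙 X) h) (S₂ := ShortComplex.mk 0 e.hom zero_comp)
    (Iso.refl K) (Iso.refl X) e (by simp) (by simp)) hc⟩

lemma isDeflation_zero (X : E) {O : E} (hO : IsZero O) : 𝓢.IsDeflation (0 : X ⟶ O) := by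
  obtain ⟨Z, p, h, hc⟩ := 𝓢.inflation_id X
  obtain rfl : p = 0 := by simpa using h
  have := epi_of_conflation hc
  have hZ : IsZero Z := IsZero.of_epi_zero X Z
  exact ⟨X, 𝟙 X, comp_zero, 𝓢.conflation_of_iso (ShortComplex.isoMk
    (S₁ := ShortComplex.mk (𝟙 X) 0 h) (S₂ := ShortComplex.mk (𝟙 X) 0 comp_zero)
    (Iso.refl X) (Iso.refl X) (hZ.iso hO) (by simp) (by simp)) hc⟩

variable {𝓢} in
lemma isDeflation_of_isPullback {Y Z Z' Y' : E} {p : Y ⟶ Z} {f : Z' ⟶ Z} {f' : Y' ⟶ Y}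
    {p' : Y' ⟶ Z'} (hpb : IsPullback f' p' p f) (hp : 𝓢.IsDeflation p) : 𝓢.IsDeflation p' := by
  obtain ⟨Y'', f'', p'', hpb', hp''⟩ := 𝓢.exists_pullback p f hp
  rw [← hpb.isoIsPullback_hom_snd _ _ hpb']
  exact 𝓢.deflation_comp _ _ (𝓢.isDeflation_iso_hom _) hp''

variable [HasZeroObject E] [HasBinaryBiproducts E]

lemma isDeflation_snd (X Y : E) : 𝓢.IsDeflation (biprod.snd : X ⊞ Y ⟶ Y) :=
  isDeflation_of_isPullback (IsPullback.of_has_biproduct X Y)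
    (𝓢.isDeflation_zero X (isZero_zero E))

variable {𝓢} in
lemma isDeflation_desc {X Y Z : E} (f : X ⟶ Z) {p : Y ⟶ Z} (hp : 𝓢.IsDeflation p) :
    𝓢.IsDeflation (biprod.desc f p) := by
  let shear : X ⊞ Z ≅ X ⊞ Z :=
    { hom := biprod.lift biprod.fst (biprod.desc f (𝟙 Z))
      inv := biprod.lift biprod.fst (biprod.desc (-f) (𝟙 Z)) }
  have hfac : biprod.desc f p = biprod.map (𝟙 X) p ≫ shear.hom ≫ biprod.snd := by
    ext <;> simp [shear]
  rw [hfac]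
  exact 𝓢.deflation_comp _ _ (isDeflation_of_isPullback (isPullback_biprod_map_id X p) hp)
    (𝓢.deflation_comp _ _ (𝓢.isDeflation_iso_hom shear) (𝓢.isDeflation_snd X Z))

end ExactStructure

namespace FrobeniusStructure

open ExactStructure

variable (𝓕 : FrobeniusStructure E)

/-- The projection functor from a Frobenius category to its stable category. -/
abbrev toStable : E ⥤ 𝓕.Stable := CategoryTheory.Quotient.functor 𝓕.stableRel

lemma toStable_map_eq_iff {X Y : E} (f g : X ⟶ Y) :
    𝓕.toStable.map f = 𝓕.toStable.map g ↔ 𝓕.Negligible (f - g) :=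
  CategoryTheory.Quotient.functor_map_eq_iff _ f g

lemma toStable_map_eq_zero_iff {X Y : E} (f : X ⟶ Y) :
    𝓕.toStable.map f = 0 ↔ 𝓕.Negligible f := by
  rw [← 𝓕.toStable.map_zero, toStable_map_eq_iff, sub_zero]

lemma toStable_comp_eq_zero_iff {X Y Z : E} (f : X ⟶ Y) (g : Y ⟶ Z) :
    𝓕.toStable.map f ≫ 𝓕.toStable.map g = 0 ↔ 𝓕.Negligible (f ≫ g) := by
  rw [← Functor.map_comp, toStable_map_eq_zero_iff]

lemma toStable_comp_eq_iff {X Y Z : E} (f : X ⟶ Y) (g : Y ⟶ Z) (l : X ⟶ Z) :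
    𝓕.toStable.map f ≫ 𝓕.toStable.map g = 𝓕.toStable.map l ↔ 𝓕.Negligible (f ≫ g - l) := by
  rw [← Functor.map_comp, toStable_map_eq_iff]

lemma negligible_comp_of_isInj {X P Y : E} (hP : 𝓕.IsInj P) (a : X ⟶ P) (b : P ⟶ Y) :
    𝓕.Negligible (a ≫ b) :=
  ⟨P, a, b, (𝓕.proj_iff_inj P).2 hP, rfl⟩

lemma isDeflation_toCosyzygy (X : E) : 𝓕.IsDeflation (𝓕.toCosyzygy X) :=
  ⟨_, _, _, 𝓕.conflation_cosyzygy X⟩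

lemma toStable_map_cosyzygyMap_add {X Y : E} (f g : X ⟶ Y) :
    𝓕.toStable.map (𝓕.cosyzygyMap (f + g)) =
      𝓕.toStable.map (𝓕.cosyzygyMap f) + 𝓕.toStable.map (𝓕.cosyzygyMap g) := by
  rw [← Functor.map_add]
  apply CategoryTheory.Quotient.sound
  refine IsCosyzygyMap.stableRel 𝓕 (𝓕.isCosyzygyMap_cosyzygyMap _) ?_ (𝓕.stableRel_refl _)
  obtain ⟨e, he, h⟩ := 𝓕.isCosyzygyMap_cosyzygyMap f
  obtain ⟨e', he', h'⟩ := 𝓕.isCosyzygyMap_cosyzygyMap g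
  exact ⟨e + e', by simp [he, he'], by simp [h, h']⟩

instance : 𝓕.suspension.Additive where
  map_add {X Y f g} := by
    obtain ⟨f, rfl⟩ := 𝓕.toStable.map_surjective f
    obtain ⟨g, rfl⟩ := 𝓕.toStable.map_surjective g
    exact 𝓕.toStable_map_cosyzygyMap_add f g

variable {𝓕}

lemma Negligible.exists_lift {X Y Z : E} {f : X ⟶ Z} (hf : 𝓕.Negligible f) {p : Y ⟶ Z}
    (hp : 𝓕.IsDeflation p) : ∃ g : X ⟶ Y, g ≫ p = f := by
  obtain ⟨P, a, b, hP, rfl⟩ := hf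
  obtain ⟨g, rfl⟩ := hP p hp b
  exact ⟨a ≫ g, Category.assoc _ _ _⟩

lemma exists_lift_of_stable_lift {X Y Z : E} (f : X ⟶ Z) {p : Y ⟶ Z} (hp : 𝓕.IsDeflation p)
    (g : 𝓕.toStable.obj X ⟶ 𝓕.toStable.obj Y) (hg : g ≫ 𝓕.toStable.map p = 𝓕.toStable.map f) :
    ∃ g' : X ⟶ Y, g' ≫ p = f := by
  obtain ⟨g, rfl⟩ := 𝓕.toStable.map_surjective g
  rw [toStable_comp_eq_iff] at hg
  obtain ⟨l, hl⟩ := Negligible.exists_lift hg hp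
  exact ⟨g - l, by rw [Preadditive.sub_comp, hl, sub_sub_cancel]⟩

variable (𝓕) in
/-- `c` is the connecting map `C ⟶ Σ A` of a conflation `A ↣ B ↠ C`, obtained by comparing it with
the chosen conflation `A ↣ I A ↠ Σ A`. -/
def IsConnectingMap {A B C : E} (i : A ⟶ B) (p : B ⟶ C) (c : C ⟶ 𝓕.cosyzygy A) : Prop :=
  ∃ b : B ⟶ 𝓕.hull A, i ≫ b = 𝓕.toHull A ∧ p ≫ c = b ≫ 𝓕.toCosyzygy A

section Conflation

variable {A B C : E} {i : A ⟶ B} {p : B ⟶ C} {c : C ⟶ 𝓕.cosyzygy A}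

lemma IsConnectingMap.exists_negligible_comp_sub (h : i ≫ p = 0) (hcn : 𝓕.IsConnectingMap i p c)
    {W : E} (f : W ⟶ 𝓕.cosyzygy A) (hf : 𝓕.Negligible (f ≫ 𝓕.cosyzygyMap i)) :
    ∃ g : W ⟶ C, 𝓕.Negligible (g ≫ c - f) := by
  obtain ⟨b, hb, hbc⟩ := hcn
  obtain ⟨t, ht⟩ := Negligible.exists_lift hf (𝓕.isDeflation_toCosyzygy B)
  obtain ⟨e, he, hi⟩ := 𝓕.isCosyzygyMap_cosyzygyMap i
  obtain ⟨V, a, v, y, hav, hcV, hay, hyv⟩ :=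
    exists_pullback_conflation (𝓕.conflation_cosyzygy A) f
  have := mono_of_conflation (𝓕.conflation_cosyzygy B)
  have := epi_of_conflation hcV
  -- `A ↣ V ↠ W` is the conflation with connecting map `f`; `i` extends along `A ↣ V`.
  obtain ⟨l, hl⟩ := ExactStructure.exists_lift (𝓕.conflation_cosyzygy B) (y ≫ e - v ≫ t) (by
    rw [Preadditive.sub_comp, Category.assoc, Category.assoc, ht, ← hi, reassoc_of% hyv,
      sub_self])
  have hal : a ≫ l = i := by
    rw [← cancel_mono (𝓕.toHull B), Category.assoc, hl, Preadditive.comp_sub, reassoc_of% hay,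
      reassoc_of% hav, he, zero_comp, sub_zero]
  obtain ⟨g, hg⟩ := exists_desc hcV (l ≫ p) (by rw [reassoc_of% hal, h])
  obtain ⟨m, hm⟩ := exists_desc hcV (l ≫ b - y) (by
    rw [Preadditive.comp_sub, reassoc_of% hal, hb, hay, sub_self])
  have hfac : g ≫ c - f = m ≫ 𝓕.toCosyzygy A := by
    rw [← cancel_epi v, reassoc_of% hm, Preadditive.comp_sub, reassoc_of% hg, hbc,
      Preadditive.sub_comp, ← hyv, Category.assoc]
  exact ⟨g, hfac ▸ 𝓕.negligible_comp_of_isInj (𝓕.isInj_hull A) _ _⟩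

variable {h : i ≫ p = 0} (hc : 𝓕.conflation (ShortComplex.mk i p h))

include hc

lemma exists_isConnectingMap : ∃ c, 𝓕.IsConnectingMap i p c := by
  obtain ⟨b, hb⟩ := 𝓕.isInj_hull A i ⟨_, _, _, hc⟩ (𝓕.toHull A)
  obtain ⟨c, hbc⟩ := exists_desc hc (b ≫ 𝓕.toCosyzygy A) (by
    rw [reassoc_of% hb, toHull_toCosyzygy])
  exact ⟨c, b, hb, hbc⟩

lemma exists_negligible_comp_inflation_sub {W : E} (f : W ⟶ B) (hf : 𝓕.Negligible (f ≫ p)) :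
    ∃ g : W ⟶ A, 𝓕.Negligible (g ≫ i - f) := by
  obtain ⟨P, a, d, hP, had⟩ := hf
  obtain ⟨l, rfl⟩ := hP p ⟨_, _, _, hc⟩ d
  obtain ⟨g, hg⟩ := exists_lift hc (f - a ≫ l) (by
    rw [Preadditive.sub_comp, ← had, Category.assoc, sub_self])
  exact ⟨g, by rw [hg, sub_sub_cancel_left]; exact 𝓕.negligible_neg ⟨P, a, l, hP, rfl⟩⟩

lemma exists_negligible_deflation_comp_sub {W : E} (f : B ⟶ W) (hf : 𝓕.Negligible (i ≫ f)) :
    ∃ g : C ⟶ W, 𝓕.Negligible (p ≫ g - f) := by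
  obtain ⟨P, a, d, hP, had⟩ := hf
  obtain ⟨a', ha'⟩ := (𝓕.proj_iff_inj P).1 hP i ⟨_, _, _, hc⟩ a
  obtain ⟨g, hg⟩ := exists_desc hc (f - a' ≫ d) (by
    rw [Preadditive.comp_sub, reassoc_of% ha', had, sub_self])
  exact ⟨g, by rw [hg, sub_sub_cancel_left]; exact 𝓕.negligible_neg ⟨P, a', d, hP, rfl⟩⟩

lemma IsConnectingMap.negligible_comp_cosyzygyMap (hcn : 𝓕.IsConnectingMap i p c) :
    𝓕.Negligible (c ≫ 𝓕.cosyzygyMap i) := by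
  obtain ⟨b, hb, hbc⟩ := hcn
  obtain ⟨e, he, hi⟩ := 𝓕.isCosyzygyMap_cosyzygyMap i
  obtain ⟨t, ht⟩ := exists_desc hc (b ≫ e - 𝓕.toHull B) (by
    rw [Preadditive.comp_sub, reassoc_of% hb, he, sub_self])
  have := epi_of_conflation hc
  have hfac : c ≫ 𝓕.cosyzygyMap i = t ≫ 𝓕.toCosyzygy B := by
    rw [← cancel_epi p, reassoc_of% hbc, hi, reassoc_of% ht, Preadditive.sub_comp,
      toHull_toCosyzygy, sub_zero, Category.assoc]
  rw [hfac]
  exact 𝓕.negligible_comp_of_isInj (𝓕.isInj_hull B) _ _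

-- The pullback of the conflation along `f` splits, as its connecting map `f ≫ c` is negligible.
lemma IsConnectingMap.exists_lift (hcn : 𝓕.IsConnectingMap i p c) {W : E} (f : W ⟶ C)
    (hf : 𝓕.Negligible (f ≫ c)) : ∃ g : W ⟶ B, g ≫ p = f := by
  obtain ⟨b, hb, hbc⟩ := hcn
  obtain ⟨f', hf'⟩ := Negligible.exists_lift hf (𝓕.isDeflation_toCosyzygy A)
  obtain ⟨W', i', p', g, h', hc', hg, hgp⟩ := exists_pullback_conflation hc f
  obtain ⟨r, hr⟩ := ExactStructure.exists_lift (𝓕.conflation_cosyzygy A) (g ≫ b - p' ≫ f') (by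
    rw [Preadditive.sub_comp, Category.assoc, Category.assoc, hf', ← hbc, reassoc_of% hgp,
      sub_self])
  have := mono_of_conflation (𝓕.conflation_cosyzygy A)
  have := epi_of_conflation hc'
  have hir : i' ≫ r = 𝟙 A := by
    rw [← cancel_mono (𝓕.toHull A), Category.assoc, hr, Preadditive.comp_sub, reassoc_of% h',
      reassoc_of% hg, hb, zero_comp, sub_zero, Category.id_comp]
  obtain ⟨s, hs⟩ := exists_desc hc' (𝟙 W' - r ≫ i') (by
    rw [Preadditive.comp_sub, reassoc_of% hir, Category.comp_id, sub_self])
  have hsp : s ≫ p' = 𝟙 W := by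
    rw [← cancel_epi p', reassoc_of% hs, Preadditive.sub_comp, Category.assoc, h', comp_zero,
      sub_zero, Category.id_comp, Category.comp_id]
  exact ⟨s ≫ g, by rw [Category.assoc, hgp, reassoc_of% hsp]⟩

lemma IsConnectingMap.isExactTriangle (hcn : 𝓕.IsConnectingMap i p c) :
    IsExactTriangle 𝓕.suspension (𝓕.toStable.map i) (𝓕.toStable.map p) (𝓕.toStable.map c) where
  comp_right := by
    obtain ⟨b, -, hbc⟩ := hcn
    exact (𝓕.toStable_comp_eq_zero_iff p c).2
      (hbc ▸ 𝓕.negligible_comp_of_isInj (𝓕.isInj_hull A) _ _)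
  comp_susp := (𝓕.toStable_comp_eq_zero_iff c (𝓕.cosyzygyMap i)).2
    (hcn.negligible_comp_cosyzygyMap hc)
  exact_mid f hf := by
    obtain ⟨f, rfl⟩ := 𝓕.toStable.map_surjective f
    obtain ⟨g, hg⟩ := exists_negligible_comp_inflation_sub hc f
      ((𝓕.toStable_comp_eq_zero_iff f p).1 hf)
    exact ⟨𝓕.toStable.map g, (𝓕.toStable_comp_eq_iff g i f).2 hg⟩
  exact_right f hf := by
    obtain ⟨f, rfl⟩ := 𝓕.toStable.map_surjective f
    obtain ⟨g, rfl⟩ := hcn.exists_lift hc f ((𝓕.toStable_comp_eq_zero_iff f c).1 hf)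
    exact ⟨𝓕.toStable.map g, (Functor.map_comp _ _ _).symm⟩
  exact_susp {W} f hf := by
    obtain ⟨f, rfl⟩ := 𝓕.toStable.map_surjective (X := W.as) (Y := 𝓕.cosyzygy A) f
    obtain ⟨g, hg⟩ := hcn.exists_negligible_comp_sub h f
      ((𝓕.toStable_comp_eq_zero_iff f (𝓕.cosyzygyMap i)).1 hf)
    exact ⟨𝓕.toStable.map g, (𝓕.toStable_comp_eq_iff g c f).2 hg⟩
  coexact_mid f hf := by
    obtain ⟨f, rfl⟩ := 𝓕.toStable.map_surjective f
    obtain ⟨g, hg⟩ := exists_negligible_deflation_comp_sub hc f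
      ((𝓕.toStable_comp_eq_zero_iff i f).1 hf)
    exact ⟨𝓕.toStable.map g, (𝓕.toStable_comp_eq_iff p g f).2 hg⟩

end Conflation

variable (𝓕)

lemma hasExactTriangles : HasExactTriangles 𝓕.suspension := by
  intro A D δ
  obtain ⟨c, rfl⟩ := 𝓕.toStable.map_surjective (X := D.as) (Y := 𝓕.cosyzygy A.as) δ
  obtain ⟨B, i, p, b, h, hc, hb, hbc⟩ :=
    exists_pullback_conflation (𝓕.conflation_cosyzygy A.as) c
  exact ⟨_, _, _, IsConnectingMap.isExactTriangle hc ⟨b, hb, hbc.symm⟩⟩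

end FrobeniusStructure

end Exact

/-! ## Fitting idempotents -/

section Fitting

lemma exists_isIdempotentElem_mul_of_isArtinianRing {B : Type*} [CommRing B] [IsArtinianRing B]
    (x : B) : ∃ (y : B) (n : ℕ), IsIdempotentElem (x * y) ∧ x ^ (n + 1) * (1 - x * y) = 0 := by
  obtain ⟨n, y, hy⟩ := IsArtinian.exists_pow_succ_smul_dvd x (1 : B)
  have hxy : x ^ (n + 1) * y = x ^ n := by simpa using hy
  have hpow (m : ℕ) : x ^ (n + m) * y ^ m = x ^ n := by
    induction m with
    | zero => simp
    | succ m ih => linear_combination (x ^ m * y ^ m) * hxy + ih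
  refine ⟨x ^ n * y ^ (n + 1), n, ?_, ?_⟩
  · rw [IsIdempotentElem]
    linear_combination x * y ^ (n + 1) * hpow (n + 1)
  · linear_combination -x * hpow (n + 1)

section Integral

variable (k : Type w) [Field k] {A : Type v} [Ring A] [Algebra k A] [Algebra.IsIntegral k A]

include k

lemma exists_isIdempotentElem_mul (a : A) : ∃ (b : A) (n : ℕ), Commute a b ∧
    IsIdempotentElem (a * b) ∧ a ^ (n + 1) * (1 - a * b) = 0 := by
  let B := Algebra.adjoin k {a}
  have : IsMulCommutative B := Algebra.isMulCommutative_adjoin k (by simp)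
  have : Module.Finite k B :=
    Module.Finite.iff_fg.2 (Algebra.IsIntegral.isIntegral a).fg_adjoin_singleton
  have : IsArtinianRing B := IsArtinianRing.of_finite k B
  let x : B := ⟨a, Algebra.self_mem_adjoin_singleton k a⟩
  obtain ⟨y, n, hidem, hpow⟩ := exists_isIdempotentElem_mul_of_isArtinianRing x
  exact ⟨y, n, congrArg Subtype.val (mul_comm x y), hidem.map B.val, congrArg B.val hpow⟩

lemma exists_isIdempotentElem_lift {B : Type*} [Ring B] (π : A →+* B) (a : A)
    (ha : IsIdempotentElem (π a)) : ∃ e : A, IsIdempotentElem e ∧ π e = π a := by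
  obtain ⟨b, n, -, he, hn⟩ := exists_isIdempotentElem_mul k a
  refine ⟨a * b, he, ?_⟩
  have hzero : π a * (1 - π a * π b) = 0 := by simpa [ha.pow_succ_eq] using congrArg π hn
  rw [mul_sub, mul_one, ← mul_assoc, ha.eq, sub_eq_zero] at hzero
  rw [map_mul, ← hzero]

lemma exists_isNilpotent_lift {B : Type*} [Ring B] (π : A →+* B) (a : A)
    (ha : IsNilpotent (π a)) : ∃ a' : A, IsNilpotent a' ∧ π a' = π a := by
  obtain ⟨b, n, hab, he, hn⟩ := exists_isIdempotentElem_mul k a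
  have hcomm : Commute a (1 - a * b) :=
    (Commute.one_right a).sub_right ((Commute.refl a).mul_right hab)
  refine ⟨a * (1 - a * b), ⟨n + 1, ?_⟩, ?_⟩
  · rw [hcomm.mul_pow, he.one_sub.pow_succ_eq, hn]
  · obtain ⟨m, hm⟩ := ha
    have hzero : π (a * b) = 0 := by
      rw [← he.pow_succ_eq m, hab.mul_pow, map_mul, map_pow, pow_succ, hm, zero_mul, zero_mul]
    rw [map_mul, map_sub, hzero, map_one, sub_zero, mul_one]

end Integral

lemma exists_isNilpotent_sub_algebraMap (k : Type w) [Field k] [IsAlgClosed k] {A : Type v} [Ring A]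
    [Nontrivial A] [Algebra k A] [FiniteDimensional k A]
    (hA : ∀ e : A, IsIdempotentElem e → e = 0 ∨ e = 1) (a : A) :
    ∃ c : k, IsNilpotent (a - algebraMap k A c) := by
  obtain ⟨c, hc⟩ := spectrum.nonempty_of_isAlgClosed_of_finiteDimensional k a
  obtain ⟨b, n, hab, he, hn⟩ := exists_isIdempotentElem_mul k (a - algebraMap k A c)
  rcases hA _ he with h | h
  · exact ⟨c, n + 1, by rwa [h, sub_zero, mul_one] at hn⟩
  · have hunit : IsUnit (a - algebraMap k A c) := ⟨⟨_, b, h, hab.eq ▸ h⟩, rfl⟩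
    refine absurd ?_ hc
    rw [spectrum.mem_resolventSet_iff, ← neg_sub]
    exact hunit.neg

end Fitting

lemma exists_dual_eq_one_of_notMem {k : Type w} [Field k] {V : Type*} [AddCommGroup V] [Module k V]
    (S : Submodule k V) {x : V} (hx : x ∉ S) :
    ∃ φ : V →ₗ[k] k, φ x = 1 ∧ ∀ s ∈ S, φ s = 0 := by
  obtain ⟨φ, hφx, hφS⟩ := Submodule.exists_dual_map_eq_bot_of_notMem hx inferInstance
  refine ⟨(φ x)⁻¹ • φ, by simp [hφx], fun s hs => ?_⟩
  have hφs : φ s ∈ S.map φ := ⟨s, hs, rfl⟩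
  rw [hφS, Submodule.mem_bot] at hφs
  simp [hφs]

/-! ## The radical -/

section Radical

variable {C : Type u} [Category.{v} C] [Preadditive C]

lemma isIso_one_sub_comp_swap {X Y : C} (f : X ⟶ Y) (g : Y ⟶ X) [IsIso (𝟙 X - f ≫ g)] :
    IsIso (𝟙 Y - g ≫ f) := by
  obtain ⟨r, h₁, h₂⟩ := (inferInstance : IsIso (𝟙 X - f ≫ g)).out
  rw [Preadditive.sub_comp, Category.id_comp, Category.assoc, sub_eq_iff_eq_add] at h₁
  rw [Preadditive.comp_sub, Category.comp_id, sub_eq_iff_eq_add] at h₂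
  refine ⟨𝟙 Y + g ≫ r ≫ f, ?_, ?_⟩
  · have h := g ≫= h₁ =≫ f
    simp only [Preadditive.add_comp, Preadditive.comp_add, Category.id_comp, Category.assoc] at h
    simp only [Preadditive.sub_comp, Preadditive.comp_add, Category.id_comp, Category.comp_id,
      Category.assoc]
    rw [← sub_eq_zero] at h ⊢
    rw [← h]
    abel
  · have h := g ≫= h₂ =≫ f
    simp only [Preadditive.add_comp, Preadditive.comp_add, Category.id_comp, Category.assoc] at h
    simp only [Preadditive.add_comp, Preadditive.comp_sub, Category.id_comp, Category.comp_id,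
      Category.assoc]
    rw [← sub_eq_zero] at h ⊢
    rw [← h]
    abel

namespace IsRadicalHom

variable {X Y Z : C}

lemma comp_right {f : X ⟶ Y} (hf : IsRadicalHom f) (g : Y ⟶ Z) : IsRadicalHom (f ≫ g) :=
  fun h => by
    rw [Category.assoc]
    exact hf (g ≫ h)

lemma comp_left {g : Y ⟶ Z} (hg : IsRadicalHom g) (f : X ⟶ Y) : IsRadicalHom (f ≫ g) := by
  intro h
  have : IsIso (𝟙 Y - (g ≫ h) ≫ f) := by
    rw [Category.assoc]
    exact hg (h ≫ f)
  rw [Category.assoc]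
  exact isIso_one_sub_comp_swap (g ≫ h) f

lemma add {f g : X ⟶ Y} (hf : IsRadicalHom f) (hg : IsRadicalHom g) : IsRadicalHom (f + g) := by
  intro h
  have := hf h
  have := hg (h ≫ inv (𝟙 X - f ≫ h))
  have hfac : 𝟙 X - (f + g) ≫ h =
      (𝟙 X - g ≫ h ≫ inv (𝟙 X - f ≫ h)) ≫ (𝟙 X - f ≫ h) := by
    rw [Preadditive.sub_comp, Category.id_comp, Category.assoc, Category.assoc, IsIso.inv_hom_id,
      Category.comp_id, Preadditive.add_comp, sub_sub]
  rw [hfac]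
  infer_instance

lemma zero : IsRadicalHom (0 : X ⟶ Y) := by
  intro h
  rw [zero_comp, sub_zero]
  infer_instance

end IsRadicalHom

/-- A class of objects closed under direct sums and direct summands. -/
structure IsAdditiveClass [HasBinaryBiproducts C] (𝒯 : ObjectProperty C) : Prop where
  biprod : ∀ {X Y : C}, 𝒯 X → 𝒯 Y → 𝒯 (X ⊞ Y)
  retract : ∀ {X Y : C}, Retract X Y → 𝒯 Y → 𝒯 X

/-- `f` lies in the square of the radical of the full subcategory `𝒯`; its source and target need
not lie in `𝒯`. -/
def IsRadicalSqIn (𝒯 : ObjectProperty C) {X Y : C} (f : X ⟶ Y) : Prop :=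
  ∃ (Z : C) (g : X ⟶ Z) (h : Z ⟶ Y), 𝒯 Z ∧ IsRadicalHom g ∧ IsRadicalHom h ∧ g ≫ h = f

variable {𝒯 : ObjectProperty C}

lemma IsRadicalSqIn.isRadicalHom {X Y : C} {f : X ⟶ Y} (hf : IsRadicalSqIn 𝒯 f) :
    IsRadicalHom f := by
  obtain ⟨Z, g, h, -, hg, -, rfl⟩ := hf
  exact hg.comp_right h

variable (k : Type w) [Field k] [Linear k C]

/-- The radical `rad(X, Y)` as a subspace of `Hom(X, Y)`. -/
def radicalSubmodule (X Y : C) : Submodule k (X ⟶ Y) where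
  carrier := {f | IsRadicalHom f}
  add_mem' := IsRadicalHom.add
  zero_mem' := IsRadicalHom.zero
  smul_mem' c f hf := by
    have hfac : c • f = f ≫ (c • 𝟙 Y) := by simp
    exact hfac ▸ IsRadicalHom.comp_right hf _

/-- The subspace of the morphisms `X ⟶ Y` in `rad²` of the full subcategory `𝒯`. -/
def radicalSqSubmodule [HasBinaryBiproducts C] (h𝒯 : IsAdditiveClass 𝒯) {X : C} (hX : 𝒯 X)
    (Y : C) : Submodule k (X ⟶ Y) where
  carrier := {f | IsRadicalSqIn 𝒯 f}
  add_mem' := by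
    rintro _ _ ⟨Z, g, h, hZ, hg, hh, rfl⟩ ⟨Z', g', h', hZ', hg', hh', rfl⟩
    refine ⟨Z ⊞ Z', biprod.lift g g', biprod.desc h h', h𝒯.biprod hZ hZ', ?_, ?_, by simp⟩
    · rw [biprod.lift_eq]
      exact (hg.comp_right _).add (hg'.comp_right _)
    · rw [biprod.desc_eq]
      exact (hh.comp_left _).add (hh'.comp_left _)
  zero_mem' := ⟨X, 0, 0, hX, .zero, .zero, by simp⟩
  smul_mem' := by
    rintro c _ ⟨Z, g, h, hZ, hg, hh, rfl⟩
    exact ⟨Z, g, c • h, hZ, hg, (radicalSubmodule k Z Y).smul_mem c hh, by simp⟩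

/-! ## Local objects -/

/-- A nonzero object whose endomorphism ring is local with residue field `k` and nil radical: each
endomorphism is a scalar plus a nilpotent. -/
def IsLocalObject (X : C) : Prop :=
  ¬ IsZero X ∧ ∀ f : X ⟶ X, ∃ c : k, IsNilpotent (End.of (f - c • 𝟙 X))

variable {k}

namespace IsLocalObject

variable {X : C}

lemma id_ne_zero (hX : IsLocalObject k X) : 𝟙 X ≠ 0 := fun h =>
  hX.1 ((IsZero.iff_id_eq_zero X).2 h)

lemma isIso_or_isNilpotent (hX : IsLocalObject k X) (f : X ⟶ X) :
    IsIso f ∨ IsNilpotent (End.of f) := by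
  obtain ⟨c, hc⟩ := hX.2 f
  obtain rfl | h0 := eq_or_ne c 0
  · exact .inr (by simpa using hc)
  · left
    have hunit : IsUnit (End.of (c • 𝟙 X)) := by
      rw [isUnit_iff_isIso]
      exact ⟨c⁻¹ • 𝟙 X, by simp [smul_smul, h0], by simp [smul_smul, h0]⟩
    have hcomm : Commute (End.of (f - c • 𝟙 X)) (End.of (c • 𝟙 X)) := by
      simp [Commute, SemiconjBy, End.mul_def]
    rw [← isUnit_iff_isIso, ← add_sub_cancel (c • 𝟙 X) f]
    exact hc.isUnit_add_left_of_commute hunit hcomm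

lemma isIso_of_not_isIso_one_sub (hX : IsLocalObject k X) (f : X ⟶ X)
    (hf : ¬ IsIso (𝟙 X - f)) : IsIso f := by
  have hunit := ((hX.isIso_or_isNilpotent _).resolve_left hf).isUnit_one_sub
  rw [← isUnit_iff_isIso, ← sub_sub_cancel (𝟙 X) f]
  exact hunit

lemma exists_retraction (hX : IsLocalObject k X) {Q : C} (g : X ⟶ Q) (hg : ¬ IsRadicalHom g) :
    ∃ s : Q ⟶ X, g ≫ s = 𝟙 X := by
  obtain ⟨h, hh⟩ := not_forall.1 hg
  have := hX.isIso_of_not_isIso_one_sub _ hh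
  exact ⟨h ≫ inv (g ≫ h), by rw [← Category.assoc, IsIso.hom_inv_id]⟩

lemma exists_section (hX : IsLocalObject k X) {Q : C} (g : Q ⟶ X) (hg : ¬ IsRadicalHom g) :
    ∃ s : X ⟶ Q, s ≫ g = 𝟙 X := by
  obtain ⟨h, hh⟩ := not_forall.1 hg
  have := hX.isIso_of_not_isIso_one_sub (h ≫ g) fun _ => hh (isIso_one_sub_comp_swap h g)
  exact ⟨inv (h ≫ g) ≫ h, by rw [Category.assoc, IsIso.inv_hom_id]⟩

lemma not_isRadicalHom_id (hX : IsLocalObject k X) : ¬ IsRadicalHom (𝟙 X) := by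
  intro h
  have := h (𝟙 X)
  rw [Category.id_comp, sub_self] at this
  exact hX.id_ne_zero (by rw [← IsIso.hom_inv_id (0 : X ⟶ X), zero_comp])

lemma isRadicalHom_iff_isNilpotent (hX : IsLocalObject k X) (f : X ⟶ X) :
    IsRadicalHom f ↔ IsNilpotent (End.of f) := by
  constructor
  · intro h
    refine (hX.isIso_or_isNilpotent f).resolve_left fun hf => hX.not_isRadicalHom_id ?_
    rw [← IsIso.hom_inv_id f]
    exact h.comp_right _
  · rintro ⟨n, hn⟩
    by_contra hf
    obtain ⟨s, hs⟩ := hX.exists_retraction f hf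
    have hpow := pow_mul_pow_eq_one n (show End.of s * End.of f = 1 from hs)
    rw [hn, mul_zero] at hpow
    exact hX.id_ne_zero hpow.symm

lemma exists_isRadicalHom_sub (hX : IsLocalObject k X) (f : X ⟶ X) :
    ∃ c : k, IsRadicalHom (f - c • 𝟙 X) := by
  obtain ⟨c, hc⟩ := hX.2 f
  exact ⟨c, (hX.isRadicalHom_iff_isNilpotent _).2 hc⟩

lemma eq_zero_of_isRadicalHom_smul (hX : IsLocalObject k X) {c : k}
    (h : IsRadicalHom (c • 𝟙 X)) : c = 0 := by
  by_contra hc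
  apply hX.not_isRadicalHom_id
  have hmem := (radicalSubmodule k X X).smul_mem c⁻¹ h
  rwa [smul_smul, inv_mul_cancel₀ hc, one_smul] at hmem

lemma isRadicalHom_of_forall_isRadicalHom (hX : IsLocalObject k X) {Q : C}
    (h : ∀ f : X ⟶ Q, IsRadicalHom f) (g : Q ⟶ X) : IsRadicalHom g := by
  by_contra hg
  obtain ⟨s, hs⟩ := hX.exists_section g hg
  exact hX.not_isRadicalHom_id (hs ▸ (h s).comp_right g)

lemma exists_complement [IsIdempotentComplete C] [∀ X Y : C, FiniteDimensional k (X ⟶ Y)]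
    (hX : IsLocalObject k X) {Q : C} (a : X ⟶ Q) (b : Q ⟶ X) (hab : a ≫ b = 𝟙 X) :
    ∃ (Y : C) (i : Y ⟶ Q) (p : Q ⟶ Y), i ≫ p = 𝟙 Y ∧ b ≫ a + p ≫ i = 𝟙 Q ∧
      Module.finrank k (Y ⟶ Y) < Module.finrank k (Q ⟶ Q) := by
  obtain ⟨Y, i, p, hip, hpi⟩ := IsIdempotentComplete.idempotents_split Q (𝟙 Q - b ≫ a) (by
    simp [reassoc_of% hab])
  refine ⟨Y, i, p, hip, by rw [hpi, add_sub_cancel], ?_⟩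
  have hap : a ≫ p = 0 := by
    rw [← Category.comp_id p, ← hip, reassoc_of% hpi]
    simp [reassoc_of% hab]
  let φ : (Y ⟶ Y) →ₗ[k] (Q ⟶ Q) := Linear.leftComp k Q p ∘ₗ Linear.rightComp k Y i
  have hφ (f) : φ f = p ≫ f ≫ i := rfl
  have hinj : Function.Injective φ := by
    intro f g h
    rw [hφ, hφ] at h
    simpa [reassoc_of% hip, hip] using i ≫= h =≫ p
  refine lt_of_le_of_ne (LinearMap.finrank_le_finrank_of_injective hinj) fun h => ?_
  obtain ⟨f, hf⟩ := (LinearMap.injective_iff_surjective_of_finrank_eq_finrank h).1 hinj (𝟙 Q)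
  apply hX.id_ne_zero
  rw [← hab, ← Category.comp_id a, ← hf, hφ, reassoc_of% hap, zero_comp, zero_comp]

theorem split_induction [IsIdempotentComplete C] [∀ X Y : C, FiniteDimensional k (X ⟶ Y)]
    {ι : Type*} {G : ι → C} (hG : ∀ a, IsLocalObject k (G a)) {motive : C → Prop}
    (free : ∀ Q, (∀ a (f : G a ⟶ Q), IsRadicalHom f) → motive Q)
    (split : ∀ (Q Y : C) a (u : G a ⟶ Q) (v : Q ⟶ G a) (i : Y ⟶ Q) (p : Q ⟶ Y),
      i ≫ p = 𝟙 Y → v ≫ u + p ≫ i = 𝟙 Q → motive Y → motive Q) (Q : C) : motive Q := by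
  induction hn : Module.finrank k (Q ⟶ Q) using Nat.strong_induction_on generalizing Q with
  | _ n ih =>
  subst hn
  by_cases hfree : ∀ a (f : G a ⟶ Q), IsRadicalHom f
  · exact free Q hfree
  · push Not at hfree
    obtain ⟨a, u, hu⟩ := hfree
    obtain ⟨v, huv⟩ := (hG a).exists_retraction u hu
    obtain ⟨Y, i, p, hip, htotal, hlt⟩ := (hG a).exists_complement u v huv
    exact split Q Y a u v i p hip htotal (ih _ hlt Y rfl)

lemma apply_comp_comm {Z : C} (hZ : IsLocalObject k Z) (φ : (Z ⟶ Z) →ₗ[k] k)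
    (hφ : ∀ f g : Z ⟶ Z, IsRadicalHom f → IsRadicalHom g → φ (f ≫ g) = 0) (f g : Z ⟶ Z) :
    φ (f ≫ g) = φ (g ≫ f) := by
  obtain ⟨c, hc⟩ := hZ.exists_isRadicalHom_sub f
  obtain ⟨d, hd⟩ := hZ.exists_isRadicalHom_sub g
  have hfg := hφ _ _ hc hd
  have hgf := hφ _ _ hd hc
  simp only [Preadditive.sub_comp, Preadditive.comp_sub, Linear.smul_comp, Linear.comp_smul,
    Category.id_comp, Category.comp_id, map_sub, map_smul, smul_eq_mul] at hfg hgf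
  linear_combination hfg - hgf

lemma isIso_of_not_isRadicalHom {Y : C} (hX : IsLocalObject k X) (hY : IsLocalObject k Y)
    (f : X ⟶ Y) (hf : ¬ IsRadicalHom f) : IsIso f := by
  obtain ⟨s, hs⟩ := hX.exists_retraction f hf
  rcases hY.isIso_or_isNilpotent (s ≫ f) with h | h
  · have : IsSplitEpi f := ⟨⟨inv (s ≫ f) ≫ s, by rw [Category.assoc, IsIso.inv_hom_id]⟩⟩
    have : IsSplitMono f := ⟨⟨s, hs⟩⟩
    exact isIso_of_epi_of_isSplitMono f
  · have hrad := (hY.isRadicalHom_iff_isNilpotent _).2 h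
    have hid : f ≫ (s ≫ f) ≫ s = 𝟙 X := by simp [hs]
    exact (hX.not_isRadicalHom_id (hid ▸ (hrad.comp_right s).comp_left f)).elim

end IsLocalObject

lemma notMem_radicalSqSubmodule_sup_span_id [HasBinaryBiproducts C] {X : C} (h𝒯 : IsAdditiveClass 𝒯)
    (hX𝒯 : 𝒯 X) (hX : IsLocalObject k X) {f : X ⟶ X} (hf : IsRadicalHom f)
    (hsq : ¬ IsRadicalSqIn 𝒯 f) :
    f ∉ radicalSqSubmodule k h𝒯 hX𝒯 X ⊔ k ∙ 𝟙 X := by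
  intro h
  obtain ⟨s, hs, _, hy, hsf⟩ := Submodule.mem_sup.1 h
  obtain ⟨c, rfl⟩ := Submodule.mem_span_singleton.1 hy
  have hrad : IsRadicalHom (c • 𝟙 X) := by
    rw [← add_sub_cancel_left s (c • 𝟙 X), hsf]
    exact (radicalSubmodule k X X).sub_mem hf (IsRadicalSqIn.isRadicalHom hs)
  rw [hX.eq_zero_of_isRadicalHom_smul hrad, zero_smul, add_zero] at hsf
  exact hsq (hsf ▸ hs)

lemma isLocalObject_of_idempotents [IsAlgClosed k] {X : C} [FiniteDimensional k (X ⟶ X)]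
    (h0 : ¬ IsZero X) (hX : ∀ e : X ⟶ X, e ≫ e = e → e = 0 ∨ e = 𝟙 X) : IsLocalObject k X := by
  refine ⟨h0, fun f => ?_⟩
  have : Nontrivial (End X) := ⟨𝟙 X, 0, fun h => h0 ((IsZero.iff_id_eq_zero X).2 h)⟩
  have : FiniteDimensional k (End X) := ‹FiniteDimensional k (X ⟶ X)›
  obtain ⟨c, hc⟩ := exists_isNilpotent_sub_algebraMap k (A := End X) hX f
  exact ⟨c, by rwa [Algebra.algebraMap_eq_smul_one] at hc⟩

lemma comp_eq_zero_of_idempotents_comp_eq_zero {X Y Z : C} {i : Y ⟶ X} {p : X ⟶ Y} {j : Z ⟶ X}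
    {q : X ⟶ Z} (hip : i ≫ p = 𝟙 Y) (hjq : j ≫ q = 𝟙 Z) (h : (p ≫ i) ≫ q ≫ j = 0) :
    i ≫ q = 0 := by
  simpa [reassoc_of% hip, hjq] using i ≫= h =≫ q

lemma isIndecomposable_idempotent [IsIdempotentComplete C] {X : C} (hX : isIndecomposable C X)
    (e : X ⟶ X) (he : e ≫ e = e) : e = 0 ∨ e = 𝟙 X := by
  obtain ⟨Y, i, p, hip, hpi⟩ := IsIdempotentComplete.idempotents_split X e he
  obtain ⟨Z, j, q, hjq, hqj⟩ := IsIdempotentComplete.idempotents_split X (𝟙 X - e)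
    (Idempotents.idem_of_id_sub_idem e he)
  have hiq : i ≫ q = 0 :=
    comp_eq_zero_of_idempotents_comp_eq_zero hip hjq (by simp [hpi, hqj, he])
  have hjp : j ≫ p = 0 :=
    comp_eq_zero_of_idempotents_comp_eq_zero hjq hip (by simp [hpi, hqj, he])
  let b : BinaryBicone Y Z := ⟨X, p, q, i, j, hip, hiq, hjp, hjq⟩
  rcases hX.2 b (isBinaryBilimitOfTotal b (by simp [b, hpi, hqj])) (Iso.refl X) with h | h
  · exact .inl (by rw [← hpi, h.eq_zero_of_tgt p, zero_comp])
  · rw [h.eq_zero_of_tgt q, zero_comp] at hqj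
    exact .inr (sub_eq_zero.1 hqj.symm).symm

end Radical

/-! ## Traces -/

section Traces

variable {C : Type u} [Category.{v} C] [Preadditive C]

/-- A trace on a class of objects, with values in an abelian group. -/
structure ObjectTrace (P : ObjectProperty C) (A : Type w) [AddCommGroup A] where
  tr : ∀ X : C, P X → (X ⟶ X) → A
  map_add : ∀ (X : C) (hX : P X) (f g : X ⟶ X), tr X hX (f + g) = tr X hX f + tr X hX g
  comm : ∀ (X Y : C) (hX : P X) (hY : P Y) (f : X ⟶ Y) (g : Y ⟶ X),
    tr X hX (f ≫ g) = tr Y hY (g ≫ f)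

namespace ObjectTrace

variable {P : ObjectProperty C} {A : Type w} [AddCommGroup A] (t : ObjectTrace P A)

lemma map_zero (X : C) (hX : P X) : t.tr X hX 0 = 0 := by
  simpa using t.map_add X hX 0 0

lemma map_sub (X : C) (hX : P X) (f g : X ⟶ X) :
    t.tr X hX (f - g) = t.tr X hX f - t.tr X hX g := by
  rw [eq_sub_iff_add_eq, ← t.map_add, sub_add_cancel]

/-- The inverse image of a trace under an additive functor. -/
def comap {D : Type*} [Category* D] [Preadditive D] (F : D ⥤ C) [F.Additive] :
    ObjectTrace (P.inverseImage F) A where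
  tr X hX f := t.tr (F.obj X) hX (F.map f)
  map_add X hX f g := by rw [F.map_add]; exact t.map_add _ hX _ _
  comm X Y hX hY f g := by rw [F.map_comp, F.map_comp]; exact t.comm _ _ hX hY _ _

end ObjectTrace

/-- Every trace on the class `𝒯` with values in `k` vanishes on nilpotent endomorphisms. Lenzing
deduced the absence of loops from this property. -/
def TracesKillNilpotents (k : Type w) [Field k] (𝒯 : ObjectProperty C) : Prop :=
  ∀ (t : ObjectTrace 𝒯 k) (X : C) (hX : 𝒯 X) (f : X ⟶ X), IsNilpotent (End.of f) → t.tr X hX f = 0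

/-- A presentation `K ⟶ T ⟶ M` of `M` with `P K` and `Q T` which is left exact, and right exact
relative to the class `Q`. -/
structure RelativePresentation (Q P : ObjectProperty C) (M : C) where
  K : C
  T : C
  i : K ⟶ T
  p : T ⟶ M
  hK : P K
  hT : Q T
  zero : i ≫ p = 0
  mono : Mono i
  exact : ∀ {W : C} (f : W ⟶ T), f ≫ p = 0 → ∃ g, g ≫ i = f
  lift : ∀ {T' : C} (_ : Q T') (f : T' ⟶ M), ∃ g, g ≫ p = f

/-- The objects with a relative presentation. -/
def isPresented (Q P : ObjectProperty C) : ObjectProperty C :=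
  fun M => Nonempty (RelativePresentation Q P M)

namespace RelativePresentation

variable {Q P : ObjectProperty C} {L M N : C}

/-- `(f₀, f₁)` is a map of presentations over `f`. -/
structure IsLift (X : RelativePresentation Q P M) (Y : RelativePresentation Q P N) (f : M ⟶ N)
    (f₀ : X.T ⟶ Y.T) (f₁ : X.K ⟶ Y.K) : Prop where
  mid : f₀ ≫ Y.p = X.p ≫ f
  left : f₁ ≫ Y.i = X.i ≫ f₀

lemma exists_isLift (X : RelativePresentation Q P M) (Y : RelativePresentation Q P N)
    (f : M ⟶ N) : ∃ f₀ f₁, IsLift X Y f f₀ f₁ := by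
  obtain ⟨f₀, h₀⟩ := Y.lift X.hT (X.p ≫ f)
  obtain ⟨f₁, h₁⟩ := Y.exact (X.i ≫ f₀) (by rw [Category.assoc, h₀, reassoc_of% X.zero, zero_comp])
  exact ⟨f₀, f₁, h₀, h₁⟩

namespace IsLift

lemma comp {X : RelativePresentation Q P L} {Y : RelativePresentation Q P M}
    {Z : RelativePresentation Q P N} {f : L ⟶ M} {g : M ⟶ N} {f₀ f₁ g₀ g₁}
    (hf : IsLift X Y f f₀ f₁) (hg : IsLift Y Z g g₀ g₁) :
    IsLift X Z (f ≫ g) (f₀ ≫ g₀) (f₁ ≫ g₁) :=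
  ⟨by rw [Category.assoc, hg.mid, reassoc_of% hf.mid],
    by rw [Category.assoc, hg.left, reassoc_of% hf.left]⟩

lemma add {X : RelativePresentation Q P M} {Y : RelativePresentation Q P N} {f g : M ⟶ N}
    {f₀ f₁ g₀ g₁} (hf : IsLift X Y f f₀ f₁) (hg : IsLift X Y g g₀ g₁) :
    IsLift X Y (f + g) (f₀ + g₀) (f₁ + g₁) :=
  ⟨by simp [hf.mid, hg.mid], by simp [hf.left, hg.left]⟩

end IsLift

variable {A : Type w} [AddCommGroup A] (hQP : Q ≤ P) (t : ObjectTrace P A)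

-- Two lifts differ by a homotopy `s : T ⟶ K`, and the traces of `s ≫ i` and `i ≫ s` agree.
lemma IsLift.tr_sub_tr_eq {X : RelativePresentation Q P M} {f : M ⟶ M} {f₀ f₁ g₀ g₁}
    (hf : IsLift X X f f₀ f₁) (hg : IsLift X X f g₀ g₁) :
    t.tr X.T (hQP _ X.hT) f₀ - t.tr X.K X.hK f₁ =
      t.tr X.T (hQP _ X.hT) g₀ - t.tr X.K X.hK g₁ := by
  obtain ⟨s, hs⟩ := X.exact (f₀ - g₀) (by rw [Preadditive.sub_comp, hf.mid, hg.mid, sub_self])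
  have := X.mono
  have hs' : X.i ≫ s = f₁ - g₁ := by
    rw [← cancel_mono X.i, Category.assoc, hs, Preadditive.sub_comp, Preadditive.comp_sub,
      hf.left, hg.left]
  have h := t.comm _ _ (hQP _ X.hT) X.hK s X.i
  rw [hs, hs', t.map_sub, t.map_sub] at h
  rw [sub_eq_sub_iff_sub_eq_sub, h]

variable (X : RelativePresentation Q P M)

/-- The trace of an endomorphism, computed on a presentation. -/
def tr (f : M ⟶ M) : A :=
  t.tr X.T (hQP _ X.hT) (X.exists_isLift X f).choose -
    t.tr X.K X.hK (X.exists_isLift X f).choose_spec.choose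

lemma tr_eq {f : M ⟶ M} {f₀ f₁} (hf : IsLift X X f f₀ f₁) :
    X.tr hQP t f = t.tr X.T (hQP _ X.hT) f₀ - t.tr X.K X.hK f₁ :=
  IsLift.tr_sub_tr_eq hQP t (X.exists_isLift X f).choose_spec.choose_spec hf

end RelativePresentation

lemma ObjectTrace.exists_extension {Q P : ObjectProperty C} (hQP : Q ≤ P) {A : Type w}
    [AddCommGroup A] (t : ObjectTrace P A) : ∃ t' : ObjectTrace (isPresented Q P) A,
      ∀ (M : C) (hM : isPresented Q P M) (hQ : Q M) (f : M ⟶ M),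
        t'.tr M hM f = t.tr M (hQP _ hQ) f := by
  refine ⟨⟨fun M hM f => hM.some.tr hQP t f, ?_, ?_⟩, ?_⟩
  · intro M hM f g
    obtain ⟨f₀, f₁, hf⟩ := hM.some.exists_isLift hM.some f
    obtain ⟨g₀, g₁, hg⟩ := hM.some.exists_isLift hM.some g
    rw [RelativePresentation.tr_eq hQP t _ hf, RelativePresentation.tr_eq hQP t _ hg,
      RelativePresentation.tr_eq hQP t _ (hf.add hg), t.map_add, t.map_add, add_sub_add_comm]
  · intro M N hM hN f g
    obtain ⟨f₀, f₁, hf⟩ := hM.some.exists_isLift hN.some f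
    obtain ⟨g₀, g₁, hg⟩ := hN.some.exists_isLift hM.some g
    rw [RelativePresentation.tr_eq hQP t _ (hf.comp hg),
      RelativePresentation.tr_eq hQP t _ (hg.comp hf),
      t.comm _ _ (hQP _ hM.some.hT) (hQP _ hN.some.hT), t.comm _ _ hM.some.hK hN.some.hK]
  · intro M hM hQ f
    obtain ⟨s, hs⟩ := hM.some.lift hQ (𝟙 M)
    have hf : RelativePresentation.IsLift hM.some hM.some f (hM.some.p ≫ f ≫ s) 0 :=
      ⟨by simp [hs], by simp [reassoc_of% hM.some.zero]⟩
    refine (RelativePresentation.tr_eq hQP t _ hf).trans ?_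
    rw [t.map_zero, sub_zero, t.comm _ _ (hQP _ hM.some.hT) (hQP _ hQ), Category.assoc, hs,
      Category.comp_id]

/-- A decomposition of the identity of `Q` into finitely many maps through the objects `G a` and one
map through an object in the class `null`. -/
structure LocalFrame (null : ObjectProperty C) {ι : Type*} (G : ι → C) (Q : C) where
  J : Type
  [fintype : Fintype J]
  idx : J → ι
  u : ∀ j, G (idx j) ⟶ Q
  v : ∀ j, Q ⟶ G (idx j)
  W : C
  hW : null W
  p : Q ⟶ W
  i : W ⟶ Q
  sum_add : ∑ j, v j ≫ u j + p ≫ i = 𝟙 Q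

attribute [instance] LocalFrame.fintype

namespace LocalFrame

variable {null : ObjectProperty C} {ι : Type*} {G : ι → C} {A : Type w} [AddCommGroup A]

/-- The frame of an object in the class `null`. -/
def ofNull {Q : C} (hQ : null Q) : LocalFrame null G Q where
  J := PEmpty
  idx := PEmpty.elim
  u j := j.elim
  v j := j.elim
  W := Q
  hW := hQ
  p := 𝟙 Q
  i := 𝟙 Q
  sum_add := by simp

/-- The frame of an object split into a copy of `G a` and an object with a frame. -/
def cons {Q Y : C} (F : LocalFrame null G Y) {a : ι} {u : G a ⟶ Q} {v : Q ⟶ G a} {i : Y ⟶ Q}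
    {p : Q ⟶ Y} (h : v ≫ u + p ≫ i = 𝟙 Q) : LocalFrame null G Q where
  J := Option F.J
  idx j := j.elim a F.idx
  u j := j.rec u fun j => F.u j ≫ i
  v j := j.rec v fun j => p ≫ F.v j
  W := F.W
  hW := F.hW
  p := p ≫ F.p
  i := F.i ≫ i
  sum_add := by
    have hY : ∑ j, (p ≫ F.v j) ≫ F.u j ≫ i + (p ≫ F.p) ≫ F.i ≫ i = p ≫ i := by
      simpa only [Preadditive.add_comp, Preadditive.comp_add, Preadditive.sum_comp,
        Preadditive.comp_sum, Category.assoc, Category.id_comp] using p ≫= F.sum_add =≫ i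
    rw [Fintype.sum_option, add_assoc]
    exact (congrArg (v ≫ u + ·) hY).trans h

lemma map_comp_eq {Q X Y : C} (F : LocalFrame null G Q) (μ : (X ⟶ Y) →+ A) (f : X ⟶ Q)
    (g : Q ⟶ Y) (h : μ ((f ≫ F.p) ≫ F.i ≫ g) = 0) :
    μ (f ≫ g) = ∑ j, μ ((f ≫ F.v j) ≫ F.u j ≫ g) := by
  have hfg : f ≫ g = f ≫ (∑ j, F.v j ≫ F.u j + F.p ≫ F.i) ≫ g := by
    rw [F.sum_add, Category.id_comp]
  rw [hfg, Preadditive.add_comp, Preadditive.comp_add, Preadditive.sum_comp, Preadditive.comp_sum,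
    map_add, map_sum]
  simp only [Category.assoc] at h ⊢
  rw [h, add_zero]

end LocalFrame

-- The trace of `f` is computed by cutting `f` into its components between the objects `G a`.
lemma exists_trace_of_frames {null P : ObjectProperty C} {ι : Type*} {G : ι → C} {A : Type w}
    [AddCommGroup A] (hF : ∀ Q, P Q → Nonempty (LocalFrame null G Q)) (μ : ∀ a, (G a ⟶ G a) →+ A)
    (hμ : ∀ a b (f : G a ⟶ G b) (g : G b ⟶ G a), μ a (f ≫ g) = μ b (g ≫ f))
    (hnull : ∀ a W, null W → ∀ (f : G a ⟶ W) (g : W ⟶ G a), μ a (f ≫ g) = 0) :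
    ∃ t : ObjectTrace P A, ∀ a (ha : P (G a)) (f : G a ⟶ G a), t.tr _ ha f = μ a f := by
  have F := fun Q hQ => (hF Q hQ).some
  refine ⟨⟨fun Q hQ f => ∑ j, μ _ ((F Q hQ).u j ≫ f ≫ (F Q hQ).v j), ?_, ?_⟩, ?_⟩
  · intro Q hQ f g
    simp only [Preadditive.add_comp, Preadditive.comp_add, map_add, Finset.sum_add_distrib]
  · intro Q Q' hQ hQ' f g
    have hcut {Q Q' : C} (F : LocalFrame null G Q) (F' : LocalFrame null G Q') (f : Q ⟶ Q')
        (g : Q' ⟶ Q) (j) : μ _ (F.u j ≫ (f ≫ g) ≫ F.v j) =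
          ∑ j', μ _ ((F.u j ≫ f ≫ F'.v j') ≫ F'.u j' ≫ g ≫ F.v j) := by
      simpa only [Category.assoc] using
        F'.map_comp_eq (μ (F.idx j)) (F.u j ≫ f) (g ≫ F.v j) (hnull _ _ F'.hW _ _)
    simp only [hcut (F Q hQ) (F Q' hQ'), hcut (F Q' hQ') (F Q hQ)]
    rw [Finset.sum_comm]
    exact Finset.sum_congr rfl fun _ _ => Finset.sum_congr rfl fun _ _ => hμ _ _ _ _
  · intro a ha f
    have h := (F _ ha).map_comp_eq (μ a) f (𝟙 _) (hnull _ _ (F _ ha).hW _ _)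
    rw [Category.comp_id] at h
    refine Eq.trans (Finset.sum_congr rfl fun j _ => ?_) h.symm
    rw [Category.comp_id, hμ, Category.assoc]

/-- The objects of `𝒯` receiving only radical maps from the objects `G a`. -/
def isFreeOf (𝒯 : ObjectProperty C) {ι : Type*} (G : ι → C) : ObjectProperty C := fun W =>
  𝒯 W ∧ ∀ a (f : G a ⟶ W), IsRadicalHom f

variable {k : Type w} [Field k] [Linear k C] [HasBinaryBiproducts C] [IsIdempotentComplete C]
  [∀ X Y : C, FiniteDimensional k (X ⟶ Y)] {𝒯 : ObjectProperty C}

lemma exists_localFrame (h𝒯 : IsAdditiveClass 𝒯) {ι : Type*} {G : ι → C}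
    (hG : ∀ a, IsLocalObject k (G a)) (Q : C) (hQ : 𝒯 Q) :
    Nonempty (LocalFrame (isFreeOf 𝒯 G) G Q) := by
  induction Q using IsLocalObject.split_induction hG with
  | free Q hfree => exact ⟨.ofNull ⟨hQ, hfree⟩⟩
  | split Q Y a u v i p hip htotal ih =>
    obtain ⟨F⟩ := ih (h𝒯.retract ⟨i, p, hip⟩ hQ)
    exact ⟨F.cons htotal⟩

/-! ## No loops -/

theorem isRadicalSqIn_of_isRadicalHom_endo (h𝒯 : IsAdditiveClass 𝒯)
    (hk : TracesKillNilpotents k 𝒯) {X : C} (hX𝒯 : 𝒯 X) (hX : IsLocalObject k X)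
    (f : X ⟶ X) (hf : IsRadicalHom f) : IsRadicalSqIn 𝒯 f := by
  by_contra hsq
  obtain ⟨φ, hφf, hφ⟩ := exists_dual_eq_one_of_notMem _
    (notMem_radicalSqSubmodule_sup_span_id h𝒯 hX𝒯 hX hf hsq)
  have hφsq (g : X ⟶ X) (hg : IsRadicalSqIn 𝒯 g) : φ g = 0 := hφ g (Submodule.mem_sup_left hg)
  obtain ⟨t, ht⟩ := exists_trace_of_frames
    (exists_localFrame (G := fun _ : Unit => X) h𝒯 fun _ => hX)
    (fun _ => φ.toAddMonoidHom)
    (fun _ _ => hX.apply_comp_comm φ fun g h hg hh => hφsq _ ⟨X, g, h, hX𝒯, hg, hh, rfl⟩)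
    (fun _ W hW g h => hφsq _ ⟨W, g, h, hW.1, hW.2 () g,
      hX.isRadicalHom_of_forall_isRadicalHom (hW.2 ()) h, rfl⟩)
  have htf : t.tr X hX𝒯 f = 1 := (ht () hX𝒯 f).trans hφf
  exact one_ne_zero (htf.symm.trans (hk t X hX𝒯 f ((hX.isRadicalHom_iff_isNilpotent f).1 hf)))

end Traces

/-! ## Two-cycles in the quiver of a cluster-tilting subcategory -/

section TwoCalabiYau

variable {C : Type u} [Category.{v} C]

lemma isEquivalence_of_comp_self (S : C ⥤ C) [(S ⋙ S).IsEquivalence] : S.IsEquivalence := by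
  have hfaithful : S.Faithful := Functor.Faithful.of_comp S S
  exact
    { faithful := hfaithful
      full := ⟨fun {X Y} g => by
        obtain ⟨f, hf⟩ := (S ⋙ S).map_surjective (S.map g)
        exact ⟨f, S.map_injective hf⟩⟩
      essSurj := ⟨fun Y => ⟨S.obj ((S ⋙ S).objPreimage Y), ⟨(S ⋙ S).objObjPreimageIso Y⟩⟩⟩ }

lemma exists_map_comp_objObjPreimageIso_inv (S : C ⥤ C) [S.IsEquivalence] {W Y : C}
    (f : W ⟶ S.obj Y) :
    ∃ f' : S.objPreimage W ⟶ Y, (S.objObjPreimageIso W).inv ≫ S.map f' = f := by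
  obtain ⟨f', hf'⟩ := S.map_surjective ((S.objObjPreimageIso W).hom ≫ f)
  exact ⟨f', by rw [hf', Iso.inv_hom_id_assoc]⟩

variable [Preadditive C]

lemma IsExactTriangle.exact_susp_mid {S : C ⥤ C} [S.IsEquivalence] {A B D : C} {j : A ⟶ B}
    {q : B ⟶ D} {δ : D ⟶ S.obj A} (h : IsExactTriangle S j q δ) {W : C} (f : W ⟶ S.obj B)
    (hf : f ≫ S.map q = 0) : ∃ g, g ≫ S.map j = f := by
  obtain ⟨f, rfl⟩ := exists_map_comp_objObjPreimageIso_inv S f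
  have hfq : S.map (f ≫ q) = S.map 0 := by
    rw [← cancel_epi (S.objObjPreimageIso W).inv, S.map_comp, S.map_zero, comp_zero, ← hf,
      Category.assoc]
  obtain ⟨g, rfl⟩ := h.exact_mid f (S.map_injective hfq)
  exact ⟨_, by rw [S.map_comp, Category.assoc]⟩

/-- The trace forms `Hom(X, S² X) → k` of a Serre functor `S²`. -/
structure SerreTrace (k : Type w) [Field k] [Linear k C] (S : C ⥤ C) where
  τ : ∀ X : C, (X ⟶ S.obj (S.obj X)) →ₗ[k] k
  cyc : ∀ {X Y : C} (e : X ⟶ Y) (h : Y ⟶ S.obj (S.obj X)),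
    τ X (e ≫ h) = τ Y (h ≫ S.map (S.map e))
  eq_zero_left : ∀ {X Y : C} (f : X ⟶ Y), (∀ h : Y ⟶ S.obj (S.obj X), τ X (f ≫ h) = 0) → f = 0
  eq_zero_right : ∀ {X Y : C} (h : Y ⟶ S.obj (S.obj X)), (∀ f : X ⟶ Y, τ X (f ≫ h) = 0) → h = 0
  exists_repr : ∀ {X Y : C} (φ : (X ⟶ Y) →ₗ[k] k), ∃ h : Y ⟶ S.obj (S.obj X), ∀ f, τ X (f ≫ h) = φ f

lemma IsTwoCalabiYau.exists_serreTrace {k : Type w} [Field k] [Linear k C]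
    [∀ X Y : C, FiniteDimensional k (X ⟶ Y)] {S : C ⥤ C} (h : IsTwoCalabiYau k S) :
    Nonempty (SerreTrace k S) := by
  obtain ⟨-, η, hη, hη'⟩ := h
  have heval (X Y : C) (f : X ⟶ Y) (h : Y ⟶ S.obj (S.obj X)) :
      η X Y f h = η X X (𝟙 X) (f ≫ h) := by
    simpa only [Category.id_comp] using hη X X Y (𝟙 X) f h
  refine ⟨⟨fun X => η X X (𝟙 X), ?_, ?_, ?_, ?_⟩⟩
  · intro X Y e h
    have hnat := hη' X Y Y e (𝟙 Y) h
    rw [Category.comp_id] at hnat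
    exact (heval X Y e h).symm.trans hnat
  · intro X Y f hf
    apply (η X Y).injective
    rw [map_zero]
    ext h
    exact (heval X Y f h).trans (hf h)
  · intro X Y h hh
    by_contra h0
    obtain ⟨φ, hφ⟩ := Module.Projective.exists_dual_ne_zero k h0
    obtain ⟨f, rfl⟩ := (η X Y).surjective φ
    exact hφ ((heval X Y f h).trans (hh f))
  · intro X Y φ
    obtain ⟨h, hh⟩ := (Module.evalEquiv k (Y ⟶ S.obj (S.obj X))).surjective
      (φ ∘ₗ (η X Y).symm.toLinearMap)
    refine ⟨h, fun f => ?_⟩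
    have hf := LinearMap.congr_fun hh (η X Y f)
    simp only [Module.evalEquiv_apply, Module.Dual.eval_apply, LinearMap.comp_apply,
      LinearEquiv.coe_coe, LinearEquiv.symm_apply_apply] at hf
    exact (heval X Y f h).symm.trans hf

lemma IsClusterTiltingSubcategory.isAdditiveClass [HasBinaryBiproducts C] {S : C ⥤ C} [S.Additive]
    {𝒯 : ObjectProperty C} (h : IsClusterTiltingSubcategory S 𝒯) : IsAdditiveClass 𝒯 where
  biprod {X Y} hX hY := by
    refine h.maximal _ fun T hT f => ?_
    have hfst := h.rigid hT hX (f ≫ S.map biprod.fst)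
    have hsnd := h.rigid hT hY (f ≫ S.map biprod.snd)
    rw [← Category.comp_id f, ← S.map_id, ← biprod.total, S.map_add, S.map_comp, S.map_comp,
      Preadditive.comp_add, reassoc_of% hfst, reassoc_of% hsnd, zero_comp, zero_comp, add_zero]
  retract {X Y} ρ hY := by
    refine h.maximal _ fun T hT f => ?_
    have hi := h.rigid hT hY (f ≫ S.map ρ.i)
    rw [← Category.comp_id f, ← S.map_id, ← ρ.retract, S.map_comp, reassoc_of% hi, zero_comp]

/-! ### Sink maps -/

/-- `e` is right almost split in `𝒯` (not necessarily minimal). -/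
structure IsSink (𝒯 : ObjectProperty C) {E X : C} (e : E ⟶ X) : Prop where
  mem : 𝒯 E
  isRadicalHom : IsRadicalHom e
  exists_factor : ∀ {T : C} (t : T ⟶ X), 𝒯 T → IsRadicalHom t → ∃ s, s ≫ e = t

variable {k : Type w} [Field k] [Linear k C] {S : C ⥤ C} {𝒯 : ObjectProperty C} {X : C}

-- The functional on `End X` with kernel the radical is represented by a map `h : X ⟶ S² X`, which
-- is the connecting map of an Auslander–Reiten triangle.
lemma SerreTrace.exists_isSink (τ : SerreTrace k S) (hS : HasExactTriangles S)
    (happ : ∀ X : C, ∃ (M : C) (f : M ⟶ X), 𝒯 M ∧ ∀ (N : C) (h : N ⟶ X), 𝒯 N → ∃ g, g ≫ f = h)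
    (hX : IsLocalObject k X) : ∃ (E : C) (e : E ⟶ X), IsSink 𝒯 e := by
  obtain ⟨ρ, hρid, hρ⟩ := exists_dual_eq_one_of_notMem (radicalSubmodule k X X)
    (x := 𝟙 X) hX.not_isRadicalHom_id
  obtain ⟨h, hh⟩ := τ.exists_repr ρ
  obtain ⟨M, _, m, hm⟩ := hS (A := S.obj X) h
  obtain ⟨E, f, hE, hf⟩ := happ M
  refine ⟨E, f ≫ m, hE, ?_, fun {T} t hT ht => ?_⟩
  · by_contra hr
    obtain ⟨s, hs⟩ := hX.exists_section _ hr
    have hzero : h = 0 := by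
      rw [← Category.id_comp h, ← hs, Category.assoc, Category.assoc, hm.comp_right, comp_zero,
        comp_zero]
    have hone := hh (𝟙 X)
    rw [hzero, comp_zero, map_zero, hρid] at hone
    exact zero_ne_one hone
  · have hth : t ≫ h = 0 := τ.eq_zero_right _ fun s => by
      rw [← Category.assoc, hh]
      exact hρ _ (ht.comp_left s)
    obtain ⟨g, rfl⟩ := hm.exact_right t hth
    obtain ⟨g', rfl⟩ := hf T g hT
    exact ⟨g', (Category.assoc _ _ _).symm⟩

-- The component of `e` on a copy of `X` lies in `rad²`, so it factors through the other summands.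
lemma IsSink.exists_free [IsIdempotentComplete C] [∀ X Y : C, FiniteDimensional k (X ⟶ Y)]
    [HasBinaryBiproducts C] (h𝒯 : IsAdditiveClass 𝒯) (hX : IsLocalObject k X)
    (hloop : ∀ f : X ⟶ X, IsRadicalHom f → IsRadicalSqIn 𝒯 f) {E : C} (e : E ⟶ X)
    (he : IsSink 𝒯 e) :
    ∃ (E' : C) (e' : E' ⟶ X), IsSink 𝒯 e' ∧ ∀ f : X ⟶ E', IsRadicalHom f := by
  induction E using IsLocalObject.split_induction (G := fun _ : Unit => X) fun _ => hX with
  | free E hfree => exact ⟨E, e, he, hfree ()⟩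
  | split E Y _ a s i p hip htotal ih =>
    have hsplit {T : C} (t : T ⟶ E) : t ≫ e = (t ≫ s) ≫ a ≫ e + (t ≫ p) ≫ i ≫ e := by
      conv_lhs => rw [← Category.id_comp e, ← htotal]
      simp only [Preadditive.add_comp, Preadditive.comp_add, Category.assoc]
    obtain ⟨d, hd⟩ : ∃ d, d ≫ i ≫ e = a ≫ e := by
      obtain ⟨T, g, l, hT, hg, hl, hgl⟩ := hloop _ (he.isRadicalHom.comp_left a)
      obtain ⟨c, rfl⟩ := he.exists_factor l hT hl
      have := (hg.comp_right (c ≫ s)) (𝟙 X)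
      rw [Category.comp_id] at this
      refine ⟨inv (𝟙 X - g ≫ c ≫ s) ≫ g ≫ c ≫ p, ?_⟩
      rw [hsplit c] at hgl
      rw [Category.assoc, IsIso.inv_comp_eq, Preadditive.sub_comp, Category.id_comp,
        eq_sub_iff_add_eq, add_comm]
      simpa only [Preadditive.comp_add, Category.assoc] using hgl
    refine ih (i ≫ e) ⟨h𝒯.retract ⟨i, p, hip⟩ he.mem, he.isRadicalHom.comp_left i, ?_⟩
    intro T t hT ht
    obtain ⟨t', rfl⟩ := he.exists_factor t hT ht
    refine ⟨t' ≫ s ≫ d + t' ≫ p, ?_⟩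
    simp only [hsplit t', Preadditive.add_comp, ← hd, Category.assoc]

/-! ### The exchange triangles -/

/-- The exactness properties of a triangle `Z ⟶ E ⟶ X ⟶ S Z`. -/
structure IsFiberSequence (S : C ⥤ C) {Z E X : C} (ι : Z ⟶ E) (e : E ⟶ X) (γ : X ⟶ S.obj Z) :
    Prop where
  comp : ι ≫ e = 0
  comp' : e ≫ γ = 0
  exact_mid : ∀ {W : C} (f : W ⟶ E), f ≫ e = 0 → ∃ g, g ≫ ι = f
  exact_right : ∀ {W : C} (f : W ⟶ X), f ≫ γ = 0 → ∃ g, g ≫ e = f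
  exact_susp : ∀ {W : C} (f : W ⟶ S.obj Z), f ≫ S.map ι = 0 → ∃ g, g ≫ γ = f
  coexact_left : ∀ {W : C} (f : Z ⟶ W), γ ≫ S.map f = 0 → ∃ g, ι ≫ g = f

lemma HasExactTriangles.exists_isFiberSequence [S.IsEquivalence] (hS : HasExactTriangles S)
    {E X : C} (e : E ⟶ X) :
    ∃ (Z : C) (ι : Z ⟶ E) (γ : X ⟶ S.obj Z), IsFiberSequence S ι e γ := by
  let φ := S.objObjPreimageIso X
  obtain ⟨Z, j, ι, h⟩ := hS (A := S.objPreimage X) (e ≫ φ.inv)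
  refine ⟨Z, ι, φ.inv ≫ S.map j, ?_, ?_, ?_, ?_, ?_, ?_⟩
  · rw [← cancel_mono φ.inv, Category.assoc, h.comp_right, zero_comp]
  · simpa only [Category.assoc] using h.comp_susp
  · intro W f hf
    exact h.exact_right f (by rw [reassoc_of% hf, zero_comp])
  · intro W f hf
    obtain ⟨g, hg⟩ := h.exact_susp (f ≫ φ.inv) (by simpa only [Category.assoc] using hf)
    exact ⟨g, by simpa [← cancel_mono φ.inv] using hg⟩
  · intro W f hf
    obtain ⟨g, rfl⟩ := h.exact_susp_mid f hf
    exact ⟨g ≫ φ.hom, by rw [Category.assoc, Iso.hom_inv_id_assoc]⟩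
  · intro W f hf
    refine h.coexact_mid f (S.map_injective ?_)
    rw [← cancel_epi φ.inv, S.map_comp, S.map_zero, comp_zero, ← hf, Category.assoc]

/-- A triangle `Z ⟶ E ⟶ X ⟶ S Z` on a sink map of `𝒯` such that `X` is not a summand of `E`. -/
structure IsSinkTriangle (S : C ⥤ C) (𝒯 : ObjectProperty C) {Z E X : C} (ι : Z ⟶ E) (e : E ⟶ X)
    (γ : X ⟶ S.obj Z) : Prop extends IsFiberSequence S ι e γ, IsSink 𝒯 e where
  free : ∀ f : X ⟶ E, IsRadicalHom f

namespace IsSinkTriangle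

variable {Z E : C} {ι : Z ⟶ E} {e : E ⟶ X} {γ : X ⟶ S.obj Z}

section

variable (h : IsSinkTriangle S 𝒯 ι e γ)

include h

lemma exists_comp_eq (hct : IsClusterTiltingSubcategory S 𝒯) {T : C} (hT : 𝒯 T)
    (f : T ⟶ S.obj Z) : ∃ t, t ≫ γ = f :=
  h.exact_susp f (hct.rigid hT h.mem _)

lemma comp_eq_zero {T : C} (hT : 𝒯 T) {t : T ⟶ X} (ht : IsRadicalHom t) : t ≫ γ = 0 := by
  obtain ⟨s, rfl⟩ := h.exists_factor t hT ht
  rw [Category.assoc, h.comp', comp_zero]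

lemma ne_zero (hX : IsLocalObject k X) : γ ≠ 0 := by
  rintro rfl
  obtain ⟨g, hg⟩ := h.exact_right (𝟙 X) comp_zero
  exact hX.not_isRadicalHom_id (hg ▸ h.isRadicalHom.comp_left g)

lemma isRadicalHom_mid_right (hX : IsLocalObject k X) (t : E ⟶ X) : IsRadicalHom t :=
  hX.isRadicalHom_of_forall_isRadicalHom h.free t

variable [S.IsEquivalence]

lemma rigid_left (τ : SerreTrace k S) (hct : IsClusterTiltingSubcategory S 𝒯) (hX𝒯 : 𝒯 X)
    (hX : IsLocalObject k X) (z : Z ⟶ S.obj Z) : z = 0 := by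
  have hγz : γ ≫ S.map z = 0 := τ.eq_zero_left _ fun y => by
    obtain ⟨y, rfl⟩ := S.map_surjective y
    obtain ⟨y, rfl⟩ := S.map_surjective y
    obtain ⟨t, rfl⟩ := h.coexact_left y (hct.rigid hX𝒯 hX𝒯 _)
    obtain ⟨t, rfl⟩ := h.exists_factor t h.mem (h.isRadicalHom_mid_right hX t)
    have hcyc := τ.cyc e (γ ≫ S.map z ≫ S.map (S.map (ι ≫ t)))
    rw [reassoc_of% h.comp', zero_comp, map_zero] at hcyc
    simpa only [Functor.map_comp, Category.assoc] using hcyc.symm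
  obtain ⟨g, rfl⟩ := h.coexact_left z hγz
  obtain ⟨t, rfl⟩ := h.exists_comp_eq hct h.mem g
  rw [h.comp_eq_zero h.mem (h.isRadicalHom_mid_right hX t), comp_zero]

lemma exists_serreTrace_ne_zero (τ : SerreTrace k S) (hX : IsLocalObject k X) :
    ∃ β : Z ⟶ S.obj X, τ.τ X (γ ≫ S.map β) ≠ 0 := by
  by_contra! hβ
  refine h.ne_zero hX (τ.eq_zero_left _ fun y => ?_)
  obtain ⟨β, rfl⟩ := S.map_surjective y
  exact hβ β

-- `Hom(Z, S X)` is one-dimensional.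
lemma exists_eq_comp_map_smul_id [S.Additive] (τ : SerreTrace k S)
    (hct : IsClusterTiltingSubcategory S 𝒯) (hX𝒯 : 𝒯 X) (hX : IsLocalObject k X)
    {β : Z ⟶ S.obj X} (hβ : τ.τ X (γ ≫ S.map β) ≠ 0) (y : Z ⟶ S.obj X) :
    ∃ c : k, y = β ≫ S.map (c • 𝟙 X) := by
  set c := τ.τ X (γ ≫ S.map y) / τ.τ X (γ ≫ S.map β) with hc
  have hcβ : τ.τ X (γ ≫ S.map (β ≫ S.map (c • 𝟙 X))) = c * τ.τ X (γ ≫ S.map β) := by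
    have hcyc := τ.cyc (c • 𝟙 X) (γ ≫ S.map β)
    rw [Linear.smul_comp, Category.id_comp, map_smul, smul_eq_mul] at hcyc
    rw [hcyc, S.map_comp, Category.assoc]
  refine ⟨c, sub_eq_zero.1 (S.map_injective ?_)⟩
  rw [S.map_zero]
  refine τ.eq_zero_right _ fun f => ?_
  obtain ⟨t, rfl⟩ := h.exists_comp_eq hct hX𝒯 f
  obtain ⟨d, hd⟩ := hX.exists_isRadicalHom_sub t
  have htγ := h.comp_eq_zero hX𝒯 hd
  rw [Preadditive.sub_comp, sub_eq_zero, Linear.smul_comp, Category.id_comp] at htγ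
  rw [htγ, Linear.smul_comp, map_smul, S.map_sub, Preadditive.comp_sub, map_sub, hcβ, hc,
    div_mul_cancel₀ _ hβ, sub_self, smul_zero]

section Exchange

variable {B : C} {j : X ⟶ B} {q : B ⟶ Z} {β : Z ⟶ S.obj X} (hB : IsExactTriangle S j q β)

include hB

lemma exchange_mem (τ : SerreTrace k S) (hct : IsClusterTiltingSubcategory S 𝒯) (hX𝒯 : 𝒯 X)
    (hX : IsLocalObject k X) (hβ : τ.τ X (γ ≫ S.map β) ≠ 0) : 𝒯 B := by
  refine hct.maximal B fun T hT f => ?_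
  have hfq : f ≫ S.map q = 0 := by
    obtain ⟨t, ht⟩ := h.exists_comp_eq hct hT (f ≫ S.map q)
    rw [← ht]
    refine h.comp_eq_zero hT ?_
    by_contra hr
    obtain ⟨s, hs⟩ := hX.exists_section t hr
    apply hβ
    rw [← Category.id_comp γ, ← hs, Category.assoc, Category.assoc, reassoc_of% ht, ← S.map_comp,
      hB.comp_right, S.map_zero, comp_zero, comp_zero, map_zero]
  obtain ⟨g, rfl⟩ := hB.exact_susp_mid f hfq
  rw [hct.rigid hT hX𝒯 g, zero_comp]

lemma hom_left_exchange_eq_zero [S.Additive] (τ : SerreTrace k S)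
    (hct : IsClusterTiltingSubcategory S 𝒯) (hX𝒯 : 𝒯 X) (hX : IsLocalObject k X)
    (hβ : τ.τ X (γ ≫ S.map β) ≠ 0) (y : Z ⟶ S.obj B) : y = 0 := by
  obtain ⟨g, rfl⟩ := hB.exact_susp_mid y (h.rigid_left τ hct hX𝒯 hX _)
  obtain ⟨c, rfl⟩ := h.exists_eq_comp_map_smul_id τ hct hX𝒯 hX hβ g
  have hcj : (c • 𝟙 X) ≫ j = j ≫ (c • 𝟙 B) := by simp
  rw [Category.assoc, ← S.map_comp, hcj, S.map_comp, reassoc_of% hB.comp_susp, zero_comp]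

lemma hom_exchange_left_eq_zero [S.Additive] (τ : SerreTrace k S)
    (hct : IsClusterTiltingSubcategory S 𝒯) (hX𝒯 : 𝒯 X) (hX : IsLocalObject k X)
    (hβ : τ.τ X (γ ≫ S.map β) ≠ 0) (y : B ⟶ S.obj Z) : y = 0 :=
  τ.eq_zero_left _ fun y' => by
    obtain ⟨y', rfl⟩ := S.map_surjective y'
    rw [h.hom_left_exchange_eq_zero hB τ hct hX𝒯 hX hβ y', S.map_zero, comp_zero, map_zero]

end Exchange

lemma exists_radical_factor [S.Additive] (τ : SerreTrace k S)
    (hct : IsClusterTiltingSubcategory S 𝒯) (hS : HasExactTriangles S) (hX𝒯 : 𝒯 X)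
    (hX : IsLocalObject k X) (x : X ⟶ Z) :
    ∃ (B : C) (x₁ : X ⟶ B) (x₂ : B ⟶ Z), 𝒯 B ∧ IsRadicalHom x₁ ∧ x₁ ≫ x₂ = x := by
  obtain ⟨β, hβ⟩ := h.exists_serreTrace_ne_zero τ hX
  obtain ⟨B, j, q, hB⟩ := hS β
  obtain ⟨x₁, hx⟩ := hB.exact_right x (hct.rigid hX𝒯 hX𝒯 _)
  refine ⟨B, x₁, q, h.exchange_mem hB τ hct hX𝒯 hX hβ, ?_, hx⟩
  by_contra hr
  obtain ⟨p, hp⟩ := hX.exists_retraction x₁ hr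
  apply h.ne_zero hX
  rw [← Category.id_comp γ, ← hp, Category.assoc,
    h.hom_exchange_left_eq_zero hB τ hct hX𝒯 hX hβ (p ≫ γ), comp_zero]

end

end IsSinkTriangle

end TwoCalabiYau

/-! ### The trace of a two-cycle -/

section TwoCycles

variable {C : Type u} [Category.{v} C] [Preadditive C] {k : Type w} [Field k] [Linear k C]
  {𝒯 : ObjectProperty C} {X Y : C}

/-- Frames with respect to a single object. -/
abbrev SingleFrame (𝒯 : ObjectProperty C) (Y Q : C) :=
  LocalFrame (isFreeOf 𝒯 fun _ : Unit => Y) (fun _ : Unit => Y) Q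

/-- The value of the cyclic functional `α ⊗ β` on the path `X ⟶ Q ⟶ X`, computed on the copies of
`Y` in a frame of `Q`. -/
def SingleFrame.bracket (α : (X ⟶ Y) →ₗ[k] k) (β : (Y ⟶ X) →ₗ[k] k) {Q : C}
    (F : SingleFrame 𝒯 Y Q) (f : X ⟶ Q) (g : Q ⟶ X) : k :=
  ∑ j, α (f ≫ F.v j) * β (F.u j ≫ g)

/-- `μ` extends the cyclic functional `α ⊗ β` on the paths `X ⟶ Y ⟶ X` to the endomorphisms of
`X`. -/
def IsCycleFunctional (𝒯 : ObjectProperty C) (α : (X ⟶ Y) →ₗ[k] k) (β : (Y ⟶ X) →ₗ[k] k)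
    (μ : (X ⟶ X) →ₗ[k] k) : Prop :=
  ∀ ⦃Q : C⦄ (F : SingleFrame 𝒯 Y Q) (f : X ⟶ Q) (g : Q ⟶ X), 𝒯 Q → IsRadicalHom f →
    IsRadicalHom g → μ (f ≫ g) = F.bracket α β f g

namespace IsCycleFunctional

variable {α : (X ⟶ Y) →ₗ[k] k} {β : (Y ⟶ X) →ₗ[k] k} {μ : (X ⟶ X) →ₗ[k] k}

lemma map_comp_eq_zero (hμ : IsCycleFunctional 𝒯 α β μ) {Q : C}
    (hQ : isFreeOf 𝒯 (fun _ : Unit => Y) Q) {f : X ⟶ Q} {g : Q ⟶ X} (hf : IsRadicalHom f)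
    (hg : IsRadicalHom g) : μ (f ≫ g) = 0 :=
  (hμ (.ofNull hQ) f g hQ.1 hf hg).trans Finset.sum_empty

lemma map_comp (hμ : IsCycleFunctional 𝒯 α β μ) (hX𝒯 : 𝒯 X) (hY𝒯 : 𝒯 Y)
    (hYX : ∀ g : Y ⟶ X, IsRadicalHom g) {f : X ⟶ Y} (hf : IsRadicalHom f) (g : Y ⟶ X) :
    μ (f ≫ g) = α f * β g := by
  have hY : 𝟙 Y ≫ 𝟙 Y + (0 : Y ⟶ X) ≫ 0 = 𝟙 Y := by simp
  let F : SingleFrame 𝒯 Y Y := LocalFrame.cons (a := ()) (.ofNull ⟨hX𝒯, fun _ => hYX⟩) hY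
  rw [hμ F f g hY𝒯 hf (hYX g)]
  exact (Fintype.sum_option _).trans (by simp [F, LocalFrame.cons, LocalFrame.ofNull])

end IsCycleFunctional

namespace SingleFrame

variable {α : (X ⟶ Y) →ₗ[k] k} {β : (Y ⟶ X) →ₗ[k] k}

lemma map_comp_v_eq_sum (hY : IsLocalObject k Y) (hY𝒯 : 𝒯 Y)
    (hα : ∀ f, IsRadicalSqIn 𝒯 f → α f = 0) {Q : C} (F : SingleFrame 𝒯 Y Q) {f : X ⟶ Q}
    (hf : IsRadicalHom f) (v : Q ⟶ Y) {c : F.J → k}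
    (hc : ∀ j, IsRadicalHom (F.u j ≫ v - c j • 𝟙 Y)) : α (f ≫ v) = ∑ j, c j * α (f ≫ F.v j) := by
  have hnull : α ((f ≫ F.p) ≫ F.i ≫ v) = 0 :=
    hα _ ⟨F.W, _, _, F.hW.1, hf.comp_right _,
      hY.isRadicalHom_of_forall_isRadicalHom (F.hW.2 ()) _, rfl⟩
  refine (F.map_comp_eq α.toAddMonoidHom f v hnull).trans (Finset.sum_congr rfl fun j _ => ?_)
  have hj := hα _ ⟨Y, f ≫ F.v j, _, hY𝒯, hf.comp_right _, hc j, rfl⟩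
  rwa [Preadditive.comp_sub, Linear.comp_smul, Category.comp_id, map_sub, map_smul,
    sub_eq_zero] at hj

lemma map_u_comp_eq_sum (hY𝒯 : 𝒯 Y) (hβ : ∀ f, IsRadicalSqIn 𝒯 f → β f = 0) {Q : C}
    (F : SingleFrame 𝒯 Y Q) (u : Y ⟶ Q) {g : Q ⟶ X} (hg : IsRadicalHom g) {c : F.J → k}
    (hc : ∀ j, IsRadicalHom (u ≫ F.v j - c j • 𝟙 Y)) : β (u ≫ g) = ∑ j, c j * β (F.u j ≫ g) := by
  have hnull : β ((u ≫ F.p) ≫ F.i ≫ g) = 0 :=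
    hβ _ ⟨F.W, _, _, F.hW.1, F.hW.2 () _, hg.comp_left _, rfl⟩
  refine (F.map_comp_eq β.toAddMonoidHom u g hnull).trans (Finset.sum_congr rfl fun j _ => ?_)
  have hj := hβ _ ⟨Y, _, F.u j ≫ g, hY𝒯, hc j, hg.comp_left _, rfl⟩
  rwa [Preadditive.sub_comp, Linear.smul_comp, Category.id_comp, map_sub, map_smul,
    sub_eq_zero] at hj

lemma bracket_comp (hY : IsLocalObject k Y) (hY𝒯 : 𝒯 Y)
    (hα : ∀ f, IsRadicalSqIn 𝒯 f → α f = 0) (hβ : ∀ f, IsRadicalSqIn 𝒯 f → β f = 0) {Q Q' : C}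
    (F : SingleFrame 𝒯 Y Q) (F' : SingleFrame 𝒯 Y Q') {f : X ⟶ Q} (q : Q ⟶ Q') {g : Q' ⟶ X}
    (hf : IsRadicalHom f) (hg : IsRadicalHom g) :
    F'.bracket α β (f ≫ q) g = F.bracket α β f (q ≫ g) := by
  choose c hc using fun j j' => hY.exists_isRadicalHom_sub (F.u j ≫ q ≫ F'.v j')
  have hα' (j') : α ((f ≫ q) ≫ F'.v j') = ∑ j, c j j' * α (f ≫ F.v j) := by
    rw [Category.assoc]
    exact map_comp_v_eq_sum hY hY𝒯 hα F hf _ (hc · j')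
  have hβ' (j) : β (F.u j ≫ q ≫ g) = ∑ j', c j j' * β (F'.u j' ≫ g) := by
    rw [← Category.assoc]
    exact map_u_comp_eq_sum hY𝒯 hβ F' _ hg fun j' => by simpa only [Category.assoc] using hc j j'
  simp only [bracket, hα', hβ', Finset.sum_mul, Finset.mul_sum]
  rw [Finset.sum_comm]
  exact Finset.sum_congr rfl fun _ _ => Finset.sum_congr rfl fun _ _ => by ring

end SingleFrame

-- The bracket with the sink map is a functional on `Hom(X, E)`. Balancedness makes it vanish on the
-- kernel of composition with the sink map, so it extends to `End X`.
lemma IsSink.exists_isCycleFunctional {E : C} {e : E ⟶ X} (he : IsSink 𝒯 e)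
    (hfac : ∀ w : X ⟶ E, w ≫ e = 0 → ∃ (B : C) (x₁ : X ⟶ B) (x₂ : B ⟶ E),
      𝒯 B ∧ IsRadicalHom x₁ ∧ x₁ ≫ x₂ = w ∧ x₂ ≫ e = 0)
    (hframe : ∀ Q, 𝒯 Q → Nonempty (SingleFrame 𝒯 Y Q)) (hY : IsLocalObject k Y) (hY𝒯 : 𝒯 Y)
    {α : (X ⟶ Y) →ₗ[k] k} {β : (Y ⟶ X) →ₗ[k] k} (hα : ∀ f, IsRadicalSqIn 𝒯 f → α f = 0)
    (hβ : ∀ f, IsRadicalSqIn 𝒯 f → β f = 0) : ∃ μ, IsCycleFunctional 𝒯 α β μ := by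
  obtain ⟨F⟩ := hframe E he.mem
  let θ : (X ⟶ E) →ₗ[k] k := ∑ j, β (F.u j ≫ e) • (α ∘ₗ Linear.rightComp k X (F.v j))
  have hθ (w : X ⟶ E) : θ w = F.bracket α β w e := by
    simp only [θ, LinearMap.sum_apply, LinearMap.smul_apply, LinearMap.comp_apply, smul_eq_mul,
      SingleFrame.bracket]
    exact Finset.sum_congr rfl fun j _ => mul_comm _ _
  have hker : θ ∈ (Linear.rightComp k X e).ker.dualAnnihilator := by
    rw [Submodule.mem_dualAnnihilator]
    intro w hw
    obtain ⟨B, x₁, x₂, hB, hx₁, rfl, hx₂⟩ := hfac w hw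
    obtain ⟨F'⟩ := hframe B hB
    rw [hθ, SingleFrame.bracket_comp hY hY𝒯 hα hβ F' F x₂ hx₁ he.isRadicalHom, hx₂]
    simp [SingleFrame.bracket]
  rw [← LinearMap.range_dualMap_eq_dualAnnihilator_ker] at hker
  obtain ⟨μ, hμ⟩ := hker
  refine ⟨μ, fun Q F' f g hQ hf hg => ?_⟩
  obtain ⟨g', rfl⟩ := he.exists_factor g hQ hg
  rw [← SingleFrame.bracket_comp hY hY𝒯 hα hβ F' F g' hf he.isRadicalHom, ← hθ, ← hμ,
    LinearMap.dualMap_apply, ← Category.assoc]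
  rfl

variable [IsIdempotentComplete C] [∀ X Y : C, FiniteDimensional k (X ⟶ Y)] [HasBinaryBiproducts C]

lemma exists_trace_of_isCycleFunctional (h𝒯 : IsAdditiveClass 𝒯) (hX : IsLocalObject k X)
    (hX𝒯 : 𝒯 X) (hY : IsLocalObject k Y) (hY𝒯 : 𝒯 Y) (hXY : ∀ f : X ⟶ Y, IsRadicalHom f)
    {α : (X ⟶ Y) →ₗ[k] k} {β : (Y ⟶ X) →ₗ[k] k} {μ : (X ⟶ X) →ₗ[k] k} {ν : (Y ⟶ Y) →ₗ[k] k}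
    (hμ : IsCycleFunctional 𝒯 α β μ) (hν : IsCycleFunctional 𝒯 β α ν) :
    ∃ t : ObjectTrace 𝒯 k, ∀ f : X ⟶ X, t.tr X hX𝒯 f = μ f := by
  have hYX := hX.isRadicalHom_of_forall_isRadicalHom hXY
  have hμν (f : X ⟶ Y) (g : Y ⟶ X) : μ (f ≫ g) = ν (g ≫ f) := by
    rw [hμ.map_comp hX𝒯 hY𝒯 hYX (hXY f), hν.map_comp hY𝒯 hX𝒯 hXY (hYX g), mul_comm]
  let G : Bool → C := fun i => match i with
    | true => X
    | false => Y
  have hG : ∀ i, IsLocalObject k (G i) := by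
    rintro (_ | _)
    exacts [hY, hX]
  let φ : ∀ i, (G i ⟶ G i) →+ k := fun i => match i with
    | true => μ.toAddMonoidHom
    | false => ν.toAddMonoidHom
  obtain ⟨t, ht⟩ := exists_trace_of_frames (P := 𝒯) (exists_localFrame (k := k) h𝒯 hG) φ (by
    rintro (_ | _) (_ | _) f g
    · exact hY.apply_comp_comm ν (fun _ _ => hν.map_comp_eq_zero ⟨hY𝒯, fun _ => hXY⟩) f g
    · exact (hμν g f).symm
    · exact hμν f g
    · exact hX.apply_comp_comm μ (fun _ _ => hμ.map_comp_eq_zero ⟨hX𝒯, fun _ => hYX⟩) f g) (by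
    rintro (_ | _) W ⟨hW, hGW⟩ f g
    · exact hν.map_comp_eq_zero ⟨hW, fun _ => hGW true⟩ (hGW false f)
        (hY.isRadicalHom_of_forall_isRadicalHom (hGW false) g)
    · exact hμ.map_comp_eq_zero ⟨hW, fun _ => hGW false⟩ (hGW true f)
        (hX.isRadicalHom_of_forall_isRadicalHom (hGW true) g))
  exact ⟨t, ht true hX𝒯⟩

lemma isRadicalHom_of_not_isRadicalSqIn (h𝒯 : IsAdditiveClass 𝒯) (hk : TracesKillNilpotents k 𝒯)
    (hX : IsLocalObject k X) (hX𝒯 : 𝒯 X) (hY : IsLocalObject k Y) {b : X ⟶ Y}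
    (hb : IsRadicalHom b) (hbsq : ¬ IsRadicalSqIn 𝒯 b) (f : X ⟶ Y) : IsRadicalHom f := by
  by_contra hf
  have := hX.isIso_of_not_isRadicalHom hY f hf
  obtain ⟨Z, g, h, hZ, hg, hh, hgh⟩ := isRadicalSqIn_of_isRadicalHom_endo h𝒯 hk hX𝒯 hX (b ≫ inv f)
    (hb.comp_right _)
  exact hbsq ⟨Z, g, h ≫ f, hZ, hg, hh.comp_right f, by simp [reassoc_of% hgh]⟩

variable {S : C ⥤ C} [S.IsEquivalence] [S.Additive]

lemma SerreTrace.exists_isCycleFunctional (τ : SerreTrace k S)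
    (hct : IsClusterTiltingSubcategory S 𝒯) (hS : HasExactTriangles S)
    (hk : TracesKillNilpotents k 𝒯) (hX : IsLocalObject k X) (hX𝒯 : 𝒯 X) (hY : IsLocalObject k Y)
    (hY𝒯 : 𝒯 Y) {α : (X ⟶ Y) →ₗ[k] k} {β : (Y ⟶ X) →ₗ[k] k}
    (hα : ∀ f, IsRadicalSqIn 𝒯 f → α f = 0) (hβ : ∀ f, IsRadicalSqIn 𝒯 f → β f = 0) :
    ∃ μ, IsCycleFunctional 𝒯 α β μ := by
  obtain ⟨E₀, e₀, he₀⟩ := τ.exists_isSink hS hct.functoriallyFinite.1 hX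
  obtain ⟨E, e, he, hfree⟩ := he₀.exists_free hct.isAdditiveClass hX
    (isRadicalSqIn_of_isRadicalHom_endo hct.isAdditiveClass hk hX𝒯 hX)
  obtain ⟨Z, ι, γ, hZ⟩ := hS.exists_isFiberSequence e
  have htriangle : IsSinkTriangle S 𝒯 ι e γ := { hZ, he with free := hfree }
  refine he.exists_isCycleFunctional (fun w hw => ?_)
    (exists_localFrame hct.isAdditiveClass fun _ => hY) hY hY𝒯 hα hβ
  obtain ⟨x, rfl⟩ := hZ.exact_mid w hw
  obtain ⟨B, x₁, x₂, hB, hx₁, rfl⟩ := htriangle.exists_radical_factor τ hct hS hX𝒯 hX x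
  exact ⟨B, x₁, x₂ ≫ ι, hB, hx₁, by simp, by simp [hZ.comp]⟩

-- A functional detecting the two-cycle `b ≫ a` extends to a trace on `𝒯`, yet `b ≫ a` is nilpotent.
theorem isRadicalSqIn_or_of_two_cycle (τ : SerreTrace k S)
    (hct : IsClusterTiltingSubcategory S 𝒯) (hS : HasExactTriangles S)
    (hk : TracesKillNilpotents k 𝒯) (hX : IsLocalObject k X) (hX𝒯 : 𝒯 X) (hY : IsLocalObject k Y)
    (hY𝒯 : 𝒯 Y) {b : X ⟶ Y} {a : Y ⟶ X} (hb : IsRadicalHom b) :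
    IsRadicalSqIn 𝒯 b ∨ IsRadicalSqIn 𝒯 a := by
  have h𝒯 := hct.isAdditiveClass
  by_contra! ⟨hbsq, hasq⟩
  have hXY := isRadicalHom_of_not_isRadicalSqIn h𝒯 hk hX hX𝒯 hY hb hbsq
  have hYX := hX.isRadicalHom_of_forall_isRadicalHom hXY
  obtain ⟨α, hαb, hα⟩ := exists_dual_eq_one_of_notMem (radicalSqSubmodule k h𝒯 hX𝒯 Y) hbsq
  obtain ⟨β, hβa, hβ⟩ := exists_dual_eq_one_of_notMem (radicalSqSubmodule k h𝒯 hY𝒯 X) hasq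
  obtain ⟨μ, hμ⟩ := τ.exists_isCycleFunctional hct hS hk hX hX𝒯 hY hY𝒯 hα hβ
  obtain ⟨ν, hν⟩ := τ.exists_isCycleFunctional hct hS hk hY hY𝒯 hX hX𝒯 hβ hα
  obtain ⟨t, ht⟩ := exists_trace_of_isCycleFunctional h𝒯 hX hX𝒯 hY hY𝒯 hXY hμ hν
  have hzero : t.tr X hX𝒯 (b ≫ a) = 0 :=
    hk t X hX𝒯 _ ((hX.isRadicalHom_iff_isNilpotent _).1 (hb.comp_right a))
  have hone : t.tr X hX𝒯 (b ≫ a) = 1 := by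
    rw [ht, hμ.map_comp hX𝒯 hY𝒯 hYX hb, hαb, hβa, one_mul]
  exact one_ne_zero (hone.symm.trans hzero)

end TwoCycles

/-! ## Vanishing of Ext -/

section ExtVanishing

open Abelian

variable {R : Type u} [Ring R]

/-- The short complex in `ModuleCat R` given by an exact pair of linear maps. -/
def linearShortComplex {A B C : Type u} [AddCommGroup A] [AddCommGroup B] [AddCommGroup C]
    [Module R A] [Module R B] [Module R C] (f : A →ₗ[R] B) (g : B →ₗ[R] C)
    (h : Function.Exact f g) : ShortComplex (ModuleCat.{u} R) :=
  ShortComplex.mk (ModuleCat.ofHom f) (ModuleCat.ofHom g)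
    (by rw [← ModuleCat.ofHom_comp, h.linearMap_comp_eq_zero]; rfl)

lemma linearShortComplex_shortExact {A B C : Type u} [AddCommGroup A] [AddCommGroup B]
    [AddCommGroup C] [Module R A] [Module R B] [Module R C] {f : A →ₗ[R] B} {g : B →ₗ[R] C}
    (h : Function.Exact f g) (hf : Function.Injective f) (hg : Function.Surjective g) :
    (linearShortComplex f g h).ShortExact :=
  ModuleCat.shortComplex_shortExact _ h hf hg

lemma ker_shortExact {A B : Type u} [AddCommGroup A] [AddCommGroup B] [Module R A] [Module R B]
    {g : A →ₗ[R] B} (hg : Function.Surjective g) :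
    (linearShortComplex _ g (LinearMap.exact_subtype_ker_map g)).ShortExact :=
  linearShortComplex_shortExact _ (Submodule.subtype_injective _) hg

instance projective_finFree (m : ℕ) : Projective (ModuleCat.of R (Fin m → R)) :=
  ModuleCat.projective_of_free (Pi.basisFun R (Fin m))

/-- `Extⁱ(X, Y) = 0` for all `i > 0`. -/
def ExtVanishing (X Y : ModuleCat.{u} R) : Prop := ∀ i : ℕ, 0 < i → Subsingleton (Ext X Y i)

namespace ExtVanishing

variable {X Y Z : ModuleCat.{u} R} {S : ShortComplex (ModuleCat.{u} R)}

lemma of_projective [Projective X] : ExtVanishing X Y := by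
  intro i hi
  obtain ⟨i, rfl⟩ := Nat.exists_eq_succ_of_ne_zero hi.ne'
  exact subsingleton_of_forall_eq 0 fun e => Ext.eq_zero_of_projective e

lemma of_retract (r : Retract Y Z) (hZ : ExtVanishing X Z) : ExtVanishing X Y := by
  intro i hi
  have := hZ i hi
  refine subsingleton_of_forall_eq 0 fun e => ?_
  have he : (e.comp (Ext.mk₀ r.i) (add_zero i)).comp (Ext.mk₀ r.r) (add_zero i) = e := by
    rw [Ext.comp_assoc_of_second_deg_zero, Ext.mk₀_comp_mk₀, r.retract, Ext.comp_mk₀_id]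
  rw [← he, Subsingleton.elim (e.comp (Ext.mk₀ r.i) (add_zero i)) 0, Ext.zero_comp]

lemma of_retract_left (r : Retract X Z) (hZ : ExtVanishing Z Y) : ExtVanishing X Y := by
  intro i hi
  have := hZ i hi
  refine subsingleton_of_forall_eq 0 fun e => ?_
  have he : (Ext.mk₀ r.i).comp ((Ext.mk₀ r.r).comp e (zero_add i)) (zero_add i) = e := by
    rw [Ext.mk₀_comp_mk₀_assoc, r.retract, Ext.mk₀_id_comp]
  rw [← he, Subsingleton.elim ((Ext.mk₀ r.r).comp e (zero_add i)) 0, Ext.comp_zero]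

lemma middle (hS : S.ShortExact) (h₁ : ExtVanishing X S.X₁) (h₃ : ExtVanishing X S.X₃) :
    ExtVanishing X S.X₂ := by
  intro i hi
  have := h₁ i hi
  have := h₃ i hi
  refine subsingleton_of_forall_eq 0 fun e => ?_
  obtain ⟨e', rfl⟩ := Ext.covariant_sequence_exact₂ X hS e (Subsingleton.elim _ _)
  rw [Subsingleton.elim e' 0, Ext.zero_comp]

lemma right (hS : S.ShortExact) (h₁ : ExtVanishing X S.X₁) (h₂ : ExtVanishing X S.X₂) :
    ExtVanishing X S.X₃ := by
  intro i hi
  have := h₁ (i + 1) i.succ_pos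
  have := h₂ i hi
  refine subsingleton_of_forall_eq 0 fun e => ?_
  obtain ⟨e', rfl⟩ := Ext.covariant_sequence_exact₃ X hS e rfl (Subsingleton.elim _ _)
  rw [Subsingleton.elim e' 0, Ext.zero_comp]

lemma exists_lift (hS : S.ShortExact) (h₁ : ExtVanishing X S.X₁) (f : X ⟶ S.X₃) :
    ∃ g, g ≫ S.g = f := by
  have := h₁ 1 one_pos
  obtain ⟨e, he⟩ := Ext.covariant_sequence_exact₃ X hS (Ext.mk₀ f) (zero_add 1)
    (Subsingleton.elim _ _)
  obtain ⟨g, rfl⟩ := Ext.homEquiv₀.symm.surjective e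
  refine ⟨g, ?_⟩
  rw [Ext.homEquiv₀_symm_apply, Ext.mk₀_comp_mk₀] at he
  exact Ext.homEquiv₀.symm.injective he

lemma of_cokernel (hS : S.ShortExact) (h₁ : ExtVanishing S.X₁ Y) (h₂ : ExtVanishing S.X₂ Y)
    (hext : ∀ f : S.X₁ ⟶ Y, ∃ g, S.f ≫ g = f) : ExtVanishing S.X₃ Y := by
  intro i hi
  have := h₂ i hi
  refine subsingleton_of_forall_eq 0 fun e => ?_
  obtain ⟨i, rfl⟩ := Nat.exists_eq_succ_of_ne_zero hi.ne'
  obtain ⟨e', rfl⟩ := Ext.contravariant_sequence_exact₃ hS Y e (Subsingleton.elim _ _)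
    (add_comm 1 i)
  rcases Nat.eq_zero_or_pos i with rfl | hi'
  · obtain ⟨f, rfl⟩ := Ext.homEquiv₀.symm.surjective e'
    obtain ⟨g, rfl⟩ := hext f
    rw [Ext.homEquiv₀_symm_apply, ← Ext.mk₀_comp_mk₀, ← Ext.comp_assoc _ _ _ _ (add_zero 0)
      (by lia), hS.extClass_comp, Ext.zero_comp]
    rfl
  · have := h₁ i hi'
    rw [Subsingleton.elim e' 0, Ext.comp_zero]

lemma free (hX : ExtVanishing X (ModuleCat.of R R)) (m : ℕ) :
    ExtVanishing X (ModuleCat.of R (Fin m → R)) := by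
  induction m with
  | zero =>
    refine of_retract ⟨0, 0, ?_⟩ hX
    exact ModuleCat.hom_ext (LinearMap.ext fun x => Subsingleton.elim (α := Fin 0 → R) _ _)
  | succ m ih =>
    have hexact : Function.Exact (LinearMap.single R (fun _ : Fin (m + 1) => R) 0)
        (LinearMap.funLeft R R (Fin.succ : Fin m → Fin (m + 1))) := by
      refine fun x => ⟨fun hx => ⟨x 0, ?_⟩, ?_⟩
      · ext j
        refine Fin.cases (by simp) (fun j => ?_) j
        have hxj : x j.succ = 0 := congrFun hx j
        simp [hxj]
      · rintro ⟨y, rfl⟩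
        ext j
        simp [LinearMap.funLeft_apply]
    exact middle (linearShortComplex_shortExact hexact
      (Pi.single_injective (M := fun _ : Fin (m + 1) => R) 0)
      (LinearMap.funLeft_surjective_of_injective _ _ _ (Fin.succ_injective m))) hX ih

lemma of_projectiveDimension [IsNoetherianRing R] (hX : ExtVanishing X (ModuleCat.of R R)) (n : ℕ)
    (Y : Type u) [AddCommGroup Y] [Module R Y] [Module.Finite R Y]
    (hY : HasProjectiveDimensionLT (ModuleCat.of R Y) (n + 1)) :
    ExtVanishing X (ModuleCat.of R Y) := by
  induction n generalizing Y with
  | zero =>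
    have : Module.Projective R Y := (IsProjective.iff_projective Y).2 inferInstance
    obtain ⟨m, p, hp⟩ := Module.Finite.exists_fin' R Y
    obtain ⟨s, hs⟩ := Module.projective_lifting_property p LinearMap.id hp
    refine of_retract ⟨ModuleCat.ofHom s, ModuleCat.ofHom p, ?_⟩ (hX.free m)
    rw [← ModuleCat.ofHom_comp, hs]
    rfl
  | succ n ih =>
    obtain ⟨m, p, hp⟩ := Module.Finite.exists_fin' R Y
    have hK := (ker_shortExact hp).hasProjectiveDimensionLT_X₁ (n + 1)
      (inferInstanceAs (HasProjectiveDimensionLT (ModuleCat.of R (Fin m → R)) (n + 1))) hY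
    exact right (ker_shortExact hp) (ih _ hK) (hX.free m)

end ExtVanishing

end ExtVanishing

/-! ## Duality with right modules -/

section RightDual

open MulOpposite

variable (k R : Type u) [Field k] [Ring R] [Algebra k R]

/-- The `k`-dual of a right `R`-module, with its left `R`-module structure. It is a type synonym:
`M →ₗ[k] k` itself is reserved for its `k`-module structure. -/
def RightDual (M : Type u) [AddCommGroup M] [Module k M] : Type u := M →ₗ[k] k

/-- The `k`-dual of the left module `R`, an injective cogenerator of the right `R`-modules. Like
`RightDual`, it is a type synonym. -/
def RingDual : Type u := R →ₗ[k] k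

namespace RightDual

section

variable (M : Type u) [AddCommGroup M] [Module k M]

instance : AddCommGroup (RightDual k M) := inferInstanceAs (AddCommGroup (M →ₗ[k] k))

instance : Module k (RightDual k M) := inferInstanceAs (Module k (M →ₗ[k] k))

instance [FiniteDimensional k M] : FiniteDimensional k (RightDual k M) :=
  inferInstanceAs (FiniteDimensional k (M →ₗ[k] k))

instance : FunLike (RightDual k M) M k := inferInstanceAs (FunLike (M →ₗ[k] k) M k)

instance : LinearMapClass (RightDual k M) k M k :=
  inferInstanceAs (LinearMapClass (M →ₗ[k] k) k M k)

variable {k M}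

@[ext] lemma ext {φ ψ : RightDual k M} (h : ∀ m, φ m = ψ m) : φ = ψ := DFunLike.ext _ _ h

@[simp] lemma add_apply (φ ψ : RightDual k M) (m : M) : (φ + ψ) m = φ m + ψ m := rfl

@[simp] lemma zero_apply (m : M) : (0 : RightDual k M) m = 0 := rfl

@[simp] lemma k_smul_apply (c : k) (φ : RightDual k M) (m : M) : (c • φ) m = c * φ m := rfl

/-- A linear form, as an element of the module of linear forms. -/
def of (φ : M →ₗ[k] k) : RightDual k M := φ

@[simp] lemma of_apply (φ : M →ₗ[k] k) (m : M) : of φ m = φ m := rfl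

/-- An element of the module of linear forms, as a linear form. -/
def toLinearMap (φ : RightDual k M) : M →ₗ[k] k := φ

@[simp] lemma toLinearMap_apply (φ : RightDual k M) (m : M) : φ.toLinearMap m = φ m := rfl

end

variable (M : Type u) [AddCommGroup M] [Module k M] [Module Rᵐᵒᵖ M] [IsScalarTower k Rᵐᵒᵖ M]

instance : SMul R (RightDual k M) where
  smul r φ := of (φ.toLinearMap ∘ₗ (Algebra.lsmul k k M (op r)))

variable {k R M}

@[simp] lemma smul_apply (r : R) (φ : RightDual k M) (m : M) : (r • φ) m = φ (op r • m) := rfl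

variable (k R M)

instance : Module R (RightDual k M) where
  one_smul φ := by ext; simp
  mul_smul r s φ := by ext; simp [mul_smul]
  smul_zero r := by ext; simp
  smul_add r φ ψ := by ext; simp
  add_smul r s φ := by ext; simp [add_smul]
  zero_smul φ := by ext; simp

instance : IsScalarTower k R (RightDual k M) where
  smul_assoc c r φ := by ext m; simp [smul_assoc]

instance [FiniteDimensional k M] : Module.Finite R (RightDual k M) :=
  Module.Finite.of_restrictScalars_finite k R _

variable {k R M} {N L : Type u} [AddCommGroup N] [Module k N] [Module Rᵐᵒᵖ N]
  [IsScalarTower k Rᵐᵒᵖ N] [AddCommGroup L] [Module k L] [Module Rᵐᵒᵖ L] [IsScalarTower k Rᵐᵒᵖ L]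

variable (k) in
/-- The transpose of a map of right modules. -/
def map (f : M →ₗ[Rᵐᵒᵖ] N) : RightDual k N →ₗ[R] RightDual k M where
  toFun φ := of (φ.toLinearMap ∘ₗ f.restrictScalars k)
  map_add' φ ψ := rfl
  map_smul' r φ := by ext m; simp

@[simp] lemma map_apply (f : M →ₗ[Rᵐᵒᵖ] N) (φ : RightDual k N) (m : M) :
    map k f φ m = φ (f m) := rfl

lemma map_surjective {f : M →ₗ[Rᵐᵒᵖ] N} (hf : Function.Injective f) :
    Function.Surjective (map k f) := fun φ => by
  obtain ⟨g, hg⟩ := LinearMap.exists_leftInverse_of_injective (f.restrictScalars k)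
    (LinearMap.ker_eq_bot.2 hf)
  refine ⟨of (φ.toLinearMap ∘ₗ g), ?_⟩
  ext m
  exact congrArg φ (LinearMap.congr_fun hg m)

lemma map_injective {f : M →ₗ[Rᵐᵒᵖ] N} (hf : Function.Surjective f) :
    Function.Injective (map k f) := fun φ ψ h => by
  ext n
  obtain ⟨m, rfl⟩ := hf n
  exact DFunLike.congr_fun h m

lemma map_exact {f : M →ₗ[Rᵐᵒᵖ] N} {g : N →ₗ[Rᵐᵒᵖ] L} (h : Function.Exact f g)
    (hg : Function.Surjective g) : Function.Exact (map k g) (map k f) := by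
  refine fun φ => ⟨fun hφ => ?_, ?_⟩
  · have hker : LinearMap.ker (g.restrictScalars k) ≤ LinearMap.ker φ.toLinearMap := by
      intro n hn
      obtain ⟨m, rfl⟩ := (h n).1 hn
      exact DFunLike.congr_fun hφ m
    obtain ⟨s, hs⟩ := LinearMap.exists_rightInverse_of_surjective (g.restrictScalars k)
      (LinearMap.range_eq_top.2 hg)
    refine ⟨of (φ.toLinearMap ∘ₗ s), ext fun n => ?_⟩
    have hsn : s (g n) - n ∈ LinearMap.ker (g.restrictScalars k) := by
      rw [LinearMap.mem_ker, map_sub, sub_eq_zero]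
      exact LinearMap.congr_fun hs (g n)
    have hφn : φ.toLinearMap (s (g n) - n) = 0 := hker hsn
    rwa [map_sub, sub_eq_zero] at hφn
  · rintro ⟨ψ, rfl⟩
    ext m
    simp [h.apply_apply_eq_zero m]

variable {X : Type u} [AddCommGroup X] [Module k X] [Module R X] [IsScalarTower k R X]

variable (R) in
/-- The map from a left module `X` to the dual of the right module `R` given by a linear form on
`X`, under the adjunction `Hom_R(X, Hom_k(R, k)) ≅ Hom_k(X, k)`. -/
def ofForm (ξ : X →ₗ[k] k) : X →ₗ[R] RightDual k Rᵐᵒᵖ where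
  toFun y := of (ξ ∘ₗ (LinearMap.toSpanSingleton R X y).restrictScalars k ∘ₗ
    (opLinearEquiv k).symm.toLinearMap)
  map_add' y z := ext fun s => by
    change ξ (s.unop • (y + z)) = ξ (s.unop • y) + ξ (s.unop • z)
    rw [smul_add, map_add]
  map_smul' r y := ext fun s => by
    change ξ (s.unop • r • y) = ξ ((s.unop * r) • y)
    rw [mul_smul]

lemma ofForm_apply (ξ : X →ₗ[k] k) (y : X) (s : Rᵐᵒᵖ) : ofForm R ξ y s = ξ (s.unop • y) := rfl

end RightDual

namespace RingDual

instance : AddCommGroup (RingDual k R) := inferInstanceAs (AddCommGroup (R →ₗ[k] k))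

instance : Module k (RingDual k R) := inferInstanceAs (Module k (R →ₗ[k] k))

instance [FiniteDimensional k R] : FiniteDimensional k (RingDual k R) :=
  inferInstanceAs (FiniteDimensional k (R →ₗ[k] k))

instance : FunLike (RingDual k R) R k := inferInstanceAs (FunLike (R →ₗ[k] k) R k)

instance : LinearMapClass (RingDual k R) k R k :=
  inferInstanceAs (LinearMapClass (R →ₗ[k] k) k R k)

variable {k R}

@[ext] lemma ext {φ ψ : RingDual k R} (h : ∀ m, φ m = ψ m) : φ = ψ := DFunLike.ext _ _ h

@[simp] lemma add_apply (φ ψ : RingDual k R) (m : R) : (φ + ψ) m = φ m + ψ m := rfl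

@[simp] lemma zero_apply (m : R) : (0 : RingDual k R) m = 0 := rfl

@[simp] lemma k_smul_apply (c : k) (φ : RingDual k R) (m : R) : (c • φ) m = c * φ m := rfl

/-- A linear form, as an element of the module of linear forms. -/
def of (φ : R →ₗ[k] k) : RingDual k R := φ

/-- An element of the module of linear forms, as a linear form. -/
def toLinearMap (φ : RingDual k R) : R →ₗ[k] k := φ

variable (k R)

instance : SMul Rᵐᵒᵖ (RingDual k R) where
  smul r φ := of (φ.toLinearMap ∘ₗ LinearMap.mulLeft k r.unop)

variable {k R}

@[simp] lemma smul_apply (r : Rᵐᵒᵖ) (φ : RingDual k R) (s : R) : (r • φ) s = φ (r.unop * s) := rfl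

variable (k R)

instance : Module Rᵐᵒᵖ (RingDual k R) where
  one_smul φ := by ext; simp
  mul_smul r s φ := by ext; simp [mul_assoc]
  smul_zero r := by ext; simp
  smul_add r φ ψ := by ext; simp
  add_smul r s φ := by ext; simp [add_mul]
  zero_smul φ := by ext; simp

instance : IsScalarTower k Rᵐᵒᵖ (RingDual k R) where
  smul_assoc c r φ := by ext m; simp

variable {k} {M : Type u} [AddCommGroup M] [Module k M] [Module Rᵐᵒᵖ M] [IsScalarTower k Rᵐᵒᵖ M]

/-- The map from a right module `M` to the dual of the left module `R` given by a linear form on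
`M`, under the adjunction `Hom_R(M, Hom_k(R, k)) ≅ Hom_k(M, k)`. -/
def ofForm (ξ : M →ₗ[k] k) : M →ₗ[Rᵐᵒᵖ] RingDual k R where
  toFun x := of (ξ ∘ₗ (LinearMap.toSpanSingleton Rᵐᵒᵖ M x).restrictScalars k ∘ₗ
    (opLinearEquiv k).toLinearMap)
  map_add' x y := ext fun s => by
    change ξ (op s • (x + y)) = ξ (op s • x) + ξ (op s • y)
    rw [smul_add, map_add]
  map_smul' r x := ext fun s => by
    change ξ (op s • r • x) = ξ ((op s * r) • x)
    rw [mul_smul]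

variable {R} in
lemma ofForm_apply (ξ : M →ₗ[k] k) (x : M) (s : R) : ofForm R ξ x s = ξ (op s • x) := rfl

variable (k)

instance : Module.Injective Rᵐᵒᵖ (RingDual k R) where
  out X Y _ _ _ _ f hf g := by
    let _ := Module.restrictScalars k Rᵐᵒᵖ X
    have := IsScalarTower.restrictScalars k Rᵐᵒᵖ X
    let _ := Module.restrictScalars k Rᵐᵒᵖ Y
    have := IsScalarTower.restrictScalars k Rᵐᵒᵖ Y
    let evalOne : RingDual k R →ₗ[k] k :=
      { toFun := fun φ => φ 1
        map_add' := fun _ _ => rfl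
        map_smul' := fun _ _ => rfl }
    obtain ⟨p, hp⟩ := LinearMap.exists_leftInverse_of_injective (f.restrictScalars k)
      (LinearMap.ker_eq_bot.2 hf)
    refine ⟨ofForm R (evalOne ∘ₗ g.restrictScalars k ∘ₗ p), fun x => ext fun s => ?_⟩
    have hps : p (op s • f x) = op s • x := by
      rw [← f.map_smul]
      exact LinearMap.congr_fun hp (op s • x)
    calc g (p (op s • f x)) 1 = (op s • g x) 1 := by rw [hps, map_smul]
      _ = g x s := by simp

lemma exists_embedding (M : Type u) [AddCommGroup M] [Module k M] [Module Rᵐᵒᵖ M]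
    [IsScalarTower k Rᵐᵒᵖ M] [FiniteDimensional k M] :
    ∃ (m : ℕ) (f : M →ₗ[Rᵐᵒᵖ] (Fin m → RingDual k R)), Function.Injective f := by
  let b := Module.finBasis k M
  refine ⟨_, LinearMap.pi fun j => ofForm R (b.coord j), (injective_iff_map_eq_zero _).2 ?_⟩
  refine fun x hx => b.ext_elem fun j => ?_
  have hj : b.coord j (op (1 : R) • x) = 0 := DFunLike.congr_fun (congrFun hx j) (1 : R)
  simpa using hj

/-- The biduality map of `Rᵐ`, with `RingDual k R ^ m` in the role of the dual of `Rᵐ`. -/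
def eval (m : ℕ) : (Fin m → R) →ₗ[R] RightDual k (Fin m → RingDual k R) where
  toFun r := RightDual.of
    { toFun := fun φ => ∑ j, φ j (r j)
      map_add' := fun φ ψ => by simp [Finset.sum_add_distrib]
      map_smul' := fun c φ => by simp [Finset.mul_sum] }
  map_add' r s := RightDual.ext fun φ => by
    change ∑ j, φ j (r j + s j) = ∑ j, φ j (r j) + ∑ j, φ j (s j)
    simp [Finset.sum_add_distrib]
  map_smul' r s := RightDual.ext fun φ => by
    change ∑ j, φ j (r * s j) = ∑ j, (op r • φ) j (s j)
    simp

lemma eval_apply (m : ℕ) (r : Fin m → R) (φ : Fin m → RingDual k R) :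
    eval k R m r φ = ∑ j, φ j (r j) := rfl

lemma eval_injective (m : ℕ) : Function.Injective (eval k R m) := by
  rw [injective_iff_map_eq_zero]
  intro r hr
  ext j
  by_contra hrj
  obtain ⟨φ, hφ⟩ := Module.Projective.exists_dual_ne_zero k (show r j ≠ 0 from hrj)
  have hsum := DFunLike.congr_fun hr (Pi.single j (of φ))
  rw [eval_apply, Finset.sum_eq_single j (fun i _ hij => by
    rw [Pi.single_eq_of_ne hij, zero_apply]) (by simp), Pi.single_eq_same] at hsum
  exact hφ hsum

lemma eval_surjective [FiniteDimensional k R] (m : ℕ) : Function.Surjective (eval k R m) := by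
  intro Ψ
  choose r hr using fun j : Fin m => (Module.evalEquiv k R).surjective
    (Ψ.toLinearMap ∘ₗ LinearMap.single k (fun _ : Fin m => RingDual k R) j)
  refine ⟨r, RightDual.ext fun φ => ?_⟩
  calc eval k R m r φ = ∑ j, Ψ (Pi.single j (φ j)) :=
        (eval_apply k R m r φ).trans
          (Finset.sum_congr rfl fun j _ => LinearMap.congr_fun (hr j) (φ j).toLinearMap)
    _ = Ψ φ := by rw [← map_sum, Finset.univ_sum_single]

instance [FiniteDimensional k R] (m : ℕ) :
    Module.Projective R (RightDual k (Fin m → RingDual k R)) :=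
  Module.Projective.of_equiv
    (LinearEquiv.ofBijective (eval k R m) ⟨eval_injective k R m, eval_surjective k R m⟩)

end RingDual

namespace RightDual

lemma projective_of_injective [FiniteDimensional k R] (M : Type u)
    [AddCommGroup M] [Module k M] [Module Rᵐᵒᵖ M] [IsScalarTower k Rᵐᵒᵖ M] [FiniteDimensional k M]
    [Module.Injective Rᵐᵒᵖ M] : Module.Projective R (RightDual k M) := by
  obtain ⟨m, f, hf⟩ := RingDual.exists_embedding k R M
  obtain ⟨p, hp⟩ := Module.Injective.out f hf LinearMap.id
  refine Module.Projective.of_split (map k p) (map k f) ?_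
  ext φ x
  simp [hp]

lemma hasProjectiveDimensionLT [FiniteDimensional k R] (n : ℕ) (M : Type u)
    [AddCommGroup M] [Module k M] [Module Rᵐᵒᵖ M] [IsScalarTower k Rᵐᵒᵖ M] [FiniteDimensional k M]
    (hM : HasInjectiveDimensionLT (ModuleCat.of Rᵐᵒᵖ M) (n + 1)) :
    HasProjectiveDimensionLT (ModuleCat.of R (RightDual k M)) (n + 1) := by
  induction n generalizing M with
  | zero =>
    have : Module.Injective Rᵐᵒᵖ M :=
      Module.injective_module_of_injective_object _ _ (inj := inferInstance)
    have := (IsProjective.iff_projective (R := R) _).1 (projective_of_injective k R M)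
    infer_instance
  | succ n ih =>
    obtain ⟨m, f, hf⟩ := RingDual.exists_embedding k R M
    have hexact : Function.Exact f (LinearMap.range f).mkQ := LinearMap.exact_map_mkQ_range f
    have hmkQ := (LinearMap.range f).mkQ_surjective
    have : Injective (ModuleCat.of Rᵐᵒᵖ (Fin m → RingDual k R)) :=
      Module.injective_object_of_injective_module _ _
    have hcoker := ih _ ((linearShortComplex_shortExact hexact hf
      hmkQ).hasInjectiveDimensionLT_X₃ (n + 1) (inferInstanceAs
        (HasInjectiveDimensionLT (ModuleCat.of Rᵐᵒᵖ (Fin m → RingDual k R)) (n + 1))) hM)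
    have : Projective (ModuleCat.of R (RightDual k (Fin m → RingDual k R))) :=
      (IsProjective.iff_projective (R := R) _).1 inferInstance
    exact (linearShortComplex_shortExact (map_exact (k := k) hexact hmkQ) (map_injective hmkQ)
      (map_surjective hf)).hasProjectiveDimensionLT_X₃ (n + 1) hcoker
        (inferInstanceAs (HasProjectiveDimensionLT
          (ModuleCat.of R (RightDual k (Fin m → RingDual k R))) (n + 1 + 1)))

end RightDual

end RightDual

/-! ## Gorenstein projective approximations -/

section PushoutAlongInjection

variable {R : Type u} [Ring R] {G A B M : Type u} [AddCommGroup G] [AddCommGroup A]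
  [AddCommGroup B] [AddCommGroup M] [Module R G] [Module R A] [Module R B] [Module R M]

/-- The pushout of `g` and `j`. The sign of the usual antidiagonal is omitted, which replaces `j`
by `-j`. -/
abbrev LinearPushout (g : G →ₗ[R] A) (j : G →ₗ[R] B) : Type u :=
  (A × B) ⧸ LinearMap.range (g.prod j)

namespace LinearPushout

variable {g : G →ₗ[R] A} {p : A →ₗ[R] M} (j : G →ₗ[R] B)

/-- The map out of the pushout which is `p` on `A` and zero on `B`. -/
def desc (h : Function.Exact g p) : LinearPushout g j →ₗ[R] M :=
  (LinearMap.range (g.prod j)).liftQ (p ∘ₗ LinearMap.fst R A B) (by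
    rintro _ ⟨x, rfl⟩
    exact h.apply_apply_eq_zero x)

lemma desc_surjective (h : Function.Exact g p) (hp : Function.Surjective p) :
    Function.Surjective (desc j h) := by
  intro y
  obtain ⟨x, rfl⟩ := hp y
  exact ⟨Submodule.Quotient.mk (x, 0), rfl⟩

/-- The map `B → LinearPushout g j`, which takes values in the kernel of `desc j h`. -/
def toKerDesc (h : Function.Exact g p) : B →ₗ[R] LinearMap.ker (desc j h) :=
  ((LinearMap.range (g.prod j)).mkQ ∘ₗ LinearMap.inr R A B).codRestrict _ fun _ => map_zero p

lemma exact_toKerDesc (h : Function.Exact g p) :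
    Function.Exact (j ∘ₗ (LinearMap.ker g).subtype) (toKerDesc j h) := by
  intro y
  have hy : toKerDesc j h y = 0 ↔ ((0, y) : A × B) ∈ LinearMap.range (g.prod j) := by
    rw [← Submodule.Quotient.mk_eq_zero]
    exact Subtype.ext_iff
  rw [hy]
  constructor
  · rintro ⟨x, hx⟩
    exact ⟨⟨x, congrArg Prod.fst hx⟩, congrArg Prod.snd hx⟩
  · rintro ⟨⟨x, hx⟩, rfl⟩
    exact ⟨x, Prod.ext hx rfl⟩

lemma toKerDesc_surjective (h : Function.Exact g p) : Function.Surjective (toKerDesc j h) := by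
  rintro ⟨z, hz⟩
  obtain ⟨⟨x, y⟩, rfl⟩ := Submodule.Quotient.mk_surjective _ z
  obtain ⟨w, rfl⟩ := (h x).1 hz
  refine ⟨y - j w, Subtype.ext ((Submodule.Quotient.eq _).2 ⟨-w, Prod.ext ?_ ?_⟩)⟩
  · change g (-w) = 0 - g w
    rw [map_neg, zero_sub]
  · change j (-w) = y - j w - y
    rw [map_neg]
    abel

lemma hasProjectiveDimensionLT_ker_desc [Module.Projective R B] (h : Function.Exact g p)
    (hj : Function.Injective j) (d : ℕ)
    (hd : HasProjectiveDimensionLT (ModuleCat.of R (LinearMap.ker g)) d) :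
    HasProjectiveDimensionLT (ModuleCat.of R (LinearMap.ker (desc j h))) (d + 1) := by
  have := (IsProjective.iff_projective (R := R) B).1 inferInstance
  exact (linearShortComplex_shortExact (exact_toKerDesc j h)
    (hj.comp (Submodule.subtype_injective _))
    (toKerDesc_surjective j h)).hasProjectiveDimensionLT_X₃ d hd
      (inferInstanceAs (HasProjectiveDimensionLT (ModuleCat.of R B) (d + 1)))

lemma isGorensteinProjective [Module.Projective R A] [Module.Finite R A] [Module.Projective R B]
    [Module.Finite R B] (hG : ExtVanishing (ModuleCat.of R G) (ModuleCat.of R R))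
    (hj : Function.Injective j) (hext : ∀ f : G →ₗ[R] R, ∃ f' : B →ₗ[R] R, f' ∘ₗ j = f) :
    isGorensteinProjective R (ModuleCat.of R (LinearPushout g j)) := by
  refine ⟨inferInstanceAs (Module.Finite R (_ ⧸ LinearMap.range (g.prod j))), ?_⟩
  have hproj : Projective (ModuleCat.of R (A × B)) :=
    (IsProjective.iff_projective (R := R) _).1 inferInstance
  refine ExtVanishing.of_cokernel (linearShortComplex_shortExact
    (LinearMap.exact_map_mkQ_range (g.prod j)) (fun x y hxy => hj (congrArg Prod.snd hxy))
    (Submodule.mkQ_surjective _)) hG (ExtVanishing.of_projective (X := ModuleCat.of R (A × B)))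
    fun f => ?_
  obtain ⟨f', hf'⟩ := hext f.hom
  exact ⟨ModuleCat.ofHom (f' ∘ₗ LinearMap.snd R A B), ModuleCat.hom_ext hf'⟩

end LinearPushout

end PushoutAlongInjection

section Approximation

open Abelian

variable {R : Type u} [Ring R]

lemma ExtVanishing.exists_factorization_free [IsNoetherianRing R] {X Y : Type u} [AddCommGroup X]
    [AddCommGroup Y] [Module R X] [Module R Y] [Module.Finite R Y]
    (hX : ExtVanishing (ModuleCat.of R X) (ModuleCat.of R R)) {n : ℕ}
    (hY : HasProjectiveDimensionLT (ModuleCat.of R Y) (n + 1)) (φ : X →ₗ[R] Y) :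
    ∃ (m : ℕ) (g : X →ₗ[R] (Fin m → R)) (p : (Fin m → R) →ₗ[R] Y), p ∘ₗ g = φ := by
  obtain ⟨m, p, hp⟩ := Module.Finite.exists_fin' R Y
  have hpd := (ker_shortExact hp).hasProjectiveDimensionLT_X₁ (n + 1)
    (inferInstanceAs (HasProjectiveDimensionLT (ModuleCat.of R (Fin m → R)) (n + 1)))
    (hasProjectiveDimensionLT_of_ge (ModuleCat.of R Y) (n + 1) (n + 2) (by lia))
  have hker : ExtVanishing (ModuleCat.of R X) (ModuleCat.of R (LinearMap.ker p)) :=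
    hX.of_projectiveDimension n _ hpd
  obtain ⟨g, hg⟩ := hker.exists_lift (ker_shortExact hp) (ModuleCat.ofHom φ)
  exact ⟨m, g.hom, p, congrArg ModuleCat.Hom.hom hg⟩

lemma IsGorensteinRing.exists_linearMap_ne_zero (hR : IsGorensteinRing R) (k : Type u) [Field k]
    [Algebra k R] [FiniteDimensional k R] {X : Type u} [AddCommGroup X] [Module R X]
    (hX : ExtVanishing (ModuleCat.of R X) (ModuleCat.of R R)) {x : X} (hx : x ≠ 0) :
    ∃ f : X →ₗ[R] R, f x ≠ 0 := by
  have := hR.noetherian_left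
  obtain ⟨n, hn⟩ := hR.injdim_right
  have : FiniteDimensional k Rᵐᵒᵖ := Module.Finite.equiv (MulOpposite.opLinearEquiv k)
  let _ := Module.restrictScalars k R X
  have := IsScalarTower.restrictScalars k R X
  obtain ⟨ξ, hξ⟩ := Module.Projective.exists_dual_ne_zero k hx
  obtain ⟨m, g, p, hpg⟩ := hX.exists_factorization_free
    (RightDual.hasProjectiveDimensionLT k R n Rᵐᵒᵖ hn) (RightDual.ofForm R ξ)
  have hgx : g x ≠ 0 := fun hgx => hξ <|
    calc ξ x = RightDual.ofForm R ξ x 1 := by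
          rw [RightDual.ofForm_apply, MulOpposite.unop_one, one_smul]
      _ = p (g x) 1 := by rw [← hpg, LinearMap.comp_apply]
      _ = 0 := by rw [hgx, map_zero, RightDual.zero_apply]
  obtain ⟨j, hj⟩ := Function.ne_iff.1 hgx
  exact ⟨LinearMap.proj j ∘ₗ g, hj⟩

lemma exists_left_free_approximation (k : Type u) [Field k] [Algebra k R] [FiniteDimensional k R]
    (X : Type u) [AddCommGroup X] [Module R X] [Module.Finite R X] :
    ∃ (m : ℕ) (j : X →ₗ[R] (Fin m → R)),
      ∀ f : X →ₗ[R] R, ∃ g : (Fin m → R) →ₗ[R] R, g ∘ₗ j = f := by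
  let _ := Module.restrictScalars k R X
  have := IsScalarTower.restrictScalars k R X
  have : Module.Finite k X := Module.Finite.trans R X
  let forget : (X →ₗ[R] R) →ₗ[k] (X →ₗ[k] R) :=
    { toFun := fun f => f.restrictScalars k
      map_add' := fun _ _ => rfl
      map_smul' := fun _ _ => rfl }
  have : FiniteDimensional k (X →ₗ[R] R) := FiniteDimensional.of_injective forget
    fun f g h => LinearMap.ext fun x => LinearMap.congr_fun h x
  let b := Module.finBasis k (X →ₗ[R] R)
  refine ⟨_, LinearMap.pi b, fun f => ⟨∑ i, b.repr f i • LinearMap.proj i, ?_⟩⟩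
  ext x
  have hfx : (∑ i, b.repr f i • b i) x = f x := LinearMap.congr_fun (b.sum_repr f) x
  rw [LinearMap.sum_apply] at hfx
  simpa using hfx

lemma IsGorensteinRing.exists_free_hull (hR : IsGorensteinRing R) (k : Type u) [Field k]
    [Algebra k R] [FiniteDimensional k R] {X : Type u} [AddCommGroup X] [Module R X]
    [Module.Finite R X] (hX : ExtVanishing (ModuleCat.of R X) (ModuleCat.of R R)) :
    ∃ (m : ℕ) (j : X →ₗ[R] (Fin m → R)), Function.Injective j ∧
      ∀ f : X →ₗ[R] R, ∃ g : (Fin m → R) →ₗ[R] R, g ∘ₗ j = f := by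
  obtain ⟨m, j, hext⟩ := exists_left_free_approximation k X (R := R)
  refine ⟨m, j, (injective_iff_map_eq_zero j).2 fun x hx => ?_, hext⟩
  by_contra hx0
  obtain ⟨f, hf⟩ := hR.exists_linearMap_ne_zero k hX hx0
  obtain ⟨g, rfl⟩ := hext f
  exact hf (by rw [LinearMap.comp_apply, hx, map_zero])

lemma subsingleton_ext_ker {P M : Type u} [AddCommGroup P] [AddCommGroup M] [Module R P]
    [Module R M] [Module.Projective R P] {p : P →ₗ[R] M} (hp : Function.Surjective p)
    (Y : ModuleCat.{u} R) {i : ℕ} (hi : 0 < i)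
    (h : Subsingleton (Ext (ModuleCat.of R M) Y (i + 1))) :
    Subsingleton (Ext (ModuleCat.of R (LinearMap.ker p)) Y i) := by
  have hproj := (IsProjective.iff_projective (R := R) P).1 inferInstance
  have hP := ExtVanishing.of_projective (X := ModuleCat.of R P) (Y := Y) i hi
  refine subsingleton_of_forall_eq 0 fun e => ?_
  obtain ⟨e', rfl⟩ := Ext.contravariant_sequence_exact₁ (ker_shortExact hp) _ e (add_comm 1 i)
    (h.elim _ _)
  rw [hP.elim e' 0]
  exact Ext.comp_zero (Ext.mk₀ (linearShortComplex _ p (LinearMap.exact_subtype_ker_map p)).f)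
    Y i i (zero_add i)

lemma IsGorensteinRing.exists_approximation (hR : IsGorensteinRing R) (k : Type u) [Field k]
    [Algebra k R] [FiniteDimensional k R] (n : ℕ) (M : Type u) [AddCommGroup M] [Module R M]
    [Module.Finite R M]
    (hM : ∀ i, n < i → Subsingleton (Ext (ModuleCat.of R M) (ModuleCat.of R R) i)) :
    ∃ (W : ModuleCat.{u} R) (π : W →ₗ[R] M), Function.Surjective π ∧ isGorensteinProjective R W ∧
      ∃ d, HasProjectiveDimensionLT (ModuleCat.of R (LinearMap.ker π)) d := by
  have := hR.noetherian_left
  induction n generalizing M with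
  | zero =>
    refine ⟨ModuleCat.of R M, LinearMap.id, Function.surjective_id, ⟨inferInstance, hM⟩, 0, ?_⟩
    rw [LinearMap.ker_id]
    exact (ModuleCat.isZero_of_subsingleton _).hasProjectiveDimensionLT_zero
  | succ n ih =>
    obtain ⟨m, p, hp⟩ := Module.Finite.exists_fin' R M
    -- An approximation `G` of the syzygy of `M` sits in a free module, and the cokernel of `G`
    -- in the sum of the two free modules approximates `M`.
    obtain ⟨G, π, hπ, ⟨hGfin, hG⟩, d, hd⟩ := ih (LinearMap.ker p) fun i hi =>
      subsingleton_ext_ker hp _ (by lia) (hM (i + 1) (by lia))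
    obtain ⟨q, j, hj, hext⟩ := hR.exists_free_hull k hG
    have hexact : Function.Exact ((LinearMap.ker p).subtype ∘ₗ π) p := by
      rw [LinearMap.exact_iff, LinearMap.range_comp, LinearMap.range_eq_top.2 hπ,
        Submodule.map_top, Submodule.range_subtype]
    rw [← LinearMap.ker_comp_of_ker_eq_bot π (LinearMap.ker p).ker_subtype] at hd
    exact ⟨ModuleCat.of R (LinearPushout ((LinearMap.ker p).subtype ∘ₗ π) j),
      LinearPushout.desc j hexact, LinearPushout.desc_surjective j hexact hp,
      LinearPushout.isGorensteinProjective j hG hj hext, d + 1,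
      LinearPushout.hasProjectiveDimensionLT_ker_desc j hexact hj d hd⟩

end Approximation

/-! ## Traces on Gorenstein projective modules -/

section Resolutions

variable {C : Type u} [Category.{v} C] [Preadditive C]

lemma le_isPresented {Q P : ObjectProperty C} [P.ContainsZero] : Q ≤ isPresented Q P := fun M hM =>
  let ⟨Z, hZ, hP⟩ := P.exists_prop_of_containsZero
  ⟨{ K := Z, T := M, i := 0, p := 𝟙 M, hK := hP, hT := hM
     zero := zero_comp
     mono := ⟨fun _ _ _ => hZ.eq_of_tgt _ _⟩
     exact := fun f hf => ⟨0, by rw [← Category.comp_id f, hf, zero_comp]⟩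
     lift := fun _ f => ⟨f, Category.comp_id f⟩ }⟩

/-- The objects with a resolution of length at most `n` by objects of `Q` which is exact relative
to `Q`. -/
def resolutionClass (Q : ObjectProperty C) : ℕ → ObjectProperty C
  | 0 => Q
  | n + 1 => isPresented Q (resolutionClass Q n)

variable {Q : ObjectProperty C} [Q.ContainsZero]

lemma resolutionClass_mono : Monotone (resolutionClass Q) := by
  refine monotone_nat_of_le_succ fun n => ?_
  induction n with
  | zero => exact le_isPresented (P := Q)
  | succ n ih => exact fun M ⟨P⟩ => ⟨{ P with hK := ih _ P.hK }⟩

lemma ObjectTrace.exists_resolution_extension {A : Type w} [AddCommGroup A] (t : ObjectTrace Q A)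
    (n : ℕ) : ∃ t' : ObjectTrace (resolutionClass Q n) A, ∀ (M : C) (hM : Q M) (f : M ⟶ M),
      t'.tr M (resolutionClass_mono n.zero_le M hM) f = t.tr M hM f := by
  induction n with
  | zero => exact ⟨t, fun _ _ _ => rfl⟩
  | succ n ih =>
    obtain ⟨t₁, h₁⟩ := ih
    obtain ⟨t₂, h₂⟩ := ObjectTrace.exists_extension (resolutionClass_mono n.zero_le) t₁
    exact ⟨t₂, fun M hM f => (h₂ M _ hM f).trans (h₁ M hM f)⟩

/-- The ring homomorphism between endomorphism rings induced by an additive functor. -/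
def endRingHom {D : Type*} [Category* D] [Preadditive D] (F : C ⥤ D) [F.Additive] (X : C) :
    End X →+* End (F.obj X) where
  __ := F.mapEnd X
  map_zero' := F.map_zero X X
  map_add' _ _ := F.map_add

/-- A trace on the objects of a full subcategory, regarded as a trace on a class of objects of the
ambient category. -/
def ObjectTrace.ofFullSubcategory {P : ObjectProperty C} {A : Type w} [AddCommGroup A]
    (t : ObjectTrace (⊤ : ObjectProperty P.FullSubcategory) A) : ObjectTrace P A where
  tr X hX f := t.tr ⟨X, hX⟩ trivial (ObjectProperty.homMk f)
  map_add _ _ _ _ := t.map_add _ _ _ _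
  comm X Y hX hY f g := t.comm ⟨X, hX⟩ ⟨Y, hY⟩ _ _ (ObjectProperty.homMk f) (ObjectProperty.homMk g)

namespace TracesKillNilpotents

variable {k : Type w} [Field k]

lemma fullSubcategory {P : ObjectProperty C} (h : TracesKillNilpotents k P) :
    TracesKillNilpotents k (⊤ : ObjectProperty P.FullSubcategory) := fun t X _ f hf =>
  h t.ofFullSubcategory X.obj X.property f.hom (hf.map (endRingHom P.ι X))

lemma of_isPresented {𝒰 : ObjectProperty C} (hP : ∀ X, isPresented 𝒰 𝒰 X)
    (h : TracesKillNilpotents k (⊤ : ObjectProperty C)) : TracesKillNilpotents k 𝒰 := by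
  intro t X hX f hf
  obtain ⟨t', ht'⟩ := t.exists_extension le_rfl
  rw [← ht' X (hP X) hX f]
  exact h ⟨fun Y _ => t'.tr Y (hP Y), fun Y _ => t'.map_add Y _,
    fun Y Z _ _ => t'.comm Y Z _ _⟩ X trivial f hf

end TracesKillNilpotents

end Resolutions

section GorensteinTrace

variable {R : Type u} [Ring R]

instance : (isGorensteinProjective R).ContainsZero :=
  ⟨⟨_, ModuleCat.isZero_of_subsingleton _, isGorensteinProjective_zero⟩⟩

lemma isPresented_of_surjective [IsNoetherianRing R] {P : ObjectProperty (ModuleCat.{u} R)}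
    {W M : Type u} [AddCommGroup W] [Module R W] [AddCommGroup M] [Module R M] {π : W →ₗ[R] M}
    (hπ : Function.Surjective π) (hW : isGorensteinProjective R (ModuleCat.of R W)) {d : ℕ}
    (hd : HasProjectiveDimensionLT (ModuleCat.of R (LinearMap.ker π)) (d + 1))
    (hP : P (ModuleCat.of R (LinearMap.ker π))) :
    isPresented (isGorensteinProjective R) P (ModuleCat.of R M) := by
  have : Module.Finite R W := hW.1
  have hS := ker_shortExact hπ
  exact ⟨{ K := ModuleCat.of R (LinearMap.ker π), T := ModuleCat.of R W
           i := ModuleCat.ofHom (LinearMap.ker π).subtype, p := ModuleCat.ofHom π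
           hK := hP, hT := hW
           zero := (linearShortComplex _ _ (LinearMap.exact_subtype_ker_map π)).zero
           mono := hS.mono_f
           exact := fun f hf => ⟨ModuleCat.ofHom (f.hom.codRestrict _ fun x =>
             LinearMap.congr_fun (congrArg ModuleCat.Hom.hom hf) x), rfl⟩
           lift := fun {T'} hT' f => ExtVanishing.exists_lift hS
             (ExtVanishing.of_projectiveDimension (X := T') hT'.2 d (LinearMap.ker π) hd) f }⟩

lemma resolutionClass_of_projectiveDimension [IsNoetherianRing R] (d : ℕ) (M : Type u)
    [AddCommGroup M] [Module R M] [Module.Finite R M]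
    (hM : HasProjectiveDimensionLT (ModuleCat.of R M) (d + 1)) :
    resolutionClass (isGorensteinProjective R) d (ModuleCat.of R M) := by
  induction d generalizing M with
  | zero =>
    have : Projective (ModuleCat.of R M) := inferInstance
    exact ⟨inferInstance, ExtVanishing.of_projective⟩
  | succ d ih =>
    obtain ⟨m, p, hp⟩ := Module.Finite.exists_fin' R M
    have h := (ker_shortExact hp).hasProjectiveDimensionLT_X₁ (d + 1)
      (inferInstanceAs (HasProjectiveDimensionLT (ModuleCat.of R (Fin m → R)) (d + 1))) hM
    exact isPresented_of_surjective hp ⟨inferInstance, ExtVanishing.of_projective⟩ h (ih _ h)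

lemma IsGorensteinRing.exists_resolutionClass (hR : IsGorensteinRing R) (k : Type u) [Field k]
    [Algebra k R] [FiniteDimensional k R] (M : Type u) [AddCommGroup M] [Module R M]
    [Module.Finite R M] : ∃ n, resolutionClass (isGorensteinProjective R) n (ModuleCat.of R M) := by
  have := hR.noetherian_left
  obtain ⟨n, hn⟩ := hR.injdim_left
  obtain ⟨W, π, hπ, hW, d, hd⟩ := hR.exists_approximation k n M fun i hi =>
    subsingleton_of_forall_eq 0 fun e =>
      e.eq_zero_of_hasInjectiveDimensionLT (n + 1) (by lia)
  have := hW.1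
  have hd' := hasProjectiveDimensionLT_of_ge (ModuleCat.of R (LinearMap.ker π)) d (d + 1) (by lia)
  exact ⟨d + 1,
    isPresented_of_surjective hπ hW hd' (resolutionClass_of_projectiveDimension d _ hd')⟩

-- `f` maps each `ker (f ^ (i + 1))` into `ker (f ^ i)`, so that its trace on the former is equal to
-- its trace on the latter.
lemma ObjectTrace.eq_zero_of_pow_eq_zero {Q : ObjectProperty (ModuleCat.{u} R)} {A : Type w}
    [AddCommGroup A] (t : ObjectTrace Q A) {X : ModuleCat.{u} R} (hX : Q X) (f : X →ₗ[R] X) {N : ℕ}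
    (hf : f ^ N = 0) (hQ : ∀ i ≤ N, Q (ModuleCat.of R (LinearMap.ker (f ^ i)))) :
    t.tr X hX (ModuleCat.ofHom f) = 0 := by
  let K (i : ℕ) : Submodule R X := LinearMap.ker (f ^ i)
  have hK (i : ℕ) (x : X) (hx : x ∈ K (i + 1)) : f x ∈ K i := by
    rwa [LinearMap.mem_ker, pow_succ] at hx
  have hle (i : ℕ) : K i ≤ K (i + 1) := fun x hx => by
    rw [LinearMap.mem_ker] at hx ⊢
    rw [pow_succ', Module.End.mul_apply, hx, f.map_zero]
  let r (i : ℕ) : K i →ₗ[R] K i := (f ∘ₗ (K i).subtype).codRestrict _ fun x => hK i x (hle i x.2)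
  have tr_eq_zero (i : ℕ) (hi : i ≤ N) : t.tr _ (hQ i hi) (ModuleCat.ofHom (r i)) = 0 := by
    induction i with
    | zero =>
      have : r 0 = 0 := LinearMap.ext fun x =>
        Subsingleton.elim (h := Submodule.subsingleton_iff_eq_bot.2 LinearMap.ker_id) _ _
      rw [this]
      exact t.map_zero _ _
    | succ i ih =>
      rw [← ih (by lia)]
      exact t.comm _ _ (hQ (i + 1) hi) (hQ i (by lia))
        (ModuleCat.ofHom ((f ∘ₗ (K (i + 1)).subtype).codRestrict (K i) fun x => hK i x x.2))
        (ModuleCat.ofHom (Submodule.inclusion (hle i)))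
  rw [← tr_eq_zero N le_rfl]
  exact t.comm X _ hX (hQ N le_rfl)
    (ModuleCat.ofHom (f.codRestrict (K N) fun x => by rw [LinearMap.mem_ker, hf]; rfl))
    (ModuleCat.ofHom (K N).subtype)

lemma IsGorensteinRing.trace_eq_zero (hR : IsGorensteinRing R) (k : Type u) [Field k]
    [Algebra k R] [FiniteDimensional k R] {A : Type w} [AddCommGroup A]
    (t : ObjectTrace (isGorensteinProjective R) A) (X : ModuleCat.{u} R)
    (hX : isGorensteinProjective R X) (f : X →ₗ[R] X) (hf : IsNilpotent f) :
    t.tr X hX (ModuleCat.ofHom f) = 0 := by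
  have := hR.noetherian_left
  have := hX.1
  obtain ⟨N, hN⟩ := hf
  choose n hn using fun i => hR.exists_resolutionClass k (LinearMap.ker (f ^ i))
  obtain ⟨t', ht'⟩ := t.exists_resolution_extension ((Finset.range (N + 1)).sup n)
  rw [← ht']
  exact t'.eq_zero_of_pow_eq_zero _ f hN fun i hi =>
    resolutionClass_mono (Finset.le_sup (f := n) (Finset.mem_range.2 (by lia))) _ (hn i)

lemma exists_field_finiteDimensional (k : Type w) [Field k] (R : Type u) [Ring R] [Algebra k R]
    [FiniteDimensional k R] :
    ∃ (F : Type u) (_ : Field F) (_ : Algebra F R), FiniteDimensional F R := by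
  rcases subsingleton_or_nontrivial R with h | h
  · let π : ULift.{u} ℚ →+* R :=
      ⟨⟨⟨0, Subsingleton.elim _ _⟩, fun _ _ => Subsingleton.elim _ _⟩,
        Subsingleton.elim _ _, fun _ _ => Subsingleton.elim _ _⟩
    let _ := π.toAlgebra' fun _ _ => Subsingleton.elim _ _
    exact ⟨ULift ℚ, inferInstance, inferInstance, inferInstance⟩
  · have : Small.{u} k := small_of_injective (algebraMap k R).injective
    let e := Shrink.algEquiv k k
    let _ : Algebra (Shrink.{u} k) R := Algebra.compHom R e.toRingHom
    have : IsScalarTower k (Shrink.{u} k) R := ⟨fun c s r => by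
      change e (c • s) • r = c • e s • r
      rw [map_smul, smul_assoc]⟩
    exact ⟨Shrink.{u} k, inferInstance, inferInstance,
      Module.Finite.of_restrictScalars_finite k _ R⟩

lemma IsGorensteinRing.tracesKillNilpotents (hR : IsGorensteinRing R) (k : Type w) [Field k]
    [Algebra k R] [FiniteDimensional k R] :
    TracesKillNilpotents k (isGorensteinProjective R) := by
  obtain ⟨F, _, _, _⟩ := exists_field_finiteDimensional k R
  exact fun t X hX f hf => hR.trace_eq_zero F t X hX f.hom (hf.map X.endRingEquiv)

end GorensteinTrace

/-! ## Passage to the stable category -/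

section FullSubcategory

variable {C : Type u} [Category.{v} C]

instance [IsIdempotentComplete C] (𝒯 : ObjectProperty C) [𝒯.IsStableUnderRetracts] :
    IsIdempotentComplete 𝒯.FullSubcategory where
  idempotents_split X p hp := by
    obtain ⟨Y, i, e, h₁, h₂⟩ := IsIdempotentComplete.idempotents_split X.obj p.hom
      (by rw [← ObjectProperty.FullSubcategory.comp_hom, hp])
    exact ⟨⟨Y, 𝒯.prop_of_retract ⟨i, e, h₁⟩ X.property⟩, ObjectProperty.homMk i,
      ObjectProperty.homMk e, ObjectProperty.hom_ext _ h₁, ObjectProperty.hom_ext _ h₂⟩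

lemma IsClusterTiltingSubcategory.mem_of_isExactTriangle [Preadditive C] {S : C ⥤ C}
    {𝒯 : ObjectProperty C} (h𝒯 : IsClusterTiltingSubcategory S 𝒯) {A B D : C} {j : A ⟶ B}
    {q : B ⟶ D} {δ : D ⟶ S.obj A} (ht : IsExactTriangle S j q δ) (hB : 𝒯 B)
    (hq : ∀ {Y : C} (_ : 𝒯 Y) (g : Y ⟶ D), ∃ g', g' ≫ q = g) : 𝒯 A := by
  refine h𝒯.maximal _ fun Y hY g => ?_
  obtain ⟨g', rfl⟩ := ht.exact_susp g (h𝒯.rigid hY hB _)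
  obtain ⟨g'', rfl⟩ := hq hY g'
  rw [Category.assoc, ht.comp_right, comp_zero]

end FullSubcategory

section Stable

variable {E : Type u} [Category.{v} E] [Preadditive E] [HasFiniteBiproducts E]
  (𝓕 : FrobeniusStructure E)

namespace FrobeniusStructure

instance [HasZeroObject E] : HasZeroObject 𝓕.Stable :=
  let ⟨Z, hZ⟩ := HasZeroObject.zero (C := E)
  ⟨𝓕.toStable.obj Z, 𝓕.toStable.map_isZero hZ⟩

instance [HasBinaryBiproducts E] : HasBinaryBiproducts 𝓕.Stable :=
  ⟨fun X Y => HasBinaryBiproduct.mk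
    { bicone := 𝓕.toStable.mapBinaryBicone (BinaryBiproduct.bicone X.as Y.as)
      isBilimit := isBinaryBilimitOfTotal _ (by
        have := congrArg 𝓕.toStable.map (biprod.total (X := X.as) (Y := Y.as))
        rwa [Functor.map_add, Functor.map_comp, Functor.map_comp, 𝓕.toStable.map_id] at this) }⟩

lemma hasFiniteBiproducts_stable [HasZeroObject E] [HasBinaryBiproducts E] :
    HasFiniteBiproducts 𝓕.Stable :=
  have : HasTerminal 𝓕.Stable := inferInstance
  have : HasFiniteProducts 𝓕.Stable := hasFiniteProducts_of_has_binary_and_terminal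
  HasFiniteBiproducts.of_hasFiniteProducts

variable (k : Type w) [Field k] [Linear k E]

instance [∀ X Y : E, FiniteDimensional k (X ⟶ Y)] (X Y : 𝓕.Stable) : FiniteDimensional k (X ⟶ Y) :=
  let ρ : (X.as ⟶ Y.as) →ₗ[k] (X ⟶ Y) :=
    { toFun := fun f => 𝓕.toStable.map f
      map_add' := fun _ _ => 𝓕.toStable.map_add
      map_smul' := fun _ _ => rfl }
  Module.Finite.of_surjective ρ (𝓕.toStable.map_surjective (X := X.as) (Y := Y.as))

lemma isIdempotentComplete_stable [IsIdempotentComplete E]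
    [∀ X Y : E, FiniteDimensional k (X ⟶ Y)] : IsIdempotentComplete 𝓕.Stable where
  idempotents_split X p hp := by
    obtain ⟨a, rfl⟩ := (𝓕.toStable.map_surjective (X := X.as) (Y := X.as)) p
    have : FiniteDimensional k (End X.as) := inferInstanceAs (FiniteDimensional k (X.as ⟶ X.as))
    obtain ⟨e, he, hea⟩ := exists_isIdempotentElem_lift k (endRingHom 𝓕.toStable X.as) a hp
    obtain ⟨Y, i, q, h₁, h₂⟩ := IsIdempotentComplete.idempotents_split X.as e he
    refine ⟨𝓕.toStable.obj Y, 𝓕.toStable.map i, 𝓕.toStable.map q, ?_, ?_⟩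
    · exact (𝓕.toStable.map_comp i q).symm.trans ((congrArg _ h₁).trans (𝓕.toStable.map_id Y))
    · exact (𝓕.toStable.map_comp q i).symm.trans ((congrArg _ h₂).trans hea)

lemma tracesKillNilpotents_stable [∀ X Y : E, FiniteDimensional k (X ⟶ Y)]
    {𝒯 : ObjectProperty 𝓕.Stable} (h : TracesKillNilpotents k (𝒯.inverseImage 𝓕.toStable)) :
    TracesKillNilpotents k 𝒯 := by
  intro t X hX f hf
  obtain ⟨a, rfl⟩ := (𝓕.toStable.map_surjective (X := X.as) (Y := X.as)) f
  have : FiniteDimensional k (End X.as) := inferInstanceAs (FiniteDimensional k (X.as ⟶ X.as))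
  obtain ⟨e, he, hea : 𝓕.toStable.map e = 𝓕.toStable.map a⟩ :=
    exists_isNilpotent_lift k (endRingHom 𝓕.toStable X.as) a hf
  rw [← hea]
  exact h (t.comap 𝓕.toStable) X.as hX e he

variable [HasBinaryBiproducts E]

/-- Adding a projective summand does not change an object of the stable category; only one of the
two composites is needed. -/
def retractBiprodProj (M : E) {P : E} (hP : 𝓕.IsProj P) :
    Retract (𝓕.toStable.obj (M ⊞ P)) (𝓕.toStable.obj M) where
  i := 𝓕.toStable.map biprod.fst
  r := 𝓕.toStable.map biprod.inl
  retract := by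
    rw [← 𝓕.toStable.map_id, toStable_comp_eq_iff]
    refine ⟨P, -biprod.snd, biprod.inr, hP, ?_⟩
    rw [← biprod.total, Preadditive.neg_comp, sub_add_cancel_left]

lemma exists_isDeflation_approximation {𝒯 : ObjectProperty 𝓕.Stable} [𝒯.IsStableUnderRetracts]
    (hT : IsFunctoriallyFinite 𝒯) (X : E) :
    ∃ (T : E) (q : T ⟶ X), 𝓕.IsDeflation q ∧ 𝒯 (𝓕.toStable.obj T) ∧
      ∀ {Y : 𝓕.Stable} (_ : 𝒯 Y) (g : Y ⟶ 𝓕.toStable.obj X),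
        ∃ g' : Y ⟶ 𝓕.toStable.obj T, g' ≫ 𝓕.toStable.map q = g := by
  obtain ⟨M, f, hM, happ⟩ := hT.1 (𝓕.toStable.obj X)
  obtain ⟨f, rfl⟩ := (𝓕.toStable.map_surjective (X := M.as) (Y := X)) f
  obtain ⟨P, p, hP, hp⟩ := 𝓕.enough_proj X
  refine ⟨M.as ⊞ P, biprod.desc f p, 𝓕.isDeflation_desc f hp,
    𝒯.prop_of_retract (𝓕.retractBiprodProj M.as hP) hM, fun {Y} hY g => ?_⟩
  obtain ⟨g', rfl⟩ := happ Y g hY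
  refine ⟨g' ≫ 𝓕.toStable.map (biprod.inl : M.as ⟶ M.as ⊞ P), ?_⟩
  rw [Category.assoc, ← Functor.map_comp, biprod.inl_desc]

lemma isPresented_of_isClusterTilting {𝒯 : ObjectProperty 𝓕.Stable}
    (h𝒯 : IsClusterTiltingSubcategory 𝓕.suspension 𝒯) (X : E) :
    isPresented (𝒯.inverseImage 𝓕.toStable) (𝒯.inverseImage 𝓕.toStable) X := by
  have : 𝒯.IsStableUnderRetracts := ⟨h𝒯.isAdditiveClass.retract⟩
  obtain ⟨T, q, hq, hT, hlift⟩ := 𝓕.exists_isDeflation_approximation h𝒯.functoriallyFinite X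
  obtain ⟨K, i, h, hc⟩ := id hq
  obtain ⟨c, hc'⟩ := 𝓕.exists_isConnectingMap hc
  have hK := h𝒯.mem_of_isExactTriangle (IsConnectingMap.isExactTriangle hc hc') hT hlift
  exact ⟨{ K := K, T := T, i := i, p := q, hK := hK, hT := hT
           zero := h
           mono := ExactStructure.mono_of_conflation hc
           exact := ExactStructure.exists_lift hc
           lift := fun {T'} hT' g =>
             let ⟨g', hg'⟩ := hlift hT' (𝓕.toStable.map g)
             exists_lift_of_stable_lift g hq g' hg' }⟩

end FrobeniusStructure

end Stable

section GorensteinProjective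

variable {R : Type u} [Ring R]

instance : (isGorensteinProjective R).IsStableUnderRetracts where
  of_retract r hY :=
    have := hY.1
    ⟨Module.Finite.of_surjective r.r.hom fun x =>
      ⟨r.i.hom x, LinearMap.congr_fun (congrArg ModuleCat.Hom.hom r.retract) x⟩,
      ExtVanishing.of_retract_left r hY.2⟩

open ModuleCat in
instance (k : Type w) [Field k] [Algebra k R] [FiniteDimensional k R] (X Y : GP R) :
    FiniteDimensional k (X ⟶ Y) := by
  have := X.property.1
  have := Y.property.1
  have : FiniteDimensional k X.obj := Module.Finite.trans R X.obj
  have : FiniteDimensional k Y.obj := Module.Finite.trans R Y.obj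
  let ρ : (X ⟶ Y) →ₗ[k] (X.obj →ₗ[k] Y.obj) :=
    { toFun := fun f => f.hom.hom.restrictScalars k
      map_add' := fun _ _ => rfl
      map_smul' := fun _ _ => rfl }
  refine FiniteDimensional.of_injective ρ fun f g h => ?_
  exact ObjectProperty.hom_ext _ <|
    ModuleCat.hom_ext (LinearMap.ext fun x => LinearMap.congr_fun h x)

lemma IsGorensteinRing.tracesKillNilpotents_stable (hR : IsGorensteinRing R)
    (𝓕 : FrobeniusStructure (GP R)) (k : Type w) [Field k] [Algebra k R] [FiniteDimensional k R]
    {𝒯 : ObjectProperty 𝓕.Stable}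
    (h𝒯 : ∀ X, isPresented (𝒯.inverseImage 𝓕.toStable) (𝒯.inverseImage 𝓕.toStable) X) :
    TracesKillNilpotents k 𝒯 :=
  𝓕.tracesKillNilpotents_stable k (.of_isPresented h𝒯 (hR.tracesKillNilpotents k).fullSubcategory)

end GorensteinProjective

/-! ## Quivers -/

section Quivers

variable {C : Type u} [Category.{v} C] [Preadditive C]

lemma IsRadicalSqHom.comp_right {X Y Z : C} {f : X ⟶ Y} (hf : IsRadicalSqHom f) (g : Y ⟶ Z) :
    IsRadicalSqHom (f ≫ g) := by
  obtain ⟨W, a, b, ha, hb, rfl⟩ := hf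
  exact ⟨W, a, b ≫ g, ha, hb.comp_right g, (Category.assoc _ _ _).symm⟩

lemma IsRadicalSqHom.comp_left {X Y Z : C} {g : Y ⟶ Z} (hg : IsRadicalSqHom g) (f : X ⟶ Y) :
    IsRadicalSqHom (f ≫ g) := by
  obtain ⟨W, a, b, ha, hb, rfl⟩ := hg
  exact ⟨W, f ≫ a, b, ha.comp_left f, hb, Category.assoc _ _ _⟩

lemma nonempty_iso_of_indecClass_eq {X Y : (isIndecomposable C).FullSubcategory}
    (h : (⟦X⟧ : IndecClass C) = ⟦Y⟧) : Nonempty (X.obj ≅ Y.obj) :=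
  (Quotient.exact h).map (isIndecomposable C).ι.mapIso

lemma categoryQuiver_noLoops (h : ∀ X : C, isIndecomposable C X → ∀ f : X ⟶ X,
    IsRadicalHom f → IsRadicalSqHom f) : (categoryQuiver C).NoLoops := by
  rintro x ⟨X, Y, hX, hY, f, hf, hf'⟩
  obtain ⟨e⟩ := nonempty_iso_of_indecClass_eq (hX.trans hY.symm)
  have hfe := (h X.obj X.property (f ≫ e.inv) (hf.comp_right _)).comp_right e.hom
  rw [Category.assoc, e.inv_hom_id, Category.comp_id] at hfe
  exact hf' hfe

lemma categoryQuiver_noTwoCycles (h : ∀ X Y : C, isIndecomposable C X → isIndecomposable C Y →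
    ∀ (b : X ⟶ Y) (a : Y ⟶ X), IsRadicalHom b → IsRadicalSqHom b ∨ IsRadicalSqHom a) :
    (categoryQuiver C).NoTwoCycles := by
  rintro x y ⟨⟨X, Y, hX, hY, b, hb, hb'⟩, ⟨Y', X', hY', hX', a, -, ha'⟩⟩
  obtain ⟨e⟩ := nonempty_iso_of_indecClass_eq (hX.trans hX'.symm)
  obtain ⟨e'⟩ := nonempty_iso_of_indecClass_eq (hY.trans hY'.symm)
  rcases h _ _ X.property Y.property b (e'.hom ≫ a ≫ e.inv) hb with h | h
  · exact hb' h
  · exact ha' (by simpa using (h.comp_left e'.inv).comp_right e.hom)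

variable {𝒯 : ObjectProperty C}

lemma isRadicalHom_hom_iff {X Y : 𝒯.FullSubcategory} (f : X ⟶ Y) :
    IsRadicalHom f.hom ↔ IsRadicalHom f := by
  constructor
  · intro h g
    have : IsIso (𝒯.ι.map (𝟙 X - f ≫ g)) := h g.hom
    exact isIso_of_reflects_iso _ 𝒯.ι
  · intro h g
    have := h (ObjectProperty.homMk g)
    exact inferInstanceAs (IsIso (𝒯.ι.map (𝟙 X - f ≫ ObjectProperty.homMk g)))

lemma IsRadicalSqIn.isRadicalSqHom {X Y : 𝒯.FullSubcategory} {f : X ⟶ Y}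
    (hf : IsRadicalSqIn 𝒯 f.hom) : IsRadicalSqHom f := by
  obtain ⟨Z, g, h, hZ, hg, hh, hgh⟩ := hf
  exact ⟨⟨Z, hZ⟩, ObjectProperty.homMk g, ObjectProperty.homMk h,
    (isRadicalHom_hom_iff (X := X) (Y := ⟨Z, hZ⟩) (ObjectProperty.homMk g)).1 hg,
    (isRadicalHom_hom_iff (X := ⟨Z, hZ⟩) (Y := Y) (ObjectProperty.homMk h)).1 hh,
    ObjectProperty.hom_ext _ hgh⟩

variable (k : Type w) [Field k] [IsAlgClosed k] [Linear k C] [IsIdempotentComplete C]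
  [∀ X Y : C, FiniteDimensional k (X ⟶ Y)]

lemma isIndecomposable.isLocalObject {X : C} (hX : isIndecomposable C X) : IsLocalObject k X :=
  isLocalObject_of_idempotents hX.1 (isIndecomposable_idempotent hX)

lemma isLocalObject_of_isIndecomposable_fullSubcategory [HasBinaryBiproducts C]
    (h𝒯 : IsAdditiveClass 𝒯) {X : 𝒯.FullSubcategory}
    (hX : isIndecomposable 𝒯.FullSubcategory X) : IsLocalObject k X.obj := by
  have : 𝒯.IsStableUnderRetracts := ⟨h𝒯.retract⟩
  refine isLocalObject_of_idempotents (fun h => hX.1 ?_) fun e he => ?_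
  · rw [IsZero.iff_id_eq_zero] at h ⊢
    exact ObjectProperty.hom_ext _ h
  · have hidem := isIndecomposable_idempotent hX (ObjectProperty.homMk e)
      (ObjectProperty.hom_ext _ he)
    exact hidem.imp (congrArg 𝒯.ι.map) (congrArg 𝒯.ι.map)

lemma subcategoryQuiver_noLoops [HasBinaryBiproducts C] (h𝒯 : IsAdditiveClass 𝒯)
    (hk : TracesKillNilpotents k 𝒯) : (subcategoryQuiver 𝒯).NoLoops :=
  categoryQuiver_noLoops fun X hX f hf => IsRadicalSqIn.isRadicalSqHom <|
    isRadicalSqIn_of_isRadicalHom_endo h𝒯 hk X.property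
      (isLocalObject_of_isIndecomposable_fullSubcategory k h𝒯 hX) f.hom
      ((isRadicalHom_hom_iff f).2 hf)

lemma categoryQuiver_noLoops_of_traces [HasBinaryBiproducts C]
    (hk : TracesKillNilpotents k (⊤ : ObjectProperty C)) : (categoryQuiver C).NoLoops :=
  categoryQuiver_noLoops fun _ hX f hf =>
    let ⟨Z, g, h, _, hg, hh, hgh⟩ := isRadicalSqIn_of_isRadicalHom_endo (𝒯 := ⊤)
      ⟨fun _ _ => trivial, fun _ _ => trivial⟩ hk trivial (hX.isLocalObject k) f hf
    ⟨Z, g, h, hg, hh, hgh⟩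

end Quivers

/-! ## Cluster-tilting objects -/

section ClusterTiltingObject

variable {C : Type u} [Category.{v} C] [Preadditive C]

namespace addClosure

variable {M N : C}

lemma exists_lift (hN : addClosure M N) {Y X : C} {f : Y ⟶ X}
    (hf : ∀ h : M ⟶ X, ∃ g, g ≫ f = h) (h : N ⟶ X) : ∃ g, g ≫ f = h := by
  obtain ⟨n, b, ⟨hb⟩, ⟨r⟩⟩ := hN
  choose g hg using fun j => hf (b.ι j ≫ r.r ≫ h)
  refine ⟨r.i ≫ ∑ j, b.π j ≫ g j, ?_⟩
  have hsum : (∑ j, b.π j ≫ g j) ≫ f = r.r ≫ h := by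
    rw [← Category.id_comp (r.r ≫ h), ← IsBilimit.total hb]
    simp only [Preadditive.sum_comp, Category.assoc, hg]
  rw [Category.assoc, hsum, r.retract_assoc]

lemma exists_desc (hN : addClosure M N) {X Y : C} {f : X ⟶ Y}
    (hf : ∀ h : X ⟶ M, ∃ g, f ≫ g = h) (h : X ⟶ N) : ∃ g, f ≫ g = h := by
  obtain ⟨n, b, ⟨hb⟩, ⟨r⟩⟩ := hN
  choose g hg using fun j => hf (h ≫ r.i ≫ b.π j)
  refine ⟨(∑ j, g j ≫ b.ι j) ≫ r.r, ?_⟩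
  have hsum : f ≫ ∑ j, g j ≫ b.ι j = h ≫ r.i := by
    rw [← Category.comp_id (h ≫ r.i), ← IsBilimit.total hb]
    simp only [Preadditive.comp_sum, ← Category.assoc, hg]
  rw [reassoc_of% hsum, r.retract, Category.comp_id]

lemma hom_eq_zero (hN : addClosure M N) {X : C} (hM : ∀ f : M ⟶ X, f = 0) (f : N ⟶ X) :
    f = 0 := by
  obtain ⟨g, hg⟩ := hN.exists_lift (f := (0 : M ⟶ X)) (fun h => ⟨0, by rw [hM h, comp_zero]⟩) f
  rw [← hg, comp_zero]

lemma hom_map_eq_zero {X : C} {S : C ⥤ C} [S.Additive] (hX : addClosure M X)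
    (hN : addClosure M N) (hM : ∀ f : M ⟶ S.obj M, f = 0) (f : X ⟶ S.obj N) : f = 0 := by
  obtain ⟨n, b, ⟨hb⟩, ⟨r⟩⟩ := hN
  have hpt : f ≫ S.map r.i = 0 := by
    rw [← Category.comp_id (f ≫ S.map r.i), ← S.map_id, ← IsBilimit.total hb, S.map_sum,
      Preadditive.comp_sum]
    refine Finset.sum_eq_zero fun j _ => ?_
    rw [S.map_comp, ← Category.assoc, hX.hom_eq_zero hM (_ ≫ S.map (b.π j)), zero_comp]
  rw [← Category.comp_id f, ← S.map_id, ← r.retract, S.map_comp, reassoc_of% hpt, zero_comp]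

end addClosure

lemma addClosure_self (M : C) : addClosure M M :=
  ⟨1, biproduct.bicone _, ⟨biproduct.isBilimit _⟩,
    ⟨{ i := biproduct.ι (fun _ : Fin 1 => M) 0, r := biproduct.π (fun _ : Fin 1 => M) 0 }⟩⟩

variable [HasFiniteBiproducts C]

lemma addClosure_biproduct (M : C) (n : ℕ) : addClosure M (⨁ fun _ : Fin n => M) :=
  ⟨n, biproduct.bicone _, ⟨biproduct.isBilimit _⟩, ⟨Retract.refl _⟩⟩

lemma isFunctoriallyFinite_addClosure (k : Type w) [Field k] [Linear k C]
    [∀ X Y : C, FiniteDimensional k (X ⟶ Y)] (M : C) : IsFunctoriallyFinite (addClosure M) := by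
  refine ⟨fun X => ?_, fun X => ?_⟩
  · let β := Module.finBasis k (M ⟶ X)
    refine ⟨_, biproduct.desc β, addClosure_biproduct M _, fun N h hN => hN.exists_lift ?_ h⟩
    refine fun h => ⟨biproduct.lift fun l => β.repr h l • 𝟙 M, ?_⟩
    simpa only [biproduct.lift_desc, Linear.smul_comp, Category.id_comp] using β.sum_repr h
  · let β := Module.finBasis k (X ⟶ M)
    refine ⟨_, biproduct.lift β, addClosure_biproduct M _, fun N h hN => hN.exists_desc ?_ h⟩
    refine fun h => ⟨biproduct.desc fun l => β.repr h l • 𝟙 M, ?_⟩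
    simpa only [biproduct.lift_desc, Linear.comp_smul, Category.comp_id] using β.sum_repr h

lemma IsClusterTiltingObject.isClusterTiltingSubcategory (k : Type w) [Field k] [Linear k C]
    [∀ X Y : C, FiniteDimensional k (X ⟶ Y)] {S : C ⥤ C} [S.Additive] {M : C}
    (hM : IsClusterTiltingObject S M) : IsClusterTiltingSubcategory S (addClosure M) where
  rigid _ _ hX hY f := hX.hom_map_eq_zero hY hM.rigid f
  maximal X h := hM.maximal X (h M (addClosure_self M))
  functoriallyFinite := isFunctoriallyFinite_addClosure k M

end ClusterTiltingObject

section StableGorensteinProjective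

variable {k : Type w} [Field k] [IsAlgClosed k] {R : Type u} [Ring R] [Algebra k R]
  [FiniteDimensional k R] (𝓕 : FrobeniusStructure (GP R))

lemma IsGorensteinRing.categoryQuiver_stable_noLoops (hR : IsGorensteinRing R)
    (k : Type w) [Field k] [IsAlgClosed k] [Algebra k R] [FiniteDimensional k R] :
    (categoryQuiver 𝓕.Stable).NoLoops :=
  have := 𝓕.isIdempotentComplete_stable k
  categoryQuiver_noLoops_of_traces k <| hR.tracesKillNilpotents_stable 𝓕 k fun _ =>
    le_isPresented (P := ⊤) (Q := ⊤) _ trivial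

variable {𝓕}

lemma IsClusterTiltingSubcategory.noLoops_and_noTwoCycles (hR : IsGorensteinRing R)
    (hcy : IsTwoCalabiYau k 𝓕.suspension) {𝒯 : ObjectProperty 𝓕.Stable}
    (h𝒯 : IsClusterTiltingSubcategory 𝓕.suspension 𝒯) :
    (subcategoryQuiver 𝒯).NoLoops ∧ (subcategoryQuiver 𝒯).NoTwoCycles := by
  have := 𝓕.isIdempotentComplete_stable k
  have hk : TracesKillNilpotents k 𝒯 :=
    hR.tracesKillNilpotents_stable 𝓕 k (𝓕.isPresented_of_isClusterTilting h𝒯)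
  have hlocal {X : 𝒯.FullSubcategory} (hX : isIndecomposable 𝒯.FullSubcategory X) :
      IsLocalObject k X.obj :=
    isLocalObject_of_isIndecomposable_fullSubcategory k h𝒯.isAdditiveClass hX
  obtain ⟨τ⟩ := hcy.exists_serreTrace
  have := hcy.1
  have := isEquivalence_of_comp_self 𝓕.suspension
  refine ⟨subcategoryQuiver_noLoops k h𝒯.isAdditiveClass hk,
    categoryQuiver_noTwoCycles fun X Y hX hY b a hb => ?_⟩
  exact (isRadicalSqIn_or_of_two_cycle τ h𝒯 𝓕.hasExactTriangles hk (hlocal hX) X.property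
    (hlocal hY) Y.property (a := a.hom) ((isRadicalHom_hom_iff b).2 hb)).imp
    IsRadicalSqIn.isRadicalSqHom IsRadicalSqIn.isRadicalSqHom

end StableGorensteinProjective

end

theorem theorem2p11 {k : Type w} [Field k] [IsAlgClosed k] {R : Type u} [Ring R] [Algebra k R]
    [FiniteDimensional k R] (hR : IsGorensteinRing R) (𝓕 : FrobeniusStructure (GP R)) :
    (categoryQuiver 𝓕.Stable).NoLoops ∧
    (IsTwoCalabiYau k 𝓕.suspension →
      (∀ M : 𝓕.Stable, IsClusterTiltingObject 𝓕.suspension M →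
        (objectQuiver M).NoLoops ∧ (objectQuiver M).NoTwoCycles) ∧
      (∀ 𝒯 : ObjectProperty 𝓕.Stable, IsClusterTiltingSubcategory 𝓕.suspension 𝒯 →
        (subcategoryQuiver 𝒯).NoLoops ∧ (subcategoryQuiver 𝒯).NoTwoCycles)) := by
  refine ⟨hR.categoryQuiver_stable_noLoops 𝓕 k, fun hcy => ⟨fun M hM => ?_, fun 𝒯 h𝒯 =>
    h𝒯.noLoops_and_noTwoCycles hR hcy⟩⟩
  have := 𝓕.hasFiniteBiproducts_stable
  exact (hM.isClusterTiltingSubcategory k).noLoops_and_noTwoCycles hR hcy
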